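/- Let $\mathbb T\subset\mathbb R$ be an interval (finite or infinite), let $\Theta\subset\mathbb R^d$ be open, convex and bounded, and for $\vartheta\in\Theta$ let $\lambda(\vartheta,\cdot):\mathbb T\to(0,\infty)$ be a Borel function with $\int_{\mathbb T}\lambda(\vartheta,t)\,dt<\infty$. Let $\ell=\ln\lambda$, let a dot denote the gradient in $\vartheta$, and let $$\mathbf I(\vartheta)=\int_{\mathbb T}\dot\lambda(\vartheta,t)\dot\lambda(\vartheta,t)^{\tau}\lambda(\vartheta,t)^{-1}\,dt$$ be the Fisher information matrix. Let $\vartheta_0\in\Theta$ be the true value and let $X_1,X_2,\ldots$ be independent Poisson processes on $\mathbb T$ with intensity function $\lambda(\vartheta_0,\cdot)$; $X_j(t)$ is the number of events of the $j$-th process in $\mathbb T\cap(-\infty,t]$. Assume: ($\mathcal L_0$) for every $t\in\mathbb T$ the function $\vartheta\mapsto\ell(\vartheta,t)$ has continuous derivatives on $\Theta$ up to order three, the derivatives of orders one, two and three are bounded uniformly in $(\vartheta,t)\in\Theta\times\mathbb T$, and $\inf_{\vartheta\in\Theta}\inf_{|\mu|=1}\mu^\tau\mathbf I(\vartheta)\mu>0$;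 ($\mathcal P_0$) for each $n$ there is a preliminary estimator $\bar\vartheta_n$, a function of $X_1,\ldots,X_n$ with values in $\mathbb R^d$, such that $\bar\vartheta_n\to\vartheta_0$ in probability and $\sqrt n(\bar\vartheta_n-\vartheta_0)$ is bounded in probability. Let $\delta\in(1/2,1)$ and $N=[n^\delta]$, where $[a]$ is the integer part of $a$. The one-step MLE-process is $$\vartheta^\star_{k,n}=\bar\vartheta_N+\mathbf I(\bar\vartheta_N)^{-1}\frac1k\sum_{j=N+1}^{k}\int_{\mathbb T}\dot\ell(\bar\vartheta_N,t)\,\bigl[dX_j(t)-\lambda(\bar\vartheta_N,t)\,dt\bigr],\qquad k=N+1,\ldots,n,$$ if $\bar\vartheta_N\in\Theta$, and $\vartheta^\star_{k,n}=\bar\vartheta_N$ otherwise. Then: 1. for $N<k\le n$ the estimator $\vartheta^\star_{k,n}$ is a function of the first $k$ observations $X_1,\ldots,X_k$ only; 2. the process is consistent: for every $\varepsilon>0$, $\ P\bigl(\max_{N<k\le n}|\vartheta^\star_{k,n}-\vartheta_0|\ge\varepsilon\bigr)\to0$ as $n\to\infty$; in particular each $\vartheta^\star_{k,n}$ with $k=k_n$,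 $N<k_n\le n$, converges to $\vartheta_0$ in probability; 3. it is asymptotically normal: for every $s\in(0,1]$, with $k=[sn]$, $$\sqrt k\,\bigl(\vartheta^\star_{k,n}-\vartheta_0\bigr)\Longrightarrow\mathcal N\bigl(0,\mathbf I(\vartheta_0)^{-1}\bigr)\qquad(n\to\infty).$$ (For the finitely many $n$ with $[sn]\le N$ the sum is empty and $\vartheta^\star_{k,n}$ is read as $\bar\vartheta_N$.) -/

import Mathlib

open MeasureTheory ProbabilityTheory Filter Topology

noncomputable section

/-- The family `lam θ t`, `θ ∈ Θ`, `t ∈ T`, is a family of intensity functions on the observation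
window `T`: each `lam θ` is positive, Borel on `T` and has a finite integral over `T`.
Values of `lam` outside `Θ × T` play no role. -/
structure IsIntensityFamily {d : ℕ} (T : Set ℝ) (Θ : Set (EuclideanSpace ℝ (Fin d)))
    (lam : EuclideanSpace ℝ (Fin d) → ℝ → ℝ) : Prop where
  pos : ∀ θ ∈ Θ, ∀ t ∈ T, 0 < lam θ t
  measurable : ∀ θ ∈ Θ, Measurable (T.domRestrict (lam θ))
  integrableOn : ∀ θ ∈ Θ, IntegrableOn (lam θ) T

/-- `X` is a Poisson process on the window `T` with intensity function `r`, defined on the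
probability space `(Ω, P)`. The value `X ω t` is the number of events in `T ∩ (-∞, t]`; a path is
thus given for all real `t` (with no events outside `T`), and is nondecreasing and
right-continuous, which is what `StieltjesFunction ℝ` bundles. -/
structure IsPoissonProcess {Ω : Type*} [MeasurableSpace Ω] (P : Measure Ω)
    (T : Set ℝ) (r : ℝ → ℝ) (X : Ω → StieltjesFunction ℝ) : Prop where
  measurable : ∀ t : ℝ, Measurable (fun ω => X ω t)
  counting : ∀ ω, ∀ t : ℝ, ∃ m : ℕ, X ω t = m
  start : ∀ᵐ ω ∂P, Tendsto (fun t : ℝ => X ω t) atBot (𝓝 0)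
  increment_law : ∀ a b : ℝ, a ≤ b →
    HasLaw (fun ω => X ω b - X ω a)
      ((poissonMeasure (∫ t in Set.Ioc a b ∩ T, r t).toNNReal).map (Nat.cast : ℕ → ℝ)) P
  indep_increments : HasIndepIncrements (fun (t : ℝ) ω => X ω t) P

/-- The σ-algebra generated by the process `Y`. -/
abbrev pathSigma {Ω : Type*} (Y : Ω → StieltjesFunction ℝ) : MeasurableSpace Ω :=
  ⨆ t : ℝ, MeasurableSpace.comap (fun ω => Y ω t) (borel ℝ)

/-- The σ-algebra generated by the first `n` observations `X 0, …, X (n - 1)`. -/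
abbrev obsSigma {Ω : Type*} (X : ℕ → Ω → StieltjesFunction ℝ) (n : ℕ) : MeasurableSpace Ω :=
  ⨆ j ∈ Finset.range n, pathSigma (X j)

/-- The observations `X 0, X 1, …` are independent Poisson processes on `T` with the same
intensity function `r`. -/
structure IsPoissonSample {Ω : Type*} [MeasurableSpace Ω] (P : Measure Ω)
    (T : Set ℝ) (r : ℝ → ℝ) (X : ℕ → Ω → StieltjesFunction ℝ) : Prop where
  poisson : ∀ j, IsPoissonProcess P T r (X j)
  indep : iIndep (fun j => pathSigma (X j)) P

/-- The Fisher information matrix `∫_T (∂_θ lam) (∂_θ lam)ᵀ / lam dt`. -/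
def fisherInfo {d : ℕ} (T : Set ℝ) (lam : EuclideanSpace ℝ (Fin d) → ℝ → ℝ)
    (θ : EuclideanSpace ℝ (Fin d)) : Matrix (Fin d) (Fin d) ℝ :=
  Matrix.of fun i j => ∫ t in T,
    gradient (fun θ' => lam θ' t) θ i * gradient (fun θ' => lam θ' t) θ j / lam θ t

/-- The score function: the gradient in `θ` of `log lam θ t`. -/
def score {d : ℕ} (lam : EuclideanSpace ℝ (Fin d) → ℝ → ℝ)
    (θ : EuclideanSpace ℝ (Fin d)) (t : ℝ) : EuclideanSpace ℝ (Fin d) :=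
  gradient (fun θ' => Real.log (lam θ' t)) θ

/-- The regularity conditions on the intensities: `log lam θ t` has three continuous derivatives
in `θ`, bounded uniformly in `θ ∈ Θ` and `t ∈ T`, and the Fisher information is uniformly
nondegenerate on `Θ`. -/
structure RegularityL0 {d : ℕ} (T : Set ℝ) (Θ : Set (EuclideanSpace ℝ (Fin d)))
    (lam : EuclideanSpace ℝ (Fin d) → ℝ → ℝ) : Prop where
  smooth : ∀ t ∈ T, ContDiffOn ℝ 3 (fun θ => Real.log (lam θ t)) Θ
  bounded : ∃ C : ℝ, ∀ m : ℕ, 1 ≤ m → m ≤ 3 → ∀ θ ∈ Θ, ∀ t ∈ T,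
    ‖iteratedFDeriv ℝ m (fun θ' => Real.log (lam θ' t)) θ‖ ≤ C
  nondegenerate : ∃ c : ℝ, 0 < c ∧ ∀ θ ∈ Θ, ∀ u : EuclideanSpace ℝ (Fin d), ‖u‖ = 1 →
    c ≤ inner ℝ u (Matrix.toEuclideanLin (fisherInfo T lam θ) u)

/-- The condition on the preliminary estimators: `θbar n` is a function of the first `n`
observations, is consistent, and `√n (θbar n - θ₀)` is bounded in probability. -/
structure PreliminaryP0 {d : ℕ} {Ω : Type*} [MeasurableSpace Ω] (P : Measure Ω)
    (X : ℕ → Ω → StieltjesFunction ℝ) (θ₀ : EuclideanSpace ℝ (Fin d))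
    (θbar : ℕ → Ω → EuclideanSpace ℝ (Fin d)) : Prop where
  estimator : ∀ n, Measurable[obsSigma X n] (θbar n)
  consistent : TendstoInMeasure P θbar atTop (fun _ => θ₀)
  bounded_in_prob : ∀ ε : ENNReal, 0 < ε → ∃ M : ℝ, ∀ n : ℕ,
    P {ω | M < ‖√(n : ℝ) • (θbar n ω - θ₀)‖} ≤ ε

/-- The size `N = [n ^ δ]` of the learning sample. -/
def learnSize (δ : ℝ) (n : ℕ) : ℕ := ⌊(n : ℝ) ^ δ⌋₊

open Classical in
/-- The one-step MLE based on the first `k` observations, of which the first `N` are used for the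
preliminary estimator `θbar N`:
`θbar_N + I(θbar_N)⁻¹ (1/k) ∑_{N < j ≤ k} ∫_T score(θbar_N, t) [dX_j(t) - lam(θbar_N, t) dt]`.
The `j`-th observation (counted from one) is `X (j - 1)`. The formula makes sense only if `θbar_N`
lies in the parameter set `Θ`; otherwise no correction is made. -/
def oneStepMLE {d : ℕ} {Ω : Type*} (T : Set ℝ) (Θ : Set (EuclideanSpace ℝ (Fin d)))
    (lam : EuclideanSpace ℝ (Fin d) → ℝ → ℝ) (X : ℕ → Ω → StieltjesFunction ℝ)
    (θbar : ℕ → Ω → EuclideanSpace ℝ (Fin d)) (N k : ℕ) (ω : Ω) : EuclideanSpace ℝ (Fin d) :=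
  if θbar N ω ∈ Θ then
    θbar N ω + Matrix.toEuclideanLin (fisherInfo T lam (θbar N ω))⁻¹
      ((k : ℝ)⁻¹ • ∑ j ∈ Finset.Ico N k,
        ((∫ t in T, score lam (θbar N ω) t ∂(X j ω).measure)
          - ∫ t in T, lam (θbar N ω) t • score lam (θbar N ω) t))
  else θbar N ω

end

/-! Write ρ for the error of the preliminary estimator θ̄ = `θbar N`, Λ for the measure with density
`lam θ₀` on `T`, and call a sum over N ≤ j < k of ∫ f dX_j - ∫ f dΛ a centered sum. The estimator is
one Newton step started at θ̄. Expanding the score around θ₀ and the intensity around θ̄, the sum in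
its definition equals S + ∑_b (θ̄ - θ₀)_b H_b - (k - N) I(θ̄)(θ̄ - θ₀) plus an error quadratic in ρ.
Here S is the centered sum of the score at θ₀ and H_b that of its b-th partial derivative at θ₀.
Applying I(θ̄)⁻¹/k, the linear term cancels the initial error up to the fraction N/k. Hence the
estimation error is I(θ₀)⁻¹ S/k up to (N/k)ρ + O(ρ² + ρ|H|/k + ρ|S|/k), where the ρ² term also
carries the average number of events (`RegularModel.exists_norm_oneStepMLE_sub_le`). All integrands
in S and H are deterministic, so the randomness of θ̄ enters only through ρ and no conditioning on
the learning sample is needed.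

Consistency follows because the strong law makes S/k and H/k small simultaneously for all k > N,
outside an event of vanishing probability. For asymptotic normality, multiply by √k. The term √k
(N/k) ρ = √(N/k) · √N ρ vanishes since δ < 1, and √k ρ² = (√k/N)(√N ρ)² vanishes since δ > 1/2. The
mixed terms are products of ρ → 0 with tight normalized sums. What remains is S/√k multiplied by
I(θ₀)⁻¹.

The probabilistic input is the characteristic functional E exp(i∫g dX) = exp ∫(e^{ig} - 1) dΛ
(`integral_cexp_integral_stieltjes`), proved for step functions from the independent Poisson
increments and extended by L¹ density. It gives equality in law of the integrals, the central limit
theorem and, through tightness, the bounds in probability. -/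

/-! ### Path measures as a kernel, and measurability of stochastic integrals -/

section StieltjesKernel

variable {Ω : Type*} [MeasurableSpace Ω]

/-- The kernel `ω ↦ (X ω).measure` restricted to the interval `(a, b]`. -/
noncomputable def stieltjesKernelIoc (X : Ω → StieltjesFunction ℝ)
    (hX : ∀ t : ℝ, Measurable fun ω => X ω t) (a b : ℝ) : Kernel Ω ℝ where
  toFun ω := (X ω).measure.restrict (Set.Ioc a b)
  measurable' := by
    have hfin : ∀ ω, IsFiniteMeasure ((X ω).measure.restrict (Set.Ioc a b)) := fun ω =>
      ⟨by simp [StieltjesFunction.measure_Ioc]⟩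
    have hIoc : ∀ u v : ℝ, Measurable fun ω => (X ω).measure (Set.Ioc u v) := fun u v => by
      simp only [StieltjesFunction.measure_Ioc]
      exact ((hX v).sub (hX u)).ennreal_ofReal
    refine Measurable.measure_of_isPiSystem
      (S := {S | ∃ l u : ℝ, l < u ∧ Set.Ioc l u = S}) ?_ (isPiSystem_Ioc id id) ?_ ?_
    · exact (borel_eq_generateFrom_Ioc ℝ ▸ BorelSpace.measurable_eq)
    · rintro _ ⟨l, u, -, rfl⟩
      simp only [Measure.restrict_apply measurableSet_Ioc, Set.Ioc_inter_Ioc]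
      exact hIoc _ _
    · simp only [Measure.restrict_apply MeasurableSet.univ, Set.univ_inter]
      exact hIoc _ _

/-- A kernel all of whose measures are finite is s-finite. -/
lemma isSFiniteKernel_of_forall_measure_univ_lt_top {β : Type*} [MeasurableSpace β]
    (κ : Kernel Ω β) (h : ∀ ω, κ ω Set.univ < ⊤) : IsSFiniteKernel κ := by
  classical
  -- Cutting Ω by the integer part of the total mass leaves pieces of mass at most m + 1.
  have hs : ∀ m : ℕ, MeasurableSet {ω | ⌊(κ ω Set.univ).toReal⌋₊ = m} := fun m =>
    ((κ.measurable_coe MeasurableSet.univ).ennreal_toReal.nat_floor) (measurableSet_singleton m)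
  have hfin : ∀ m : ℕ, IsFiniteKernel (Kernel.piecewise (hs m) κ 0) := fun m =>
    ⟨⟨(m : ENNReal) + 1, by simp, fun ω => by
      rw [Kernel.piecewise_apply]
      split_ifs with hω
      · have h1 : (κ ω Set.univ).toReal ≤ m + 1 := by
          have h2 : ⌊(κ ω Set.univ).toReal⌋₊ = m := hω
          rw [← h2]
          exact (Nat.lt_floor_add_one _).le
        rw [← ENNReal.ofReal_toReal (h ω).ne]
        exact (ENNReal.ofReal_le_ofReal h1).trans (by
          rw [ENNReal.ofReal_add (by positivity) zero_le_one]; simp)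
      · simp⟩⟩
  have hsum : κ = Kernel.sum fun m : ℕ => Kernel.piecewise (hs m) κ 0 := by
    ext ω s hS
    rw [Kernel.sum_apply' _ _ hS, tsum_eq_single ⌊(κ ω Set.univ).toReal⌋₊]
    · simp [Kernel.piecewise_apply]
    · intro m hm
      rw [Kernel.piecewise_apply, if_neg]
      · simp
      · exact fun h => hm h.symm
  rw [hsum]
  exact Kernel.isSFiniteKernel_sum

/-- The kernel `ω ↦ (X ω).measure` attached to a measurable family of Stieltjes functions. -/
noncomputable def stieltjesKernel (X : Ω → StieltjesFunction ℝ)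
    (hX : ∀ t : ℝ, Measurable fun ω => X ω t) : Kernel Ω ℝ :=
  -- A path measure is a priori only locally finite, so it is assembled from its finite pieces on
  -- the unit intervals.
  Kernel.sum fun n : ℤ => stieltjesKernelIoc X hX n (n + 1)

lemma stieltjesKernel_apply (X : Ω → StieltjesFunction ℝ)
    (hX : ∀ t : ℝ, Measurable fun ω => X ω t) (ω : Ω) :
    stieltjesKernel X hX ω = (X ω).measure := by
  have h := Measure.restrict_iUnion (μ := (X ω).measure) (Set.pairwise_disjoint_Ioc_intCast ℝ)
    fun n => measurableSet_Ioc
  rw [iUnion_Ioc_intCast, Measure.restrict_univ] at h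
  rw [stieltjesKernel, Kernel.sum_apply, h]
  rfl

instance isSFiniteKernel_stieltjesKernel (X : Ω → StieltjesFunction ℝ)
    (hX : ∀ t : ℝ, Measurable fun ω => X ω t) : IsSFiniteKernel (stieltjesKernel X hX) := by
  have : ∀ n : ℤ, IsSFiniteKernel (stieltjesKernelIoc X hX n (n + 1)) := fun n =>
    isSFiniteKernel_of_forall_measure_univ_lt_top _ fun ω => by
      change (X ω).measure.restrict (Set.Ioc (n : ℝ) (n + 1)) Set.univ < ⊤
      simp [StieltjesFunction.measure_Ioc]
  exact Kernel.isSFiniteKernel_sum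

/-- Integrals of a jointly measurable function against a measurable family of Stieltjes
measures are measurable. -/
lemma measurable_integral_stieltjes {E : Type*} [NormedAddCommGroup E] [NormedSpace ℝ E]
    [FiniteDimensional ℝ E] [MeasurableSpace E] [BorelSpace E]
    (X : Ω → StieltjesFunction ℝ) (hX : ∀ t : ℝ, Measurable fun ω => X ω t)
    {g : Ω → ℝ → E} (hg : Measurable (Function.uncurry g)) :
    Measurable fun ω => ∫ t, g ω t ∂(X ω).measure := by
  have h := hg.stronglyMeasurable.integral_kernel_prod_right' (κ := stieltjesKernel X hX)
  simp only [stieltjesKernel_apply] at h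
  exact h.measurable

end StieltjesKernel

/-! ### The mean of the Poisson law -/

section PoissonMean

/-- Since n rⁿ/n! = r · rⁿ⁻¹/(n - 1)!, shifting the index leaves r times the total mass of the
Poisson law. -/
lemma hasSum_poisson_mul_nat (r : NNReal) :
    HasSum (fun n : ℕ => Real.exp (-r) * (r : ℝ) ^ n / (n.factorial : ℝ) * n) r := by
  rw [← hasSum_nat_add_iff' 1]
  have h := (hasSum_one_poissonMeasure r).mul_left (r : ℝ)
  simp only [Finset.range_one, Finset.sum_singleton, Nat.cast_zero, mul_zero, sub_zero]
  rw [mul_one] at h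
  refine h.congr_fun ?_
  intro n
  have h1 : ((n + 1).factorial : ℝ) = (n + 1) * n.factorial := by
    rw [Nat.factorial_succ]; push_cast; ring
  have h2 : (n.factorial : ℝ) ≠ 0 := by positivity
  have h3 : (n : ℝ) + 1 ≠ 0 := by positivity
  rw [h1]
  push_cast
  field_simp
  ring

lemma lintegral_ofReal_map_cast_poissonMeasure (r : NNReal) :
    ∫⁻ x, ENNReal.ofReal x ∂((poissonMeasure r).map (Nat.cast : ℕ → ℝ)) = r := by
  rw [lintegral_map ENNReal.measurable_ofReal .of_discrete]
  have hs := hasSum_poisson_mul_nat r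
  have hint : Integrable (fun n : ℕ => (n : ℝ)) (poissonMeasure r) := by
    rw [integrable_poissonMeasure_iff]
    refine hs.summable.congr fun n => by simp
  rw [← ofReal_integral_eq_lintegral_ofReal hint (ae_of_all _ fun n => by positivity),
    integral_poissonMeasure' hint]
  simp only [smul_eq_mul]
  rw [hs.tsum_eq]
  simp

end PoissonMean

/-! ### Density of step functions in L¹ -/

section StepFunctions

/-- The step function with value `c j` on `(t j, t (j + 1)]` for `j < K`, and zero elsewhere. -/
noncomputable def stepFun (K : ℕ) (t : ℕ → ℝ) (c : ℕ → ℝ) (x : ℝ) : ℝ :=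
  ∑ j ∈ Finset.range K, (Set.Ioc (t j) (t (j + 1))).indicator (fun _ => c j) x

lemma measurable_stepFun (K : ℕ) (t : ℕ → ℝ) (c : ℕ → ℝ) : Measurable (stepFun K t c) :=
  Finset.measurable_fun_sum _ fun _ _ => measurable_const.indicator measurableSet_Ioc

lemma stepFun_of_mem {K : ℕ} {t : ℕ → ℝ} (ht : Monotone t) (c : ℕ → ℝ) {x : ℝ} {j : ℕ}
    (hj : j < K) (hx : x ∈ Set.Ioc (t j) (t (j + 1))) : stepFun K t c x = c j := by
  rw [stepFun, Finset.sum_eq_single j]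
  · simp [hx]
  · intro i _ hij
    refine Set.indicator_of_notMem (fun hi => ?_) _
    rcases lt_or_gt_of_ne hij with h | h
    · exact absurd hx.1 (not_lt.2 (hi.2.trans (ht h)))
    · exact absurd hi.1 (not_lt.2 (hx.2.trans (ht h)))
  · intro h
    exact absurd (Finset.mem_range.2 hj) h

lemma stepFun_of_forall_notMem {K : ℕ} {t : ℕ → ℝ} (c : ℕ → ℝ) {x : ℝ}
    (hx : ∀ j < K, x ∉ Set.Ioc (t j) (t (j + 1))) : stepFun K t c x = 0 :=
  Finset.sum_eq_zero fun j hj => Set.indicator_of_notMem (hx j (Finset.mem_range.1 hj)) _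

/-- At most one cell contains a given point, so φ may be applied term by term; φ 0 = 0 takes care of
the points outside all cells. -/
lemma comp_stepFun {E : Type*} [AddCommMonoid E] (φ : ℝ → E) (hφ : φ 0 = 0) (K : ℕ) {t : ℕ → ℝ}
    (ht : Monotone t) (c : ℕ → ℝ) (x : ℝ) :
    φ (stepFun K t c x) =
      ∑ j ∈ Finset.range K, (Set.Ioc (t j) (t (j + 1))).indicator (fun _ => φ (c j)) x := by
  by_cases h : ∃ j < K, x ∈ Set.Ioc (t j) (t (j + 1))
  · obtain ⟨j, hj, hx⟩ := h
    rw [stepFun_of_mem ht c hj hx, Finset.sum_eq_single j]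
    · simp [hx]
    · intro i _ hij
      refine Set.indicator_of_notMem (fun hi => ?_) _
      rcases lt_or_gt_of_ne hij with h | h
      · exact absurd hx.1 (not_lt.2 (hi.2.trans (ht h)))
      · exact absurd hi.1 (not_lt.2 (hx.2.trans (ht h)))
    · intro h
      exact absurd (Finset.mem_range.2 hj) h
  · push Not at h
    rw [stepFun_of_forall_notMem c h, hφ, Finset.sum_eq_zero]
    exact fun j hj => Set.indicator_of_notMem (h j (Finset.mem_range.1 hj)) _

lemma integral_sum_indicator_Ioc {E : Type*} [NormedAddCommGroup E] [NormedSpace ℝ E]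
    [CompleteSpace E] (μ : Measure ℝ) [IsLocallyFiniteMeasure μ] (K : ℕ) (t : ℕ → ℝ) (c : ℕ → E) :
    ∫ x, ∑ j ∈ Finset.range K, (Set.Ioc (t j) (t (j + 1))).indicator (fun _ => c j) x ∂μ =
      ∑ j ∈ Finset.range K, μ.real (Set.Ioc (t j) (t (j + 1))) • c j := by
  rw [integral_finsetSum]
  · refine Finset.sum_congr rfl fun j _ => ?_
    rw [integral_indicator_const _ measurableSet_Ioc]
  · intro j _
    exact (integrable_indicator_iff measurableSet_Ioc).2
      (integrableOn_const measure_Ioc_lt_top.ne)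

/-- A continuous compactly supported function is a uniform limit of step functions. -/
lemma exists_stepFun_forall_abs_sub_le {f : ℝ → ℝ} (hf : Continuous f) (hc : HasCompactSupport f)
    {ε : ℝ} (hε : 0 < ε) :
    ∃ (K : ℕ) (t c : ℕ → ℝ), Monotone t ∧ ∀ x, |f x - stepFun K t c x| ≤ ε := by
  obtain ⟨δ, hδ, hδf⟩ := Metric.uniformContinuous_iff.1
    (hc.uniformContinuous_of_continuous hf) ε hε
  obtain ⟨R, hR⟩ := hc.isCompact.isBounded.subset_closedBall 0
  obtain ⟨M, hM⟩ := exists_nat_gt R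
  obtain ⟨n, hn⟩ := exists_nat_gt (1 / δ)
  have hn0 : (0 : ℝ) < n := (by positivity : 0 < 1 / δ).trans hn
  have hnδ : 1 / (n : ℝ) < δ := by
    rw [div_lt_iff₀ hn0]
    rw [div_lt_iff₀ hδ] at hn
    linarith
  set t : ℕ → ℝ := fun j => -M + j / n with ht_def
  have ht : Monotone t := fun i j hij => by
    simp only [ht_def]
    gcongr
  -- The grid -M + j/n has mesh below the modulus δ and covers (-M, M], which contains the support
  -- of f; each cell carries the value at its right endpoint.
  refine ⟨2 * M * n, t, fun j => f (t (j + 1)), ht, fun x => ?_⟩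
  by_cases hx : ∃ j < 2 * M * n, x ∈ Set.Ioc (t j) (t (j + 1))
  · obtain ⟨j, hj, hxj⟩ := hx
    rw [stepFun_of_mem ht _ hj hxj]
    refine (hδf (a := x) (b := t (j + 1)) ?_).le
    have h1 : t (j + 1) - t j = 1 / n := by
      simp only [ht_def]; push_cast; ring
    rw [Real.dist_eq, abs_lt]
    constructor <;> linarith [hxj.1, hxj.2]
  · rw [stepFun_of_forall_notMem _ (by simpa using hx)]
    have hfx : f x = 0 := by
      by_contra hne
      have hxR := hR (subset_tsupport f hne)
      rw [mem_closedBall_zero_iff, Real.norm_eq_abs] at hxR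
      have hx2 := abs_le.1 hxR
      have hpos : 0 < n * (x + M) := mul_pos hn0 (by linarith)
      have hceil : 0 < ⌈n * (x + M)⌉₊ := Nat.ceil_pos.2 hpos
      -- Cells are open on the left, so the cell of x is found with a ceiling, shifted by one.
      refine hx ⟨⌈n * (x + M)⌉₊ - 1, ?_, ?_⟩
      · have : ⌈n * (x + M)⌉₊ ≤ 2 * M * n := by
          refine Nat.ceil_le.2 ?_
          push_cast
          nlinarith
        omega
      · have h1 := Nat.ceil_lt_add_one hpos.le
        have h2 := Nat.le_ceil (n * (x + M))
        have h3 : ((⌈n * (x + M)⌉₊ - 1 : ℕ) : ℝ) = ⌈n * (x + M)⌉₊ - 1 := by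
          rw [Nat.cast_sub hceil]; simp
        rw [Nat.sub_add_cancel hceil]
        simp only [ht_def, h3]
        constructor
        · have : (⌈n * (x + M)⌉₊ - 1 : ℝ) / n < x + M := by
            rw [div_lt_iff₀ hn0]; linarith
          linarith
        · have : x + M ≤ (⌈n * (x + M)⌉₊ : ℝ) / n := by
            rw [le_div_iff₀ hn0]; linarith
          linarith
    simp [hfx, hε.le]

/-- Step functions are dense in `L¹` of a finite measure. -/
lemma exists_stepFun_integral_abs_sub_le (Λ : Measure ℝ) [IsFiniteMeasure Λ] {g : ℝ → ℝ}
    (hg : Integrable g Λ) {ε : ℝ} (hε : 0 < ε) :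
    ∃ (K : ℕ) (t c : ℕ → ℝ), Monotone t ∧ Integrable (stepFun K t c) Λ ∧
      ∫ x, |g x - stepFun K t c x| ∂Λ ≤ ε := by
  obtain ⟨f, hfc, hfg, hf, hfi⟩ := hg.exists_hasCompactSupport_integral_sub_le (half_pos hε)
  -- Chosen so that η times the total mass of Λ is at most ε/2.
  set η := ε / 2 / (Λ.real Set.univ + 1) with hη
  have hη0 : 0 < η := by positivity
  obtain ⟨K, t, c, ht, hs⟩ := exists_stepFun_forall_abs_sub_le hf hfc hη0
  have hdi : Integrable (fun x => f x - stepFun K t c x) Λ :=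
    Integrable.of_bound (hf.measurable.sub (measurable_stepFun K t c)).aestronglyMeasurable η
      (ae_of_all _ hs)
  have hsi : Integrable (stepFun K t c) Λ := by
    refine (hfi.sub hdi).congr (ae_of_all _ fun x => ?_)
    simp
  refine ⟨K, t, c, ht, hsi, ?_⟩
  calc ∫ x, |g x - stepFun K t c x| ∂Λ
      ≤ ∫ x, (‖g x - f x‖ + |f x - stepFun K t c x|) ∂Λ := by
        refine integral_mono (hg.sub hsi).abs ((hg.sub hfi).norm.add hdi.abs) fun x => ?_
        exact abs_sub_le _ _ _
    _ = ∫ x, ‖g x - f x‖ ∂Λ + ∫ x, |f x - stepFun K t c x| ∂Λ :=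
        integral_add (hg.sub hfi).norm hdi.abs
    _ ≤ ε / 2 + ∫ _, η ∂Λ := by
        refine add_le_add hfg (integral_mono hdi.abs (integrable_const _) hs)
    _ ≤ ε := by
        rw [integral_const, smul_eq_mul, hη]
        have : Λ.real Set.univ * (ε / 2 / (Λ.real Set.univ + 1)) ≤ ε / 2 := by
          have h0 : 0 ≤ Λ.real Set.univ := measureReal_nonneg
          rw [mul_div_assoc', div_le_iff₀ (by positivity)]
          nlinarith
        linarith

end StepFunctions

/-! ### Mean measure and characteristic functional of a Poisson process -/

section PoissonFunctional

variable {Ω : Type*} [MeasurableSpace Ω] {P : Measure Ω} {Λ : Measure ℝ}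
  {X : Ω → StieltjesFunction ℝ}

/-- The mean measure of a process with Poisson increments is the intensity measure. -/
lemma bind_stieltjesKernel_eq [IsFiniteMeasure Λ] (hX : ∀ t : ℝ, Measurable fun ω => X ω t)
    (hlaw : ∀ a b : ℝ, a ≤ b → HasLaw (fun ω => X ω b - X ω a)
      ((poissonMeasure (Λ (Set.Ioc a b)).toNNReal).map (Nat.cast : ℕ → ℝ)) P) :
    P.bind (stieltjesKernel X hX) = Λ := by
  -- Uniqueness from the values on half-open intervals requires local finiteness of one measure
  -- only, and Λ is the one known to have it.
  symm
  refine Measure.ext_of_Ioc _ _ fun a b hab => ?_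
  rw [Measure.bind_apply measurableSet_Ioc (Kernel.aemeasurable _)]
  simp only [stieltjesKernel_apply, StieltjesFunction.measure_Ioc]
  have h := hlaw a b hab.le
  have h2 := lintegral_ofReal_map_cast_poissonMeasure (Λ (Set.Ioc a b)).toNNReal
  rw [← h.map_eq, lintegral_map' ENNReal.measurable_ofReal.aemeasurable h.aemeasurable,
    ENNReal.coe_toNNReal (measure_ne_top _ _)] at h2
  exact h2.symm

/-- The expectation of ∫ ‖g‖ dX is ∫ ‖g‖ dΛ < ∞, so integrability can fail only on a null set of
paths. -/
lemma ae_integrable_stieltjes {E : Type*} [NormedAddCommGroup E]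
    (hX : ∀ t : ℝ, Measurable fun ω => X ω t) (hmean : P.bind (stieltjesKernel X hX) = Λ)
    {g : ℝ → E} (hg : Integrable g Λ) : ∀ᵐ ω ∂P, Integrable g (X ω).measure := by
  have h := Measure.ae_integrable_of_integrable_comp (κ := stieltjesKernel X hX) (μ := P)
    (f := g) (by rw [hmean]; exact hg)
  simpa only [stieltjesKernel_apply] using h

lemma integrable_integral_norm_stieltjes {E : Type*} [NormedAddCommGroup E]
    (hX : ∀ t : ℝ, Measurable fun ω => X ω t) (hmean : P.bind (stieltjesKernel X hX) = Λ)
    {g : ℝ → E} (hg : Integrable g Λ) : Integrable (fun ω => ∫ t, ‖g t‖ ∂(X ω).measure) P := by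
  have h := Measure.integrable_integral_norm_of_integrable_comp (κ := stieltjesKernel X hX) (μ := P)
    (f := g) (by rw [hmean]; exact hg)
  simpa only [stieltjesKernel_apply] using h

/-- Campbell's formula. -/
lemma integral_integral_stieltjes {E : Type*} [NormedAddCommGroup E] [NormedSpace ℝ E]
    (hX : ∀ t : ℝ, Measurable fun ω => X ω t) (hmean : P.bind (stieltjesKernel X hX) = Λ)
    {g : ℝ → E} (hg : Integrable g Λ) :
    ∫ ω, ∫ t, g t ∂(X ω).measure ∂P = ∫ t, g t ∂Λ := by
  have h : Integrable g (stieltjesKernel X hX ∘ₘ P) := by rw [hmean]; exact hg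
  -- The mixture of path measures is a composition of kernels once P is viewed as a constant kernel.
  have h2 := Kernel.integral_comp (κ := Kernel.const Unit P) (η := stieltjesKernel X hX) (a := ())
    (f := g) (by rw [Kernel.comp_apply]; simpa using h)
  rw [Kernel.comp_apply] at h2
  simp only [Kernel.const_apply, stieltjesKernel_apply] at h2
  rw [← h2, hmean]

/-- The characteristic functional for step functions. -/
lemma integral_cexp_stepFun [IsFiniteMeasure Λ]
    (hlaw : ∀ a b : ℝ, a ≤ b → HasLaw (fun ω => X ω b - X ω a)
      ((poissonMeasure (Λ (Set.Ioc a b)).toNNReal).map (Nat.cast : ℕ → ℝ)) P)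
    (hind : HasIndepIncrements (fun (t : ℝ) ω => X ω t) P)
    (K : ℕ) {t : ℕ → ℝ} (ht : Monotone t) (c : ℕ → ℝ) :
    ∫ ω, Complex.exp ((∫ x, stepFun K t c x ∂(X ω).measure : ℝ) * Complex.I) ∂P =
      Complex.exp (∫ x, (Complex.exp (stepFun K t c x * Complex.I) - 1) ∂Λ) := by
  have h1 : ∀ ω, ∫ x, stepFun K t c x ∂(X ω).measure =
      ∑ j ∈ Finset.range K, c j * (X ω (t (j + 1)) - X ω (t j)) := fun ω => by
    have := integral_sum_indicator_Ioc (X ω).measure K t c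
    simp only [stepFun]
    rw [this]
    refine Finset.sum_congr rfl fun j _ => ?_
    rw [measureReal_def, StieltjesFunction.measure_Ioc, ENNReal.toReal_ofReal
      (sub_nonneg.2 ((X ω).mono (ht (Nat.le_succ j)))), smul_eq_mul, mul_comm]
  have h2 : ∫ x, (Complex.exp (stepFun K t c x * Complex.I) - 1) ∂Λ =
      ∑ j ∈ Finset.range K, (Λ.real (Set.Ioc (t j) (t (j + 1))) : ℂ) *
        (Complex.exp (c j * Complex.I) - 1) := by
    have h3 : ∀ x, Complex.exp (stepFun K t c x * Complex.I) - 1 = _ := fun x =>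
      comp_stepFun (fun y : ℝ => Complex.exp (y * Complex.I) - 1) (by simp) K ht c x
    simp only [h3]
    rw [integral_sum_indicator_Ioc]
    rfl
  set Y : ℕ → Ω → ℝ := fun j ω => c j * (X ω (t (j + 1)) - X ω (t j)) with hY
  have hYind : iIndepFun Y P :=
    (hind.nat ht).comp (fun j x => c j * x) fun j => measurable_const_mul _
  have hYm : ∀ j, AEMeasurable (Y j) P := fun j =>
    (hlaw _ _ (ht (Nat.le_succ j))).aemeasurable.const_mul _
  -- The expectation sought is the characteristic function of a sum of independent variables at
  -- frequency 1.
  have h4 := congrFun (iIndepFun.charFun_map_fun_finsetSum_eq_prod (s := Finset.range K)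
    (fun i _ => hYm i) (hYind.restrict _)) 1
  rw [charFun_apply_real, integral_map (Finset.aemeasurable_fun_sum _ fun i _ => hYm i)
    (by fun_prop)] at h4
  simp only [Complex.ofReal_one, one_mul] at h4
  simp only [h1, h2, Complex.exp_sum]
  rw [h4, Finset.prod_apply]
  refine Finset.prod_congr rfl fun j _ => ?_
  have h5 := hlaw _ _ (ht (Nat.le_succ j))
  have h6 : P.map (Y j) = (P.map fun ω => X ω (t (j + 1)) - X ω (t j)).map (fun x => c j * x) := by
    rw [AEMeasurable.map_map_of_aemeasurable (by fun_prop) h5.aemeasurable]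
    rfl
  rw [h6, charFun_map_mul, h5.map_eq, charFun_map_cast_poissonMeasure, mul_one]
  rfl

/-- Both sides of the characteristic functional are thereby continuous for L¹(Λ) convergence of the
integrand. -/
lemma norm_cexp_ofReal_mul_I_sub_le (a b : ℝ) :
    ‖Complex.exp (a * Complex.I) - Complex.exp (b * Complex.I)‖ ≤ |a - b| := by
  have h : Complex.exp (a * Complex.I) - Complex.exp (b * Complex.I) =
      Complex.exp (b * Complex.I) * (Complex.exp (Complex.I * ((a - b : ℝ) : ℂ)) - 1) := by
    rw [mul_sub, ← Complex.exp_add]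
    push_cast
    ring_nf
  rw [h, norm_mul, Complex.norm_exp_ofReal_mul_I, one_mul]
  exact Real.norm_exp_I_mul_ofReal_sub_one_le

/-- The characteristic functional of a Poisson process. -/
lemma integral_cexp_integral_stieltjes [IsProbabilityMeasure P] [IsFiniteMeasure Λ]
    (hX : ∀ t : ℝ, Measurable fun ω => X ω t)
    (hlaw : ∀ a b : ℝ, a ≤ b → HasLaw (fun ω => X ω b - X ω a)
      ((poissonMeasure (Λ (Set.Ioc a b)).toNNReal).map (Nat.cast : ℕ → ℝ)) P)
    (hind : HasIndepIncrements (fun (t : ℝ) ω => X ω t) P) {g : ℝ → ℝ} (hgm : Measurable g)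
    (hg : Integrable g Λ) :
    ∫ ω, Complex.exp ((∫ x, g x ∂(X ω).measure : ℝ) * Complex.I) ∂P =
      Complex.exp (∫ x, (Complex.exp (g x * Complex.I) - 1) ∂Λ) := by
  have hmean := bind_stieltjesKernel_eq hX hlaw
  have hbd : ∀ h : ℝ → ℝ, Measurable h →
      Integrable (fun x => Complex.exp (h x * Complex.I) - 1) Λ := fun h hm =>
    Integrable.of_bound (C := 2) (by fun_prop) (ae_of_all _ fun x => by
      refine (norm_sub_le _ _).trans ?_
      rw [Complex.norm_exp_ofReal_mul_I]; norm_num)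
  have hbdP : ∀ h : ℝ → ℝ, Measurable h →
      Integrable (fun ω => Complex.exp ((∫ x, h x ∂(X ω).measure : ℝ) * Complex.I)) P :=
      fun h hm => by
    have hm' : Measurable fun ω => ∫ x, h x ∂(X ω).measure :=
      measurable_integral_stieltjes X hX (g := fun _ => h) (hm.comp measurable_snd)
    exact Integrable.of_bound (C := 1)
      (Complex.measurable_exp.comp
        ((Complex.measurable_ofReal.comp hm').mul_const _)).aestronglyMeasurable
      (ae_of_all _ fun ω => by
      rw [Complex.norm_exp_ofReal_mul_I])
  choose K t c ht hsi hs using fun n : ℕ =>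
    exists_stepFun_integral_abs_sub_le Λ hg (ε := 1 / ((n : ℝ) + 1)) (by positivity)
  set s : ℕ → ℝ → ℝ := fun n => stepFun (K n) (t n) (c n) with hs_def
  have hsm : ∀ n, Measurable (s n) := fun n => measurable_stepFun _ _ _
  have hlim : Tendsto (fun n : ℕ => 1 / ((n : ℝ) + 1)) atTop (𝓝 0) :=
    tendsto_one_div_add_atTop_nhds_zero_nat
  have hL : Tendsto (fun n => ∫ ω, Complex.exp ((∫ x, s n x ∂(X ω).measure : ℝ) * Complex.I) ∂P)
      atTop (𝓝 (∫ ω, Complex.exp ((∫ x, g x ∂(X ω).measure : ℝ) * Complex.I) ∂P)) := by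
    rw [tendsto_iff_norm_sub_tendsto_zero]
    refine squeeze_zero (fun _ => norm_nonneg _) (fun n => ?_) hlim
    rw [← integral_sub (hbdP _ (hsm n)) (hbdP _ hgm)]
    have hdi : Integrable (fun x => g x - s n x) Λ := hg.sub (hsi n)
    -- Campbell's formula turns the mean distance between the path integrals into an L¹(Λ) distance.
    calc _ ≤ ∫ ω, ∫ x, ‖g x - s n x‖ ∂(X ω).measure ∂P := by
          refine norm_integral_le_of_norm_le (integrable_integral_norm_stieltjes hX hmean hdi) ?_
          filter_upwards [ae_integrable_stieltjes hX hmean hg,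
            ae_integrable_stieltjes hX hmean (hsi n)] with ω h1 h2
          refine (norm_cexp_ofReal_mul_I_sub_le _ _).trans ?_
          rw [abs_sub_comm, ← integral_sub h1 h2]
          exact norm_integral_le_integral_norm (μ := (X ω).measure) fun x => g x - s n x
      _ = ∫ x, ‖g x - s n x‖ ∂Λ := integral_integral_stieltjes hX hmean hdi.norm
      _ ≤ _ := hs n
  have hR : Tendsto (fun n => ∫ x, (Complex.exp (s n x * Complex.I) - 1) ∂Λ)
      atTop (𝓝 (∫ x, (Complex.exp (g x * Complex.I) - 1) ∂Λ)) := by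
    rw [tendsto_iff_norm_sub_tendsto_zero]
    refine squeeze_zero (fun _ => norm_nonneg _) (fun n => ?_) hlim
    rw [← integral_sub (hbd _ (hsm n)) (hbd _ hgm)]
    refine (norm_integral_le_of_norm_le (hg.sub (hsi n)).abs (ae_of_all _ fun x => ?_)).trans (hs n)
    rw [sub_sub_sub_cancel_right]
    refine (norm_cexp_ofReal_mul_I_sub_le _ _).trans ?_
    rw [abs_sub_comm]
    rfl
  refine tendsto_nhds_unique hL (((Complex.continuous_exp.tendsto _).comp hR).congr fun n => ?_)
  exact (integral_cexp_stepFun hlaw hind (K n) (ht n) (c n)).symm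

end PoissonFunctional

/-! ### The σ-algebra of a path -/

section PathSigma

variable {Ω : Type*}

lemma measurable_pathSigma (Y : Ω → StieltjesFunction ℝ) (t : ℝ) :
    Measurable[pathSigma Y] fun ω => Y ω t :=
  Measurable.mono (comap_measurable fun ω => Y ω t)
    (le_iSup (fun t : ℝ => MeasurableSpace.comap (fun ω => Y ω t) (borel ℝ)) t) le_rfl

lemma pathSigma_le [m : MeasurableSpace Ω] {Y : Ω → StieltjesFunction ℝ}
    (hY : ∀ t : ℝ, Measurable fun ω => Y ω t) : pathSigma Y ≤ m :=
  iSup_le fun t => (hY t).comap_le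

end PathSigma

/-! ### Limit theorems for independent copies -/

section Sample

variable {Ω : Type*} [MeasurableSpace Ω]

/-- Independent processes with independent Poisson increments and mean measure `Λ`. -/
structure IsPoissonMeasureSample (P : Measure Ω) (Λ : Measure ℝ)
    (X : ℕ → Ω → StieltjesFunction ℝ) : Prop where
  measurable : ∀ (j : ℕ) (t : ℝ), Measurable fun ω => X j ω t
  law : ∀ (j : ℕ) (a b : ℝ), a ≤ b → HasLaw (fun ω => X j ω b - X j ω a)
    ((poissonMeasure (Λ (Set.Ioc a b)).toNNReal).map (Nat.cast : ℕ → ℝ)) P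
  indep_increments : ∀ j : ℕ, HasIndepIncrements (fun (t : ℝ) ω => X j ω t) P
  indep : iIndep (fun j => pathSigma (X j)) P

/-- The sum over `N ≤ j < k` of the centered integrals of `f` with respect to `X j`. -/
noncomputable def centeredSum {E : Type*} [NormedAddCommGroup E] [NormedSpace ℝ E] (Λ : Measure ℝ)
    (X : ℕ → Ω → StieltjesFunction ℝ) (f : ℝ → E) (N k : ℕ) (ω : Ω) : E :=
  ∑ j ∈ Finset.Ico N k, (∫ t, f t ∂(X j ω).measure - ∫ t, f t ∂Λ)

variable {P : Measure Ω} {Λ : Measure ℝ}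
  {X : ℕ → Ω → StieltjesFunction ℝ}
  {E : Type*} [NormedAddCommGroup E] [InnerProductSpace ℝ E] [FiniteDimensional ℝ E]
  [MeasurableSpace E] [BorelSpace E] {f : ℝ → E}

namespace IsPoissonMeasureSample

lemma measurable_integral (h : IsPoissonMeasureSample P Λ X) (hf : Measurable f) (j : ℕ) :
    Measurable fun ω => ∫ t, f t ∂(X j ω).measure :=
  measurable_integral_stieltjes (X j) (h.measurable j) (g := fun _ => f) (hf.comp measurable_snd)

lemma iIndepFun_integral (h : IsPoissonMeasureSample P Λ X) (hf : Measurable f) :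
    iIndepFun (fun j ω => ∫ t, f t ∂(X j ω).measure) P := by
  rw [iIndepFun_iff_iIndep]
  refine iIndep_of_iIndep_of_le h.indep fun j => Measurable.comap_le ?_
  -- The measurability lemma is read on Ω with the σ-algebra of the single path X j: the integral
  -- depends on that path alone.
  exact @measurable_integral_stieltjes Ω (pathSigma (X j)) E _ _ _ _ _ (X j)
    (fun t => measurable_pathSigma (X j) t) (fun _ => f)
    (hf.comp (@measurable_snd Ω ℝ (pathSigma (X j)) _))

lemma mean [IsFiniteMeasure Λ] (h : IsPoissonMeasureSample P Λ X) (j : ℕ) :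
    P.bind (stieltjesKernel (X j) (h.measurable j)) = Λ :=
  bind_stieltjesKernel_eq (h.measurable j) (h.law j)

/-- Pairing with u reduces to the scalar functional. The pairing passes through the path integral
only almost surely, for the paths against which f is integrable. -/
lemma charFun_map_integral [IsProbabilityMeasure P] [IsFiniteMeasure Λ]
    (h : IsPoissonMeasureSample P Λ X) (hf : Measurable f)
    (hfi : Integrable f Λ) (j : ℕ) (u : E) :
    charFun (P.map fun ω => ∫ t, f t ∂(X j ω).measure) u =
      Complex.exp (∫ t, (Complex.exp ((inner ℝ (f t) u : ℝ) * Complex.I) - 1) ∂Λ) := by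
  rw [charFun_apply, integral_map (h.measurable_integral hf j).aemeasurable (by fun_prop),
    ← integral_cexp_integral_stieltjes (h.measurable j) (h.law j) (h.indep_increments j)
      (g := fun t => inner ℝ (f t) u) (by fun_prop) (hfi.inner_const u)]
  refine integral_congr_ae ?_
  filter_upwards [ae_integrable_stieltjes (h.measurable j) (h.mean j) hfi] with ω hω
  have : inner ℝ (∫ t, f t ∂(X j ω).measure) u = ∫ t, inner ℝ (f t) u ∂(X j ω).measure := by
    simp only [real_inner_comm u]
    exact (integral_inner hω u).symm
  rw [this]

/-- The characteristic function just computed does not depend on the index. -/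
lemma identDistrib_integral [IsProbabilityMeasure P] [IsFiniteMeasure Λ]
    (h : IsPoissonMeasureSample P Λ X) (hf : Measurable f)
    (hfi : Integrable f Λ) (i j : ℕ) :
    IdentDistrib (fun ω => ∫ t, f t ∂(X i ω).measure) (fun ω => ∫ t, f t ∂(X j ω).measure) P P where
  aemeasurable_fst := (h.measurable_integral hf i).aemeasurable
  aemeasurable_snd := (h.measurable_integral hf j).aemeasurable
  map_eq := by
    have := Measure.isProbabilityMeasure_map (μ := P) (h.measurable_integral hf i).aemeasurable
    have := Measure.isProbabilityMeasure_map (μ := P) (h.measurable_integral hf j).aemeasurable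
    refine Measure.ext_of_charFun (funext fun u => ?_)
    rw [h.charFun_map_integral hf hfi, h.charFun_map_integral hf hfi]

lemma integrable_integral [IsFiniteMeasure Λ] (h : IsPoissonMeasureSample P Λ X) (hf : Measurable f)
    (hfi : Integrable f Λ) (j : ℕ) : Integrable (fun ω => ∫ t, f t ∂(X j ω).measure) P :=
  (integrable_integral_norm_stieltjes (h.measurable j) (h.mean j) hfi).mono'
    (h.measurable_integral hf j).aestronglyMeasurable
    (ae_of_all _ fun _ => norm_integral_le_integral_norm _)

/-- The strong law of large numbers for centered integrals. -/
lemma ae_tendsto_centeredSum [IsProbabilityMeasure P] [IsFiniteMeasure Λ]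
    (h : IsPoissonMeasureSample P Λ X) (hf : Measurable f)
    (hfi : Integrable f Λ) :
    ∀ᵐ ω ∂P, Tendsto (fun k : ℕ => (k : ℝ)⁻¹ • centeredSum Λ X f 0 k ω) atTop (𝓝 0) := by
  have hs := strong_law_ae (fun j ω => ∫ t, f t ∂(X j ω).measure) (h.integrable_integral hf hfi 0)
    (fun i j hij => (h.iIndepFun_integral hf).indepFun hij)
    (fun i => h.identDistrib_integral hf hfi i 0)
  rw [integral_integral_stieltjes (h.measurable 0) (h.mean 0) hfi] at hs
  filter_upwards [hs] with ω hω
  have h0 := hω.sub_const (∫ t, f t ∂Λ)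
  rw [sub_self] at h0
  refine h0.congr' ?_
  filter_upwards [eventually_gt_atTop 0] with k hk
  have hk0 : (k : ℝ) ≠ 0 := by positivity
  simp only [centeredSum, Nat.Ico_zero_eq_range, Finset.sum_sub_distrib, Finset.sum_const,
    Finset.card_range, smul_sub]
  rw [← Nat.cast_smul_eq_nsmul ℝ, smul_smul, inv_mul_cancel₀ hk0, one_smul]

lemma measurable_centeredSum (h : IsPoissonMeasureSample P Λ X) (hf : Measurable f) (N k : ℕ) :
    Measurable (centeredSum Λ X f N k) :=
  Finset.measurable_fun_sum _ fun j _ => (h.measurable_integral hf j).sub_const _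

/-- Independence gives a product of k - N equal factors, and the centering contributes the linear
term to each exponent. The integrand is then of second order in r. -/
lemma charFun_map_smul_centeredSum [IsProbabilityMeasure P] [IsFiniteMeasure Λ]
    (h : IsPoissonMeasureSample P Λ X) (hf : Measurable f)
    (hfi : Integrable f Λ) (N k : ℕ) (r : ℝ) (u : E) :
    charFun (P.map fun ω => r • centeredSum Λ X f N k ω) u =
      Complex.exp ((k - N : ℕ) * ∫ t, (Complex.exp ((r * inner ℝ (f t) u : ℝ) * Complex.I) - 1
        - (r * inner ℝ (f t) u : ℝ) * Complex.I) ∂Λ) := by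
  set m := ∫ t, f t ∂Λ with hm
  set Y : ℕ → Ω → E := fun j ω => ∫ t, f t ∂(X j ω).measure - m with hY
  have hYm : ∀ j, Measurable (Y j) := fun j => (h.measurable_integral hf j).sub_const _
  have hYind : iIndepFun Y P :=
    (h.iIndepFun_integral hf).comp (fun _ x => x - m) fun _ => measurable_id.sub_const _
  have h1 : (P.map fun ω => r • centeredSum Λ X f N k ω) =
      (P.map (fun ω => ∑ j ∈ Finset.Ico N k, Y j ω)).map (fun x => r • x) := by
    rw [Measure.map_map (by fun_prop) (Finset.measurable_fun_sum _ fun j _ => hYm j)]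
    rfl
  have h2 : ∀ j, charFun (P.map (Y j)) (r • u) =
      Complex.exp (∫ t, (Complex.exp ((r * inner ℝ (f t) u : ℝ) * Complex.I) - 1
        - (r * inner ℝ (f t) u : ℝ) * Complex.I) ∂Λ) := fun j => by
    have h3 : P.map (Y j) = (P.map fun ω => ∫ t, f t ∂(X j ω).measure).map (fun x => x + -m) := by
      rw [Measure.map_map (by fun_prop) (h.measurable_integral hf j)]
      simp only [hY, sub_eq_add_neg]
      rfl
    rw [h3, charFun_map_add_const, h.charFun_map_integral hf hfi, ← Complex.exp_add]
    congr 1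
    have h4 : inner ℝ (-m) (r • u) = -∫ t, r * inner ℝ (f t) u ∂Λ := by
      rw [inner_neg_left, inner_smul_right, integral_const_mul, hm]
      congr 2
      simp only [real_inner_comm u]
      exact (integral_inner hfi u).symm
    have h5 : Integrable (fun t => ((r * inner ℝ (f t) u : ℝ) : ℂ) * Complex.I) Λ :=
      (((hfi.inner_const u).const_mul r).ofReal).mul_const _
    have h6 : Integrable (fun t => Complex.exp ((r * inner ℝ (f t) u : ℝ) * Complex.I) - 1) Λ :=
      Integrable.of_bound (C := 2) (by fun_prop) (ae_of_all _ fun x => by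
        refine (norm_sub_le _ _).trans ?_
        rw [Complex.norm_exp_ofReal_mul_I]; norm_num)
    rw [integral_sub h6 h5, integral_mul_const, integral_complex_ofReal, h4]
    simp only [inner_smul_right]
    push_cast
    ring
  rw [h1, charFun_map_smul, iIndepFun.charFun_map_fun_finsetSum_eq_prod
    (fun i _ => (hYm i).aemeasurable) (hYind.restrict _), Finset.prod_apply]
  simp only [h2]
  rw [Finset.prod_const, Nat.card_Ico, ← Complex.exp_nat_mul]

end IsPoissonMeasureSample

lemma norm_cexp_mul_I_sub_taylor_le {y : ℝ} (hy : |y| ≤ 1) :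
    ‖Complex.exp (y * Complex.I) - 1 - y * Complex.I + (y : ℂ) ^ 2 / 2‖ ≤ |y| ^ 3 := by
  have hn : ‖(y : ℂ) * Complex.I‖ = |y| := by simp
  have h := Complex.exp_bound (x := y * Complex.I) (by rw [hn]; exact hy) (n := 3) (by norm_num)
  rw [hn] at h
  have h1 : ∑ m ∈ Finset.range 3, ((y : ℂ) * Complex.I) ^ m / (m.factorial : ℂ) =
      1 + y * Complex.I - (y : ℂ) ^ 2 / 2 := by
    simp [Finset.sum_range_succ, mul_pow, Nat.factorial]
    ring
  rw [h1] at h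
  have h2 : Complex.exp (y * Complex.I) - 1 - y * Complex.I + (y : ℂ) ^ 2 / 2 =
      Complex.exp (y * Complex.I) - (1 + y * Complex.I - (y : ℂ) ^ 2 / 2) := by ring
  rw [h2]
  refine h.trans ?_
  have h3 : ((Nat.succ 3 : ℕ) : ℝ) * (((Nat.factorial 3 : ℕ) : ℝ) * ((3 : ℕ) : ℝ))⁻¹ ≤ 1 := by
    norm_num [Nat.factorial]
  exact mul_le_of_le_one_right (by positivity) h3

namespace IsPoissonMeasureSample

/-- The central limit theorem for centered integrals, in terms of characteristic functions. -/
lemma tendsto_charFun_centeredSum [IsProbabilityMeasure P] [IsFiniteMeasure Λ]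
    (h : IsPoissonMeasureSample P Λ X) (hf : Measurable f)
    {B : ℝ} (hB : ∀ t, ‖f t‖ ≤ B) {N k : ℕ → ℕ} (hk : Tendsto k atTop atTop)
    (hN : Tendsto (fun n => (N n : ℝ) / k n) atTop (𝓝 0)) (u : E) :
    Tendsto (fun n => charFun (P.map fun ω => (√(k n : ℝ))⁻¹ • centeredSum Λ X f (N n) (k n) ω) u)
      atTop (𝓝 (Complex.exp (-(∫ t, (inner ℝ (f t) u) ^ 2 ∂Λ : ℝ) / 2))) := by
  have hfi : Integrable f Λ := Integrable.of_bound hf.aestronglyMeasurable B (ae_of_all _ hB)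
  simp only [h.charFun_map_smul_centeredSum hf hfi]
  refine (Complex.continuous_exp.tendsto _).comp ?_
  have hkR : Tendsto (fun n => (k n : ℝ)) atTop atTop := tendsto_natCast_atTop_atTop.comp hk
  set D := B * ‖u‖ with hD
  have hB0 : 0 ≤ B := (norm_nonneg _).trans (hB 0)
  have hD0 : 0 ≤ D := by positivity
  have ha : ∀ t, |inner ℝ (f t) u| ≤ D := fun t =>
    (abs_real_inner_le_norm _ _).trans
      (mul_le_mul_of_nonneg_right (hB t) (norm_nonneg _))
  have hsq : Integrable (fun t => (inner ℝ (f t) u) ^ 2) Λ :=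
    Integrable.of_bound (C := D ^ 2) (by fun_prop) (ae_of_all _ fun t => by
      rw [norm_pow, Real.norm_eq_abs]
      exact pow_le_pow_left₀ (abs_nonneg _) (ha t) 2)
  set F : ℕ → ℝ → ℂ := fun n t =>
    Complex.exp (((√(k n : ℝ))⁻¹ * inner ℝ (f t) u : ℝ) * Complex.I) - 1
        - ((√(k n : ℝ))⁻¹ * inner ℝ (f t) u : ℝ) * Complex.I with hF
  have hFm : ∀ n, Measurable (F n) := fun n => by simp only [hF]; fun_prop
  have hmain : Tendsto (fun n => (k n : ℂ) * ∫ t, F n t ∂Λ) atTop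
      (𝓝 (-(∫ t, (inner ℝ (f t) u) ^ 2 ∂Λ : ℝ) / 2)) := by
    rw [tendsto_iff_norm_sub_tendsto_zero]
    have hlim : Tendsto (fun n => D ^ 3 * Λ.real Set.univ * (√(k n : ℝ))⁻¹) atTop (𝓝 0) := by
      have := ((Real.tendsto_sqrt_atTop.comp hkR).inv_tendsto_atTop).const_mul
        (D ^ 3 * Λ.real Set.univ)
      simpa using this
    refine squeeze_zero' (Eventually.of_forall fun _ => norm_nonneg _) ?_ hlim
    -- From here on D ≤ √k, so the argument of the exponential is at most 1 in absolute value, as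
    -- the Taylor bound requires.
    filter_upwards [hkR.eventually_ge_atTop (D ^ 2 + 1)] with n hn
    have hk0 : (0 : ℝ) < k n := by nlinarith
    have hs0 : 0 < √(k n : ℝ) := Real.sqrt_pos.2 hk0
    have hs2 : √(k n : ℝ) ^ 2 = k n := Real.sq_sqrt hk0.le
    have hDs : D ≤ √(k n : ℝ) := Real.le_sqrt_of_sq_le (by linarith)
    -- Uniformly in t, k times the exponent density differs from minus half the squared score
    -- pairing by O(k^(-1/2)): the factor k meets a cubic remainder of order k^(-3/2).
    have hbd : ∀ t, ‖(k n : ℂ) * F n t + (((inner ℝ (f t) u) ^ 2 : ℝ) : ℂ) / 2‖ ≤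
        D ^ 3 * (√(k n : ℝ))⁻¹ := fun t => by
      set a := inner ℝ (f t) u with ha_def
      have hy : |(√(k n : ℝ))⁻¹ * a| ≤ 1 := by
        rw [abs_mul, abs_of_pos (inv_pos.2 hs0), inv_mul_le_one₀ hs0]
        exact (ha t).trans hDs
      have h1 := norm_cexp_mul_I_sub_taylor_le hy
      have h2 : (k n : ℂ) * F n t + ((a ^ 2 : ℝ) : ℂ) / 2 =
          (k n : ℂ) * (F n t + (((√(k n : ℝ))⁻¹ * a : ℝ) : ℂ) ^ 2 / 2) := by
        have h3 : (k n : ℝ) * ((√(k n : ℝ))⁻¹ * a) ^ 2 = a ^ 2 := by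
          rw [mul_pow, inv_pow, hs2]
          field_simp
        have h4 : (k n : ℂ) * (((√(k n : ℝ))⁻¹ * a : ℝ) : ℂ) ^ 2 = ((a ^ 2 : ℝ) : ℂ) := by
          exact_mod_cast h3
        rw [mul_add, ← h4]
        ring
      rw [h2, norm_mul, Complex.norm_natCast]
      calc (k n : ℝ) * ‖F n t + (((√(k n : ℝ))⁻¹ * a : ℝ) : ℂ) ^ 2 / 2‖
          ≤ (k n : ℝ) * |(√(k n : ℝ))⁻¹ * a| ^ 3 := by gcongr
        _ ≤ (k n : ℝ) * ((√(k n : ℝ))⁻¹ * D) ^ 3 := by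
            gcongr
            rw [abs_mul, abs_of_pos (inv_pos.2 hs0)]
            gcongr
            exact ha t
        _ = D ^ 3 * (√(k n : ℝ))⁻¹ := by
            rw [mul_pow, inv_pow]
            nth_rewrite 1 [← hs2]
            field_simp
    have hFi : Integrable (F n) Λ := by
      have h5 : Integrable (fun t => (((√(k n : ℝ))⁻¹ * inner ℝ (f t) u : ℝ) : ℂ) * Complex.I) Λ :=
        (((hfi.inner_const u).const_mul _).ofReal).mul_const _
      refine Integrable.sub ?_ h5
      exact Integrable.of_bound (C := 2) (by fun_prop) (ae_of_all _ fun x => by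
        refine (norm_sub_le _ _).trans ?_
        rw [Complex.norm_exp_ofReal_mul_I]; norm_num)
    have h6 : (k n : ℂ) * ∫ t, F n t ∂Λ - -(∫ t, (inner ℝ (f t) u) ^ 2 ∂Λ : ℝ) / 2 =
        ∫ t, ((k n : ℂ) * F n t + (((inner ℝ (f t) u) ^ 2 : ℝ) : ℂ) / 2) ∂Λ := by
      have h7 : Integrable (fun t => (((inner ℝ (f t) u) ^ 2 : ℝ) : ℂ) / 2) Λ :=
        (hsq.ofReal (𝕜 := ℂ)).div_const 2
      rw [integral_add (hFi.const_mul _) h7, integral_const_mul, integral_div,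
        integral_complex_ofReal]
      ring
    rw [h6]
    refine (norm_integral_le_of_norm_le_const (ae_of_all _ hbd)).trans (le_of_eq ?_)
    ring
  -- The sum has k - N terms but is normalized by k; the discrepancy disappears in the limit.
  have hr : Tendsto (fun n => (((k n - N n : ℕ) : ℝ) / k n : ℝ)) atTop (𝓝 1) := by
    have h1 : Tendsto (fun n => 1 - (N n : ℝ) / k n) atTop (𝓝 1) := by
      simpa using hN.const_sub 1
    refine h1.congr' ?_
    filter_upwards [hN.eventually_lt_const zero_lt_one, hk.eventually_gt_atTop 0] with n hn hkn
    have hk0 : (0 : ℝ) < k n := by positivity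
    rw [div_lt_one hk0] at hn
    rw [Nat.cast_sub (by exact_mod_cast hn.le)]
    field_simp
  have hr' : Tendsto (fun n => (((k n - N n : ℕ) : ℝ) / k n : ℂ)) atTop (𝓝 1) := by
    have := (Complex.continuous_ofReal.tendsto _).comp hr
    simpa [Function.comp_def] using this
  have hfin := hr'.mul hmain
  rw [one_mul] at hfin
  refine hfin.congr' ?_
  filter_upwards [hk.eventually_gt_atTop 0] with n hkn
  have hk0 : (k n : ℂ) ≠ 0 := by
    exact_mod_cast hkn.ne'
  rw [← mul_assoc]
  congr 1
  push_cast
  field_simp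

/-- Normalized centered sums are bounded in probability. -/
lemma exists_measure_centeredSum_le [IsProbabilityMeasure P] [IsFiniteMeasure Λ]
    (h : IsPoissonMeasureSample P Λ X) (hf : Measurable f)
    {B : ℝ} (hB : ∀ t, ‖f t‖ ≤ B) {N k : ℕ → ℕ} (hk : Tendsto k atTop atTop)
    (hN : Tendsto (fun n => (N n : ℝ) / k n) atTop (𝓝 0)) {ε : ENNReal} (hε : 0 < ε) :
    ∃ M : ℝ, 0 < M ∧ ∀ n,
      P {ω | M < ‖(√(k n : ℝ))⁻¹ • centeredSum Λ X f (N n) (k n) ω‖} ≤ ε := by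
  have hm : ∀ n, Measurable fun ω => (√(k n : ℝ))⁻¹ • centeredSum Λ X f (N n) (k n) ω := fun n =>
    (h.measurable_centeredSum hf _ _).const_smul _
  have : ∀ n, IsProbabilityMeasure
      (P.map fun ω => (√(k n : ℝ))⁻¹ • centeredSum Λ X f (N n) (k n) ω) := fun n =>
    Measure.isProbabilityMeasure_map (hm n).aemeasurable
  have hB0 : 0 ≤ B := (norm_nonneg _).trans (hB 0)
  have hcont : ContinuousAt (fun u : E =>
      Complex.exp (-(∫ t, (inner ℝ (f t) u) ^ 2 ∂Λ : ℝ) / 2)) 0 := by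
    have h1 : ContinuousAt (fun u : E => ∫ t, (inner ℝ (f t) u) ^ 2 ∂Λ) 0 := by
      rw [ContinuousAt]
      simp only [inner_zero_right, ne_eq, OfNat.ofNat_ne_zero, not_false_eq_true, zero_pow,
        integral_zero]
      have hlim : Tendsto (fun u : E => (B * ‖u‖) ^ 2 * Λ.real Set.univ) (𝓝 0) (𝓝 0) := by
        have : Continuous fun u : E => (B * ‖u‖) ^ 2 * Λ.real Set.univ := by fun_prop
        simpa using this.tendsto 0
      refine squeeze_zero_norm (fun u => ?_) hlim
      refine norm_integral_le_of_norm_le_const (ae_of_all _ fun t => ?_)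
      rw [norm_pow, Real.norm_eq_abs]
      gcongr
      exact (abs_real_inner_le_norm _ _).trans
        (mul_le_mul_of_nonneg_right (hB t) (norm_nonneg _))
    have h2 : Continuous fun x : ℝ => Complex.exp (-(x : ℂ) / 2) := by fun_prop
    exact ContinuousAt.comp (g := fun x : ℝ => Complex.exp (-(x : ℂ) / 2)) h2.continuousAt h1
  -- Pointwise convergence of characteristic functions to a limit continuous at 0 forces tightness.
  have htight := isTightMeasureSet_of_tendsto_charFun hcont
    (h.tendsto_charFun_centeredSum hf hB hk hN)
  rw [isTightMeasureSet_iff_exists_isCompact_measure_compl_le] at htight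
  obtain ⟨K, hK, hKε⟩ := htight ε hε
  obtain ⟨R, hR⟩ := hK.isBounded.exists_norm_le
  refine ⟨max R 1, by positivity, fun n => ?_⟩
  refine le_trans ?_ (hKε _ ⟨n, rfl⟩)
  rw [Measure.map_apply (hm n) hK.measurableSet.compl]
  refine measure_mono fun ω hω => ?_
  intro hmem
  exact absurd (hR _ hmem) (not_le.2 ((le_max_left _ _).trans_lt hω))

end IsPoissonMeasureSample

end Sample

/-! ### Taylor bounds for gradients -/

section GradientCalculus

/-- First order Taylor bound for a function with Lipschitz derivative. -/
lemma norm_sub_sub_fderiv_le {E V : Type*} [NormedAddCommGroup E] [NormedSpace ℝ E]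
    [NormedAddCommGroup V] [NormedSpace ℝ V] {F : E → V}
    {s : Set E} (hs : Convex ℝ s) {C : ℝ} (hF : ∀ x ∈ s, DifferentiableAt ℝ F x)
    (hC : ∀ x ∈ s, ∀ y ∈ s, ‖fderiv ℝ F x - fderiv ℝ F y‖ ≤ C * ‖x - y‖) (hC0 : 0 ≤ C)
    {x y : E} (hx : x ∈ s) (hy : y ∈ s) :
    ‖F x - F y - fderiv ℝ F y (x - y)‖ ≤ C * ‖x - y‖ ^ 2 := by
  have hseg : segment ℝ y x ⊆ s := hs.segment_subset hy hx
  -- The mean value inequality is used on the segment only, where the derivative stays within C‖x -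
  -- y‖ of its value at y.
  have h := Convex.norm_image_sub_le_of_norm_fderiv_le' (𝕜 := ℝ) (f := F) (s := segment ℝ y x)
    (φ := fderiv ℝ F y) (C := C * ‖x - y‖) (fun z hz => hF z (hseg hz)) (fun z hz => ?_)
    (convex_segment _ _) (left_mem_segment ℝ y x) (right_mem_segment ℝ y x)
  · refine h.trans (le_of_eq ?_)
    ring
  · refine (hC z (hseg hz) y hy).trans ?_
    gcongr
    obtain ⟨a, ha, rfl⟩ := (segment_eq_image' ℝ y x ▸ hz)
    simp only [add_sub_cancel_left]
    rw [norm_smul, Real.norm_of_nonneg ha.1]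
    exact mul_le_of_le_one_left (norm_nonneg _) ha.2

variable {E : Type*} [NormedAddCommGroup E] [InnerProductSpace ℝ E] [CompleteSpace E]

/-- The Riesz isometry from the dual space, as a linear isometry over `ℝ`. -/
noncomputable def rieszIsometry (E : Type*) [NormedAddCommGroup E] [InnerProductSpace ℝ E]
    [CompleteSpace E] : StrongDual ℝ E →ₗᵢ[ℝ] E where
  toFun := (InnerProductSpace.toDual ℝ E).symm
  map_add' := map_add _
  map_smul' c x := by simp
  norm_map' x := by simp

/-- Being a fixed linear isometry after the derivative, the gradient inherits smoothness and all
norm bounds on higher derivatives. -/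
lemma gradient_eq_rieszIsometry_comp (f : E → ℝ) :
    gradient f = rieszIsometry E ∘ fderiv ℝ f := rfl

lemma norm_gradient (f : E → ℝ) (x : E) : ‖gradient f x‖ = ‖iteratedFDeriv ℝ 1 f x‖ := by
  rw [norm_iteratedFDeriv_one, gradient_eq_rieszIsometry_comp]
  exact (rieszIsometry E).norm_map _

lemma ContDiffAt.gradient {f : E → ℝ} {x : E} (hf : ContDiffAt ℝ 3 f x) :
    ContDiffAt ℝ 2 (gradient f) x :=
  (rieszIsometry E).toContinuousLinearMap.contDiff.contDiffAt.comp x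
    (hf.fderiv_right (m := 2) (by norm_num))

lemma norm_iteratedFDeriv_gradient {f : E → ℝ} {x : E} (hf : ContDiffAt ℝ 3 f x) {i : ℕ}
    (hi : i ≤ 2) : ‖iteratedFDeriv ℝ i (gradient f) x‖ = ‖iteratedFDeriv ℝ (i + 1) f x‖ := by
  rw [gradient_eq_rieszIsometry_comp, (rieszIsometry E).norm_iteratedFDeriv_comp_left
    (hf.fderiv_right (m := 2) (by norm_num)) (by exact_mod_cast hi), norm_iteratedFDeriv_fderiv]

/-- The uniform bounds on a function with three bounded derivatives which are used below. -/
lemma gradient_bounds {Θ : Set E} (hΘo : IsOpen Θ) (hΘc : Convex ℝ Θ) {f : E → ℝ}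
    (hf : ContDiffOn ℝ 3 f Θ) {C : ℝ} (hC0 : 0 ≤ C)
    (hC : ∀ m : ℕ, 1 ≤ m → m ≤ 3 → ∀ θ ∈ Θ, ‖iteratedFDeriv ℝ m f θ‖ ≤ C)
    {x y : E} (hx : x ∈ Θ) (hy : y ∈ Θ) :
    ‖gradient f x‖ ≤ C ∧ ‖fderiv ℝ (gradient f) x‖ ≤ C ∧ |f x - f y| ≤ C * ‖x - y‖ ∧
      ‖gradient f x - gradient f y‖ ≤ C * ‖x - y‖ ∧
      |f x - f y - inner ℝ (gradient f y) (x - y)| ≤ C * ‖x - y‖ ^ 2 ∧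
      ‖gradient f x - gradient f y - fderiv ℝ (gradient f) y (x - y)‖ ≤ C * ‖x - y‖ ^ 2 := by
  have hat : ∀ z ∈ Θ, ContDiffAt ℝ 3 f z := fun z hz => hf.contDiffAt (hΘo.mem_nhds hz)
  have hfd : ∀ z ∈ Θ, DifferentiableAt ℝ f z := fun z hz =>
    (hat z hz).differentiableAt (by norm_num)
  have hgd : ∀ z ∈ Θ, DifferentiableAt ℝ (gradient f) z := fun z hz =>
    (hat z hz).gradient.differentiableAt (by norm_num)
  have hggd : ∀ z ∈ Θ, DifferentiableAt ℝ (fderiv ℝ (gradient f)) z := fun z hz =>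
    ((hat z hz).gradient.fderiv_right (m := 1) (by norm_num)).differentiableAt (by norm_num)
  have h1 : ∀ z ∈ Θ, ‖gradient f z‖ ≤ C := fun z hz => by
    rw [norm_gradient]; exact hC 1 le_rfl (by norm_num) z hz
  have h1' : ∀ z ∈ Θ, ‖fderiv ℝ f z‖ ≤ C := fun z hz => by
    rw [← norm_iteratedFDeriv_one]; exact hC 1 le_rfl (by norm_num) z hz
  have h2 : ∀ z ∈ Θ, ‖fderiv ℝ (gradient f) z‖ ≤ C := fun z hz => by
    rw [← norm_iteratedFDeriv_one, norm_iteratedFDeriv_gradient (hat z hz) (by norm_num)]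
    exact hC 2 (by norm_num) (by norm_num) z hz
  have h3 : ∀ z ∈ Θ, ‖fderiv ℝ (fderiv ℝ (gradient f)) z‖ ≤ C := fun z hz => by
    rw [← norm_iteratedFDeriv_one, norm_iteratedFDeriv_fderiv,
      norm_iteratedFDeriv_gradient (hat z hz) (by norm_num)]
    exact hC 3 (by norm_num) (by norm_num) z hz
  have h4 : ∀ u ∈ Θ, ∀ v ∈ Θ, ‖gradient f u - gradient f v‖ ≤ C * ‖u - v‖ := fun u hu v hv =>
    Convex.norm_image_sub_le_of_norm_fderiv_le hgd h2 hΘc hv hu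
  refine ⟨h1 x hx, h2 x hx, ?_, h4 x hx y hy, ?_, ?_⟩
  · exact Convex.norm_image_sub_le_of_norm_fderiv_le hfd h1' hΘc hy hx
  · rw [inner_gradient_left, ← Real.norm_eq_abs]
    refine norm_sub_sub_fderiv_le hΘc hfd (fun u hu v hv => ?_) hC0 hx hy
    refine le_trans (le_of_eq ?_) (h4 u hu v hv)
    rw [gradient_eq_rieszIsometry_comp, Function.comp_apply, Function.comp_apply, ← map_sub,
      LinearIsometry.norm_map]
  · exact norm_sub_sub_fderiv_le hΘc hgd (fun u hu v hv =>
      Convex.norm_image_sub_le_of_norm_fderiv_le hggd h3 hΘc hv hu) hC0 hx hy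

end GradientCalculus

/-! ### Measurability of derivatives in a parameter -/

section ParametricMeasurability

/-- The hypotheses speak of values on the window only; extension by zero makes them statements about
Borel functions on the whole line. -/
lemma measurable_indicator_iff_domRestrict {α β : Type*} [MeasurableSpace α] [MeasurableSpace β]
    [Zero β] {T : Set α} (hT : MeasurableSet T) {g : α → β} :
    Measurable (T.indicator g) ↔ Measurable (T.domRestrict g) := by
  have h1 : T.domRestrict (T.indicator g) = T.domRestrict g := by
    ext x
    simp [Set.domRestrict]
  constructor
  · intro h
    rw [← h1]
    exact h.comp measurable_subtype_coe
  · intro h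
    refine measurable_of_restrict_of_restrict_compl hT (h1 ▸ h) ?_
    have h2 : Tᶜ.domRestrict (T.indicator g) = fun _ => 0 := by
      ext x
      exact Set.indicator_of_notMem x.2 _
    rw [h2]
    exact measurable_const

/-- Directional derivatives in a parameter of a measurable family are measurable. -/
lemma measurable_indicator_fderiv_apply {α E V : Type*} [MeasurableSpace α] [NormedAddCommGroup E]
    [NormedSpace ℝ E] [NormedAddCommGroup V] [NormedSpace ℝ V] [FiniteDimensional ℝ V]
    [MeasurableSpace V] [BorelSpace V] {T : Set α} {Θ : Set E} (hΘ : IsOpen Θ) {F : E → α → V}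
    (hFm : ∀ θ ∈ Θ, Measurable (T.indicator (F θ))) {θ : E} (hθ : θ ∈ Θ)
    (hF : ∀ t ∈ T, DifferentiableAt ℝ (fun θ' => F θ' t) θ) (v : E) :
    Measurable (T.indicator fun t => fderiv ℝ (fun θ' => F θ' t) θ v) := by
  have : FiniteDimensional ℝ V := inferInstance
  have hc : Tendsto (fun n : ℕ => ‖(n : ℝ)‖) atTop atTop := by
    simpa using tendsto_natCast_atTop_atTop (R := ℝ)
  have hmem : ∀ᶠ n : ℕ in atTop, θ + (n : ℝ)⁻¹ • v ∈ Θ := by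
    have h : Tendsto (fun n : ℕ => θ + (n : ℝ)⁻¹ • v) atTop (𝓝 (θ + (0 : ℝ) • v)) :=
      (tendsto_inv_atTop_nhds_zero_nat.smul_const v).const_add θ
    rw [zero_smul, add_zero] at h
    exact h.eventually (hΘ.mem_nhds hθ)
  obtain ⟨n₀, hn₀⟩ := eventually_atTop.1 hmem
  -- The derivative is a limit of difference quotients with increments v/(n + n₀); the shift by n₀
  -- keeps every evaluation point inside Θ.
  refine measurable_of_tendsto_metrizable (f := fun n : ℕ => fun t =>
    ((n + n₀ : ℕ) : ℝ) • (T.indicator (F (θ + ((n + n₀ : ℕ) : ℝ)⁻¹ • v)) t - T.indicator (F θ) t))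
    (fun n => ?_) ?_
  · exact ((hFm _ (hn₀ _ (Nat.le_add_left _ _))).sub (hFm θ hθ)).const_smul _
  · rw [tendsto_pi_nhds]
    intro t
    by_cases ht : t ∈ T
    · simp only [Set.indicator_of_mem ht]
      exact ((hF t ht).hasFDerivAt.lim v hc).comp (tendsto_add_atTop_nat n₀)
    · simp [Set.indicator_of_notMem ht]

end ParametricMeasurability

/-! ### Elementary bounds for the exponential -/

section ExpBounds

lemma abs_exp_sub_one_le_mul_exp (x : ℝ) : |Real.exp x - 1| ≤ |x| * Real.exp |x| := by
  have h := Complex.norm_exp_sub_sum_le_norm_mul_exp x 1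
  simp only [Finset.sum_range_one, pow_zero, Nat.factorial_zero, Nat.cast_one, div_one, pow_one,
    Complex.norm_real, Real.norm_eq_abs] at h
  rw [← Complex.ofReal_exp, ← Complex.ofReal_one, ← Complex.ofReal_sub, Complex.norm_real] at h
  exact h

lemma abs_exp_sub_one_sub_le_mul_exp (x : ℝ) :
    |Real.exp x - 1 - x| ≤ |x| ^ 2 * Real.exp |x| := by
  have h := Complex.norm_exp_sub_sum_le_norm_mul_exp x 2
  simp only [Finset.sum_range_succ, Finset.sum_range_zero, zero_add, pow_zero, pow_one,
    Nat.factorial_zero, Nat.factorial_one, Nat.cast_one, div_one, Complex.norm_real,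
    Real.norm_eq_abs] at h
  rw [← Complex.ofReal_exp, ← Complex.ofReal_one, ← Complex.ofReal_add, ← Complex.ofReal_sub,
    Complex.norm_real, ← sub_sub] at h
  exact h

end ExpBounds

/-! ### Uniform regularity of the intensity and the score -/

section Intensity

variable {d : ℕ} {T : Set ℝ} {Θ : Set (EuclideanSpace ℝ (Fin d))}
  {lam : EuclideanSpace ℝ (Fin d) → ℝ → ℝ}

/-- Uniform Lipschitz and Taylor bounds, with constant `C`, for the score and the intensity. -/
structure ScoreBounds (T : Set ℝ) (Θ : Set (EuclideanSpace ℝ (Fin d)))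
    (lam : EuclideanSpace ℝ (Fin d) → ℝ → ℝ) (C : ℝ) : Prop where
  const_pos : 0 < C
  differentiableAt_score : ∀ θ ∈ Θ, ∀ t ∈ T, DifferentiableAt ℝ (fun θ' => score lam θ' t) θ
  gradient_eq : ∀ θ ∈ Θ, ∀ t ∈ T, gradient (fun θ' => lam θ' t) θ = lam θ t • score lam θ t
  norm_score : ∀ θ ∈ Θ, ∀ t ∈ T, ‖score lam θ t‖ ≤ C
  norm_fderiv_score : ∀ θ ∈ Θ, ∀ t ∈ T, ‖fderiv ℝ (fun θ' => score lam θ' t) θ‖ ≤ C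
  score_sub : ∀ θ ∈ Θ, ∀ θ' ∈ Θ, ∀ t ∈ T, ‖score lam θ t - score lam θ' t‖ ≤ C * ‖θ - θ'‖
  score_taylor : ∀ θ ∈ Θ, ∀ θ' ∈ Θ, ∀ t ∈ T, ‖score lam θ t - score lam θ' t
    - fderiv ℝ (fun θ'' => score lam θ'' t) θ' (θ - θ')‖ ≤ C * ‖θ - θ'‖ ^ 2
  lam_le : ∀ θ ∈ Θ, ∀ θ' ∈ Θ, ∀ t ∈ T, lam θ t ≤ C * lam θ' t
  lam_sub : ∀ θ ∈ Θ, ∀ θ' ∈ Θ, ∀ t ∈ T, |lam θ t - lam θ' t| ≤ C * ‖θ - θ'‖ * lam θ' t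
  lam_taylor : ∀ θ ∈ Θ, ∀ θ' ∈ Θ, ∀ t ∈ T,
    |lam θ t - lam θ' t - lam θ' t * inner ℝ (score lam θ' t) (θ - θ')| ≤
      C * ‖θ - θ'‖ ^ 2 * lam θ' t

/-- On a convex bounded Θ a bounded gradient makes log λ Lipschitz with bounded oscillation, so the
intensities at different parameters are uniformly comparable. Writing λ(θ) = λ(θ') e^Δ transfers the
Taylor bounds from log λ to λ with errors relative to λ(θ'). No pointwise bound on λ itself is
required. -/
lemma exists_scoreBounds (hΘo : IsOpen Θ) (hΘc : Convex ℝ Θ) (hΘb : Bornology.IsBounded Θ)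
    (hlam : IsIntensityFamily T Θ lam) (hL0 : RegularityL0 T Θ lam) :
    ∃ C, ScoreBounds T Θ lam C := by
  obtain ⟨C₀, hC₀⟩ := hL0.bounded
  obtain ⟨R, hR⟩ := Metric.isBounded_iff.1 hΘb
  set A := max C₀ 1 with hA
  have hA1 : 1 ≤ A := le_max_right _ _
  have hA0 : 0 < A := by linarith
  -- A bounds the derivatives of log λ and R the diameter of Θ, so Q bounds every ratio of
  -- intensities.
  set Q := Real.exp (A * R) with hQ
  have hQ0 : 0 < Q := Real.exp_pos _
  have hb : ∀ t ∈ T, ∀ θ ∈ Θ, ∀ θ' ∈ Θ, _ := fun t ht θ hθ θ' hθ' =>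
    gradient_bounds hΘo hΘc (hL0.smooth t ht) (C := A) hA0.le
      (fun m h1 h3 z hz => (hC₀ m h1 h3 z hz t ht).trans (le_max_left _ _)) hθ hθ'
  have hexp : ∀ θ ∈ Θ, ∀ t ∈ T, Real.exp (Real.log (lam θ t)) = lam θ t := fun θ hθ t ht =>
    Real.exp_log (hlam.pos θ hθ t ht)
  have hΔ : ∀ θ ∈ Θ, ∀ θ' ∈ Θ, ∀ t ∈ T, lam θ t =
      lam θ' t * Real.exp (Real.log (lam θ t) - Real.log (lam θ' t)) := fun θ hθ θ' hθ' t ht => by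
    rw [← Real.log_div (hlam.pos θ hθ t ht).ne' (hlam.pos θ' hθ' t ht).ne',
      Real.exp_log (div_pos (hlam.pos θ hθ t ht) (hlam.pos θ' hθ' t ht))]
    field_simp [(hlam.pos θ' hθ' t ht).ne']
  have hQle : ∀ θ ∈ Θ, ∀ θ' ∈ Θ, ∀ t ∈ T,
      Real.exp |Real.log (lam θ t) - Real.log (lam θ' t)| ≤ Q := fun θ hθ θ' hθ' t ht => by
    refine Real.exp_le_exp.2 (((hb t ht θ hθ θ' hθ').2.2.1).trans ?_)
    gcongr
    rw [← dist_eq_norm]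
    exact hR hθ hθ'
  have hAC : A ≤ A + Q + A * Q + (A ^ 2 * Q + A) := by nlinarith [mul_pos hA0 hQ0]
  have hdiff : ∀ θ ∈ Θ, ∀ t ∈ T, ContDiffAt ℝ 3 (fun θ' => Real.log (lam θ' t)) θ :=
    fun θ hθ t ht => (hL0.smooth t ht).contDiffAt (hΘo.mem_nhds hθ)
  -- The constant is the sum of those arising in the separate bounds.
  refine ⟨A + Q + A * Q + (A ^ 2 * Q + A), by positivity, ?_, ?_, ?_, ?_, ?_, ?_, ?_, ?_, ?_⟩
  · exact fun θ hθ t ht => (hdiff θ hθ t ht).gradient.differentiableAt (by norm_num)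
  · intro θ hθ t ht
    have h1 : (fun θ' => lam θ' t) =ᶠ[𝓝 θ] fun θ' => Real.exp (Real.log (lam θ' t)) := by
      filter_upwards [hΘo.mem_nhds hθ] with z hz using (hexp z hz t ht).symm
    rw [score, gradient, gradient, h1.fderiv_eq,
      fderiv_exp ((hdiff θ hθ t ht).differentiableAt (by norm_num)), hexp θ hθ t ht, map_smulₛₗ]
    rfl
  · exact fun θ hθ t ht => ((hb t ht θ hθ θ hθ).1).trans hAC
  · exact fun θ hθ t ht => ((hb t ht θ hθ θ hθ).2.1).trans hAC
  · intro θ hθ θ' hθ' t ht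
    refine ((hb t ht θ hθ θ' hθ').2.2.2.1).trans ?_
    gcongr
  · intro θ hθ θ' hθ' t ht
    refine ((hb t ht θ hθ θ' hθ').2.2.2.2.2).trans ?_
    gcongr
  · intro θ hθ θ' hθ' t ht
    have hl := hlam.pos θ' hθ' t ht
    rw [hΔ θ hθ θ' hθ' t ht, mul_comm]
    gcongr
    refine (Real.exp_le_exp.2 (le_abs_self _)).trans ((hQle θ hθ θ' hθ' t ht).trans ?_)
    nlinarith [mul_pos hA0 hQ0, mul_pos (pow_pos hA0 2) hQ0]
  · intro θ hθ θ' hθ' t ht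
    have hl := hlam.pos θ' hθ' t ht
    set Δ := Real.log (lam θ t) - Real.log (lam θ' t) with hΔd
    have h1 : lam θ t - lam θ' t = lam θ' t * (Real.exp Δ - 1) := by
      rw [hΔ θ hθ θ' hθ' t ht]; ring
    rw [h1, abs_mul, abs_of_pos hl, mul_comm]
    gcongr
    calc |Real.exp Δ - 1| ≤ |Δ| * Real.exp |Δ| := abs_exp_sub_one_le_mul_exp _
      _ ≤ (A * ‖θ - θ'‖) * Q :=
        mul_le_mul (hb t ht θ hθ θ' hθ').2.2.1 (hQle θ hθ θ' hθ' t ht) (Real.exp_pos _).le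
          (by positivity)
      _ = A * Q * ‖θ - θ'‖ := by ring
      _ ≤ _ := by
        gcongr
        nlinarith [mul_pos (pow_pos hA0 2) hQ0]
  · intro θ hθ θ' hθ' t ht
    have hl := hlam.pos θ' hθ' t ht
    set Δ := Real.log (lam θ t) - Real.log (lam θ' t) with hΔd
    set w := inner ℝ (score lam θ' t) (θ - θ') with hw
    have h1 : lam θ t - lam θ' t - lam θ' t * w =
        lam θ' t * ((Real.exp Δ - 1 - Δ) + (Δ - w)) := by
      rw [hΔ θ hθ θ' hθ' t ht]; ring
    rw [h1, abs_mul, abs_of_pos hl, mul_comm]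
    gcongr
    calc |(Real.exp Δ - 1 - Δ) + (Δ - w)| ≤ |Real.exp Δ - 1 - Δ| + |Δ - w| := abs_add_le _ _
      _ ≤ |Δ| ^ 2 * Real.exp |Δ| + A * ‖θ - θ'‖ ^ 2 :=
        add_le_add (abs_exp_sub_one_sub_le_mul_exp _) (hb t ht θ hθ θ' hθ').2.2.2.2.1
      _ ≤ (A * ‖θ - θ'‖) ^ 2 * Q + A * ‖θ - θ'‖ ^ 2 := by
        refine add_le_add ?_ le_rfl
        refine mul_le_mul ?_ (hQle θ hθ θ' hθ' t ht) (Real.exp_pos _).le (by positivity)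
        exact pow_le_pow_left₀ (abs_nonneg _) (hb t ht θ hθ θ' hθ').2.2.1 2
      _ = (A ^ 2 * Q + A) * ‖θ - θ'‖ ^ 2 := by ring
      _ ≤ _ := by
        refine mul_le_mul_of_nonneg_right ?_ (by positivity)
        nlinarith [mul_pos hA0 hQ0]

lemma IsIntensityFamily.measurable_indicator (hT : MeasurableSet T)
    (hlam : IsIntensityFamily T Θ lam) {θ : EuclideanSpace ℝ (Fin d)} (hθ : θ ∈ Θ) :
    Measurable (T.indicator (lam θ)) :=
  (measurable_indicator_iff_domRestrict hT).2 (hlam.measurable θ hθ)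

/-- Each coordinate of the score is a directional derivative in θ of log λ, hence a limit of
measurable functions of t. -/
lemma measurable_indicator_score (hT : MeasurableSet T) (hΘo : IsOpen Θ)
    (hlam : IsIntensityFamily T Θ lam) (hL0 : RegularityL0 T Θ lam)
    {θ : EuclideanSpace ℝ (Fin d)} (hθ : θ ∈ Θ) : Measurable (T.indicator (score lam θ)) := by
  have hlog : ∀ θ' ∈ Θ, Measurable (T.indicator fun t => Real.log (lam θ' t)) := fun θ' hθ' => by
    have h : (T.indicator fun t => Real.log (lam θ' t)) =
        fun t => Real.log (T.indicator (lam θ') t) := by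
      ext t
      by_cases ht : t ∈ T <;> simp [ht]
    rw [h]
    exact Real.measurable_log.comp (hlam.measurable_indicator hT hθ')
  have hd : ∀ v, Measurable (T.indicator fun t => fderiv ℝ (fun θ' => Real.log (lam θ' t)) θ v) :=
    fun v => measurable_indicator_fderiv_apply hΘo hlog hθ (fun t ht =>
      ((hL0.smooth t ht).contDiffAt (hΘo.mem_nhds hθ)).differentiableAt (by norm_num)) v
  set b := EuclideanSpace.basisFun (Fin d) ℝ with hb
  have h : T.indicator (score lam θ) = fun t => ∑ i, (T.indicator fun t =>
      fderiv ℝ (fun θ' => Real.log (lam θ' t)) θ (b i)) t • b i := by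
    ext1 t
    by_cases ht : t ∈ T
    · simp only [Set.indicator_of_mem ht]
      rw [← b.sum_repr' (score lam θ t)]
      refine Finset.sum_congr rfl fun i _ => ?_
      rw [real_inner_comm, score, inner_gradient_left]
    · simp [ht]
  rw [h]
  exact Finset.measurable_fun_sum _ fun i _ => (hd (b i)).smul_const _

end Intensity

/-! ### Fisher information and its inverse -/

section RegularModel

variable {d : ℕ} {T : Set ℝ} {Θ : Set (EuclideanSpace ℝ (Fin d))}
  {lam : EuclideanSpace ℝ (Fin d) → ℝ → ℝ} {C c : ℝ}

/-- A smooth intensity family with quantitative bounds: `C` bounds the score and its variation,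
and `c` bounds the Fisher information from below. -/
structure RegularModel (T : Set ℝ) (Θ : Set (EuclideanSpace ℝ (Fin d)))
    (lam : EuclideanSpace ℝ (Fin d) → ℝ → ℝ) (C c : ℝ) : Prop extends
    ScoreBounds T Θ lam C where
  measurableSet : MeasurableSet T
  isOpen : IsOpen Θ
  family : IsIntensityFamily T Θ lam
  measurable_score : ∀ θ ∈ Θ, Measurable (T.indicator (score lam θ))
  info_pos : 0 < c
  le_info : ∀ θ ∈ Θ, ∀ u : EuclideanSpace ℝ (Fin d), ‖u‖ = 1 →
    c ≤ inner ℝ u (Matrix.toEuclideanLin (fisherInfo T lam θ) u)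

lemma exists_regularModel (hT : T.OrdConnected) (hΘo : IsOpen Θ) (hΘc : Convex ℝ Θ)
    (hΘb : Bornology.IsBounded Θ) (hlam : IsIntensityFamily T Θ lam) (hL0 : RegularityL0 T Θ lam) :
    ∃ C c, RegularModel T Θ lam C c := by
  obtain ⟨C, hC⟩ := exists_scoreBounds hΘo hΘc hΘb hlam hL0
  obtain ⟨c, hc, hcI⟩ := hL0.nondegenerate
  -- The window enters the proof only through its Borel measurability, which order-connectedness
  -- provides.
  exact ⟨C, c, hC, hT.measurableSet, hΘo, hlam,
    fun θ hθ => measurable_indicator_score hT.measurableSet hΘo hlam hL0 hθ, hc, hcI⟩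

/-- The expected number of events. -/
noncomputable def totalIntensity (T : Set ℝ) (lam : EuclideanSpace ℝ (Fin d) → ℝ → ℝ)
    (θ : EuclideanSpace ℝ (Fin d)) : ℝ := ∫ t in T, lam θ t

/-- The compensator `∫_T lam(θ, t) score(θ, t) dt` of the score. -/
noncomputable def scoreDrift (T : Set ℝ) (lam : EuclideanSpace ℝ (Fin d) → ℝ → ℝ)
    (θ : EuclideanSpace ℝ (Fin d)) : EuclideanSpace ℝ (Fin d) :=
  ∫ t in T, lam θ t • score lam θ t

/-- The Fisher information as an operator. -/
noncomputable def infoOp (T : Set ℝ) (lam : EuclideanSpace ℝ (Fin d) → ℝ → ℝ)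
    (θ : EuclideanSpace ℝ (Fin d)) : EuclideanSpace ℝ (Fin d) →ₗ[ℝ] EuclideanSpace ℝ (Fin d) :=
  Matrix.toEuclideanLin (fisherInfo T lam θ)

/-- The inverse of the Fisher information as an operator. -/
noncomputable def infoInv (T : Set ℝ) (lam : EuclideanSpace ℝ (Fin d) → ℝ → ℝ)
    (θ : EuclideanSpace ℝ (Fin d)) : EuclideanSpace ℝ (Fin d) →ₗ[ℝ] EuclideanSpace ℝ (Fin d) :=
  Matrix.toEuclideanLin (fisherInfo T lam θ)⁻¹

namespace RegularModel

variable (h : RegularModel T Θ lam C c) {θ θ' : EuclideanSpace ℝ (Fin d)}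
include h

lemma aestronglyMeasurable {V : Type*} [NormedAddCommGroup V] [NormedSpace ℝ V]
    [FiniteDimensional ℝ V] [MeasurableSpace V] [BorelSpace V] {g : ℝ → V}
    (hg : Measurable (T.indicator g)) : AEStronglyMeasurable g (volume.restrict T) := by
  have : FiniteDimensional ℝ V := inferInstance
  have h1 : AEStronglyMeasurable (T.indicator g) (volume.restrict T) := hg.aestronglyMeasurable
  refine h1.congr ?_
  filter_upwards [ae_restrict_mem h.measurableSet] with t ht
  exact Set.indicator_of_mem ht g

lemma integrable_smul {V : Type*} [NormedAddCommGroup V] [NormedSpace ℝ V]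
    [FiniteDimensional ℝ V] [MeasurableSpace V] [BorelSpace V] {g : ℝ → V}
    (hg : Measurable (T.indicator g)) {B : ℝ} (hB : ∀ t ∈ T, ‖g t‖ ≤ B) (hθ : θ ∈ Θ) :
    Integrable (fun t => lam θ t • g t) (volume.restrict T) := by
  have hi := h.family.integrableOn θ hθ
  refine (hi.norm.const_mul B).mono' (hi.aestronglyMeasurable.smul (h.aestronglyMeasurable hg)) ?_
  filter_upwards [ae_restrict_mem h.measurableSet] with t ht
  rw [norm_smul, mul_comm]
  gcongr
  exact hB t ht

lemma norm_setIntegral_le {V : Type*} [NormedAddCommGroup V] [NormedSpace ℝ V] {F : ℝ → V}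
    (hθ : θ ∈ Θ) {M : ℝ} (hF : ∀ t ∈ T, ‖F t‖ ≤ M * lam θ t) :
    ‖∫ t in T, F t‖ ≤ M * totalIntensity T lam θ := by
  rw [totalIntensity, ← integral_const_mul]
  refine norm_integral_le_of_norm_le ((h.family.integrableOn θ hθ).const_mul M) ?_
  filter_upwards [ae_restrict_mem h.measurableSet] with t ht using hF t ht

lemma totalIntensity_nonneg (hθ : θ ∈ Θ) : 0 ≤ totalIntensity T lam θ :=
  setIntegral_nonneg h.measurableSet fun t ht => (h.family.pos θ hθ t ht).le

lemma totalIntensity_le (hθ : θ ∈ Θ) (hθ' : θ' ∈ Θ) :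
    totalIntensity T lam θ ≤ C * totalIntensity T lam θ' := by
  rw [totalIntensity, totalIntensity, ← integral_const_mul]
  exact setIntegral_mono_on (h.family.integrableOn θ hθ)
    ((h.family.integrableOn θ' hθ').const_mul C) h.measurableSet
    fun t ht => h.lam_le θ hθ θ' hθ' t ht

lemma measurable_indicator_inner (hθ : θ ∈ Θ) (v : EuclideanSpace ℝ (Fin d)) :
    Measurable (T.indicator fun t => inner ℝ (score lam θ t) v) := by
  have h1 : (T.indicator fun t => inner ℝ (score lam θ t) v) =
      fun t => inner ℝ (T.indicator (score lam θ) t) v := by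
    ext t
    by_cases ht : t ∈ T <;> simp [ht]
  rw [h1]
  exact (h.measurable_score θ hθ).inner_const

lemma measurable_indicator_inner_smul (hθ : θ ∈ Θ) (v : EuclideanSpace ℝ (Fin d)) :
    Measurable (T.indicator fun t => (inner ℝ (score lam θ t) v : ℝ) • score lam θ t) := by
  have h1 : (T.indicator fun t => (inner ℝ (score lam θ t) v : ℝ) • score lam θ t) =
      fun t => (T.indicator fun t => (inner ℝ (score lam θ t) v : ℝ)) t •
        T.indicator (score lam θ) t := by
    ext1 t
    by_cases ht : t ∈ T <;> simp [ht]
  rw [h1]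
  exact (h.measurable_indicator_inner hθ v).smul (h.measurable_score θ hθ)

lemma abs_inner_score_le (hθ : θ ∈ Θ) (v : EuclideanSpace ℝ (Fin d)) {t : ℝ} (ht : t ∈ T) :
    |inner ℝ (score lam θ t) v| ≤ C * ‖v‖ :=
  (abs_real_inner_le_norm _ _).trans
    (mul_le_mul_of_nonneg_right (h.norm_score θ hθ t ht) (norm_nonneg _))

lemma norm_inner_smul_score_le (hθ : θ ∈ Θ) (v : EuclideanSpace ℝ (Fin d)) {t : ℝ} (ht : t ∈ T) :
    ‖(inner ℝ (score lam θ t) v : ℝ) • score lam θ t‖ ≤ C * ‖v‖ * C := by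
  have hC := h.const_pos
  rw [norm_smul, Real.norm_eq_abs]
  exact mul_le_mul (h.abs_inner_score_le hθ v ht) (h.norm_score θ hθ t ht) (norm_nonneg _)
    (by positivity)

lemma integrable_inner_smul_score (hθ : θ ∈ Θ) (v : EuclideanSpace ℝ (Fin d)) :
    Integrable (fun t => lam θ t • (inner ℝ (score lam θ t) v : ℝ) • score lam θ t)
      (volume.restrict T) :=
  h.integrable_smul (h.measurable_indicator_inner_smul hθ v)
    (fun _ ht => h.norm_inner_smul_score_le hθ v ht) hθ

/-- Since ∂λ = λ · score, the quotient ∂λ ∂λᵀ/λ is λ · score scoreᵀ, an integral against the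
intensity in which only bounded factors vary. -/
lemma infoOp_apply (hθ : θ ∈ Θ) (v : EuclideanSpace ℝ (Fin d)) :
    infoOp T lam θ v = ∫ t in T, lam θ t • (inner ℝ (score lam θ t) v : ℝ) • score lam θ t := by
  have hentry : ∀ i j, fisherInfo T lam θ i j =
      ∫ t in T, lam θ t * (score lam θ t i * score lam θ t j) := fun i j => by
    simp only [fisherInfo, Matrix.of_apply]
    refine setIntegral_congr_fun h.measurableSet fun t ht => ?_
    have hl := (h.family.pos θ hθ t ht).ne'
    simp only [h.gradient_eq θ hθ t ht, PiLp.smul_apply, smul_eq_mul]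
    field_simp
  have hint : ∀ i j, Integrable (fun t => lam θ t * (score lam θ t i * score lam θ t j))
      (volume.restrict T) := fun i j => by
    have h1 := (EuclideanSpace.proj i : EuclideanSpace ℝ (Fin d) →L[ℝ] ℝ).integrable_comp
      (h.integrable_inner_smul_score hθ (EuclideanSpace.single j 1))
    refine h1.congr (ae_of_all _ fun t => ?_)
    simp [EuclideanSpace.inner_single_right, mul_comm]
  ext i
  have h2 := (EuclideanSpace.proj i : EuclideanSpace ℝ (Fin d) →L[ℝ] ℝ).integral_comp_comm
    (h.integrable_inner_smul_score hθ v)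
  refine Eq.trans ?_ h2
  have h3 : infoOp T lam θ v i = ∑ j, fisherInfo T lam θ i j * v j := by
    rw [infoOp, Matrix.toEuclideanLin, Matrix.toLpLin_apply]
    rfl
  rw [h3]
  simp only [hentry, ← integral_mul_const]
  rw [← integral_finsetSum _ fun j _ => (hint i j).mul_const (v j)]
  refine integral_congr_ae (ae_of_all _ fun t => ?_)
  simp only [PiLp.proj_apply, PiLp.smul_apply, smul_eq_mul, PiLp.inner_apply,
    RCLike.inner_apply, conj_trivial,
    Finset.mul_sum, Finset.sum_mul]
  exact Finset.sum_congr rfl fun j _ => by ring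

lemma inner_infoOp (hθ : θ ∈ Θ) (v w : EuclideanSpace ℝ (Fin d)) :
    inner ℝ w (infoOp T lam θ v) =
      ∫ t in T, lam θ t * (inner ℝ (score lam θ t) v * inner ℝ (score lam θ t) w) := by
  rw [h.infoOp_apply hθ, ← integral_inner (h.integrable_inner_smul_score hθ v)]
  refine integral_congr_ae (ae_of_all _ fun t => ?_)
  simp only [inner_smul_right, real_inner_comm w]

lemma inner_infoOp_comm (hθ : θ ∈ Θ) (v w : EuclideanSpace ℝ (Fin d)) :
    inner ℝ w (infoOp T lam θ v) = inner ℝ (infoOp T lam θ w) v := by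
  rw [real_inner_comm v, h.inner_infoOp hθ, h.inner_infoOp hθ]
  simp only [mul_comm (inner ℝ (score lam θ _) v)]

lemma le_inner_infoOp (hθ : θ ∈ Θ) (v : EuclideanSpace ℝ (Fin d)) :
    c * ‖v‖ ^ 2 ≤ inner ℝ v (infoOp T lam θ v) := by
  by_cases hv : v = 0
  · simp [hv]
  have hn : ‖v‖ ≠ 0 := norm_ne_zero_iff.2 hv
  have h1 := h.le_info θ hθ (‖v‖⁻¹ • v) (by rw [norm_smul, norm_inv, norm_norm, inv_mul_cancel₀ hn])
  rw [map_smul, inner_smul_right, real_inner_smul_left] at h1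
  have h2 : ‖v‖⁻¹ * (‖v‖⁻¹ * inner ℝ v (infoOp T lam θ v)) * ‖v‖ ^ 2 =
      inner ℝ v (infoOp T lam θ v) := by
    field_simp
  rw [← h2]
  exact mul_le_mul_of_nonneg_right h1 (by positivity)

/-- Coercivity and Cauchy–Schwarz; this is what bounds the inverse by c⁻¹. -/
lemma le_norm_infoOp (hθ : θ ∈ Θ) (v : EuclideanSpace ℝ (Fin d)) :
    c * ‖v‖ ≤ ‖infoOp T lam θ v‖ := by
  by_cases hv : v = 0
  · simp [hv]
  have hn : 0 < ‖v‖ := norm_pos_iff.2 hv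
  have h1 := (h.le_inner_infoOp hθ v).trans (real_inner_le_norm _ _)
  refine le_of_mul_le_mul_left ?_ hn
  calc ‖v‖ * (c * ‖v‖) = c * ‖v‖ ^ 2 := by ring
    _ ≤ _ := h1

/-- The lower bound excludes a kernel. The matrix inverse, which has a default value on singular
matrices, is therefore a genuine inverse on Θ. -/
lemma isUnit_det_fisherInfo (hθ : θ ∈ Θ) : IsUnit (fisherInfo T lam θ).det := by
  rw [← Matrix.isUnit_iff_isUnit_det, ← Matrix.mulVec_injective_iff_isUnit]
  intro x y hxy
  have h1 : infoOp T lam θ (WithLp.toLp 2 (x - y)) = 0 := by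
    rw [infoOp, Matrix.toEuclideanLin, Matrix.toLpLin_apply, WithLp.ofLp_toLp, Matrix.mulVec_sub,
      hxy, sub_self]
    rfl
  have h2 := h.le_norm_infoOp hθ (WithLp.toLp 2 (x - y))
  rw [h1, norm_zero] at h2
  have h3 : ‖WithLp.toLp 2 (x - y)‖ ≤ 0 := nonpos_of_mul_nonpos_right h2 h.info_pos
  have h4 := norm_le_zero_iff.1 h3
  have h5 : x - y = 0 := congrArg WithLp.ofLp h4
  exact sub_eq_zero.1 h5

lemma infoOp_infoInv (hθ : θ ∈ Θ) (v : EuclideanSpace ℝ (Fin d)) :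
    infoOp T lam θ (infoInv T lam θ v) = v := by
  have h1 := Matrix.toLpLin_mul_same 2 (fisherInfo T lam θ) (fisherInfo T lam θ)⁻¹
  rw [Matrix.mul_nonsing_inv _ (h.isUnit_det_fisherInfo hθ), Matrix.toLpLin_one] at h1
  exact (LinearMap.congr_fun h1 v).symm

lemma infoInv_infoOp (hθ : θ ∈ Θ) (v : EuclideanSpace ℝ (Fin d)) :
    infoInv T lam θ (infoOp T lam θ v) = v := by
  have h1 := Matrix.toLpLin_mul_same 2 (fisherInfo T lam θ)⁻¹ (fisherInfo T lam θ)
  rw [Matrix.nonsing_inv_mul _ (h.isUnit_det_fisherInfo hθ), Matrix.toLpLin_one] at h1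
  exact (LinearMap.congr_fun h1 v).symm

lemma norm_infoInv_le (hθ : θ ∈ Θ) (v : EuclideanSpace ℝ (Fin d)) :
    ‖infoInv T lam θ v‖ ≤ c⁻¹ * ‖v‖ := by
  have h1 := h.le_norm_infoOp hθ (infoInv T lam θ v)
  rw [h.infoOp_infoInv hθ] at h1
  rw [inv_mul_eq_div, le_div_iff₀ h.info_pos, mul_comm]
  exact h1

lemma inner_infoInv_comm (hθ : θ ∈ Θ) (v w : EuclideanSpace ℝ (Fin d)) :
    inner ℝ (infoInv T lam θ v) w = inner ℝ v (infoInv T lam θ w) := by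
  conv_lhs => rw [← h.infoOp_infoInv hθ w]
  rw [h.inner_infoOp_comm hθ, h.infoOp_infoInv hθ]

lemma posSemidef_fisherInfo_inv (hθ : θ ∈ Θ) : (fisherInfo T lam θ)⁻¹.PosSemidef := by
  refine Matrix.PosSemidef.inv (Matrix.PosSemidef.of_dotProduct_mulVec_nonneg ?_ fun x => ?_)
  · ext i j
    simp [fisherInfo, mul_comm]
  · have h1 := h.le_inner_infoOp hθ (WithLp.toLp 2 x)
    have h2 : (0 : ℝ) ≤ c * ‖WithLp.toLp 2 x‖ ^ 2 := by
      have := h.info_pos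
      positivity
    refine (h2.trans h1).trans (le_of_eq ?_)
    rw [EuclideanSpace.inner_eq_star_dotProduct, infoOp, Matrix.toEuclideanLin,
      Matrix.toLpLin_apply, dotProduct_comm]

/-- The score normalized by the inverse Fisher information has the inverse Fisher information as
covariance. -/
lemma integral_inner_infoInv_score_sq (hθ : θ ∈ Θ) (u : EuclideanSpace ℝ (Fin d)) :
    ∫ t in T, lam θ t * (inner ℝ (infoInv T lam θ (score lam θ t)) u) ^ 2 =
      u.ofLp ⬝ᵥ (fisherInfo T lam θ)⁻¹.mulVec u.ofLp := by
  have h1 : u.ofLp ⬝ᵥ (fisherInfo T lam θ)⁻¹.mulVec u.ofLp = inner ℝ u (infoInv T lam θ u) := by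
    rw [EuclideanSpace.inner_eq_star_dotProduct, infoInv, Matrix.toEuclideanLin,
      Matrix.toLpLin_apply, dotProduct_comm]
    rfl
  rw [h1, ← h.inner_infoInv_comm hθ]
  conv_rhs => rw [← h.infoOp_infoInv hθ u]
  rw [h.infoInv_infoOp hθ, h.inner_infoOp hθ]
  simp only [h.inner_infoInv_comm hθ, sq]

/-- One factor of λ ⟨score, v⟩ score is varied at a time: the intensity costs C³, each score C². -/
lemma norm_infoOp_sub_le (hθ : θ ∈ Θ) (hθ' : θ' ∈ Θ) (v : EuclideanSpace ℝ (Fin d)) :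
    ‖infoOp T lam θ v - infoOp T lam θ' v‖ ≤
      (C ^ 3 + 2 * C ^ 2) * ‖θ - θ'‖ * ‖v‖ * totalIntensity T lam θ' := by
  have hC := h.const_pos
  rw [h.infoOp_apply hθ, h.infoOp_apply hθ', ← integral_sub (h.integrable_inner_smul_score hθ v)
    (h.integrable_inner_smul_score hθ' v)]
  refine h.norm_setIntegral_le hθ' fun t ht => ?_
  have hl := h.family.pos θ' hθ' t ht
  set s := score lam θ t
  set s' := score lam θ' t
  have hs : ‖s‖ ≤ C := h.norm_score θ hθ t ht
  have hd : ‖s - s'‖ ≤ C * ‖θ - θ'‖ := h.score_sub θ hθ θ' hθ' t ht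
  have h1 : lam θ t • (inner ℝ s v : ℝ) • s - lam θ' t • (inner ℝ s' v : ℝ) • s' =
      (lam θ t - lam θ' t) • (inner ℝ s v : ℝ) • s +
        (lam θ' t • (inner ℝ (s - s') v : ℝ) • s + lam θ' t • (inner ℝ s' v : ℝ) • (s - s')) := by
    rw [inner_sub_left]
    module
  rw [h1]
  refine (norm_add_le _ _).trans ((add_le_add_right (norm_add_le _ _) _).trans ?_)
  simp only [norm_smul, Real.norm_eq_abs, abs_of_pos hl]
  have h2 : |inner ℝ (s - s') v| ≤ C * ‖θ - θ'‖ * ‖v‖ :=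
    (abs_real_inner_le_norm _ _).trans (by gcongr)
  calc _ ≤ C * ‖θ - θ'‖ * lam θ' t * (C * ‖v‖ * C) + (lam θ' t * (C * ‖θ - θ'‖ * ‖v‖ * C) +
        lam θ' t * (C * ‖v‖ * (C * ‖θ - θ'‖))) := by
        gcongr
        · exact h.lam_sub θ hθ θ' hθ' t ht
        · exact h.abs_inner_score_le hθ v ht
        · exact h.abs_inner_score_le hθ' v ht
    _ = _ := by ring

lemma norm_infoInv_sub_le (hθ : θ ∈ Θ) (hθ' : θ' ∈ Θ) (v : EuclideanSpace ℝ (Fin d)) :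
    ‖infoInv T lam θ v - infoInv T lam θ' v‖ ≤
      c⁻¹ * ((C ^ 3 + 2 * C ^ 2) * ‖θ - θ'‖ * (c⁻¹ * ‖v‖) * totalIntensity T lam θ') := by
  have hC := h.const_pos
  have hc := h.info_pos
  have hm := h.totalIntensity_nonneg hθ'
  -- The identity A⁻¹ - B⁻¹ = A⁻¹(B - A)B⁻¹.
  have h1 : infoInv T lam θ v - infoInv T lam θ' v = infoInv T lam θ
      (infoOp T lam θ' (infoInv T lam θ' v) - infoOp T lam θ (infoInv T lam θ' v)) := by
    rw [map_sub, h.infoInv_infoOp hθ, h.infoOp_infoInv hθ']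
  rw [h1]
  refine (h.norm_infoInv_le hθ _).trans ?_
  gcongr
  rw [norm_sub_rev]
  refine (h.norm_infoOp_sub_le hθ hθ' _).trans ?_
  gcongr
  exact h.norm_infoInv_le hθ' v

lemma integrable_smul_score (hθ : θ ∈ Θ) (hθ' : θ' ∈ Θ) :
    Integrable (fun t => lam θ t • score lam θ' t) (volume.restrict T) :=
  h.integrable_smul (h.measurable_score θ' hθ') (fun t ht => h.norm_score θ' hθ' t ht) hθ

/-- Supplies continuity of the compensator in θ, used for measurability of the estimator. -/
lemma norm_scoreDrift_sub_le (hθ : θ ∈ Θ) (hθ' : θ' ∈ Θ) :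
    ‖scoreDrift T lam θ - scoreDrift T lam θ'‖ ≤
      (C ^ 2 + C) * ‖θ - θ'‖ * totalIntensity T lam θ' := by
  have hC := h.const_pos
  rw [scoreDrift, scoreDrift, ← integral_sub (h.integrable_smul_score hθ hθ)
    (h.integrable_smul_score hθ' hθ')]
  refine h.norm_setIntegral_le hθ' fun t ht => ?_
  have hl := h.family.pos θ' hθ' t ht
  have h1 : lam θ t • score lam θ t - lam θ' t • score lam θ' t =
      (lam θ t - lam θ' t) • score lam θ t + lam θ' t • (score lam θ t - score lam θ' t) := by
    module
  rw [h1]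
  refine (norm_add_le _ _).trans ?_
  simp only [norm_smul, Real.norm_eq_abs, abs_of_pos hl]
  calc _ ≤ C * ‖θ - θ'‖ * lam θ' t * C + lam θ' t * (C * ‖θ - θ'‖) := by
        gcongr
        · exact h.lam_sub θ hθ θ' hθ' t ht
        · exact h.norm_score θ hθ t ht
        · exact h.score_sub θ hθ θ' hθ' t ht
    _ = _ := by ring

/-- The bias of the score at `θ` under `θ'` is linear in `θ - θ'` up to a quadratic error. -/
lemma norm_scoreDrift_sub_integral_le (hθ : θ ∈ Θ) (hθ' : θ' ∈ Θ) :
    ‖scoreDrift T lam θ - (∫ t in T, lam θ' t • score lam θ t) - infoOp T lam θ (θ - θ')‖ ≤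
      C ^ 2 * ‖θ - θ'‖ ^ 2 * totalIntensity T lam θ := by
  have hC := h.const_pos
  have hi : Integrable (fun t => lam θ t • score lam θ t - lam θ' t • score lam θ t)
      (volume.restrict T) := (h.integrable_smul_score hθ hθ).sub (h.integrable_smul_score hθ' hθ)
  rw [scoreDrift, h.infoOp_apply hθ, ← integral_sub (h.integrable_smul_score hθ hθ)
    (h.integrable_smul_score hθ' hθ), ← integral_sub hi (h.integrable_inner_smul_score hθ _)]
  refine h.norm_setIntegral_le hθ fun t ht => ?_
  -- The intensity is expanded at θ, the point where the score is taken; the linear term is then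
  -- exactly I(θ)(θ - θ').
  have h1 : lam θ t • score lam θ t - lam θ' t • score lam θ t -
      lam θ t • (inner ℝ (score lam θ t) (θ - θ') : ℝ) • score lam θ t =
      -(lam θ' t - lam θ t - lam θ t * inner ℝ (score lam θ t) (θ' - θ)) • score lam θ t := by
    rw [← neg_sub θ θ', inner_neg_right]
    module
  rw [h1, norm_smul, norm_neg, Real.norm_eq_abs]
  have h2 := h.lam_taylor θ' hθ' θ hθ t ht
  rw [norm_sub_rev θ' θ] at h2
  calc _ ≤ C * ‖θ - θ'‖ ^ 2 * lam θ t * C :=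
        mul_le_mul h2 (h.norm_score θ hθ t ht) (norm_nonneg _) ((abs_nonneg _).trans h2)
    _ = _ := by ring

end RegularModel

end RegularModel

/-! ### The intensity measure and expansion of the score integral -/

section IntensityMeasure

variable {d : ℕ} {T : Set ℝ} {Θ : Set (EuclideanSpace ℝ (Fin d))}
  {lam : EuclideanSpace ℝ (Fin d) → ℝ → ℝ} {C c : ℝ}

/-- The measure on `T` with density `r`. -/
noncomputable def intensityMeasure (T : Set ℝ) (r : ℝ → ℝ) : Measure ℝ :=
  (volume.restrict T).withDensity fun t => ENNReal.ofReal (r t)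

/-- The directional derivative of the score along the `b`-th coordinate, extended by zero. -/
noncomputable def scoreDeriv (T : Set ℝ) (lam : EuclideanSpace ℝ (Fin d) → ℝ → ℝ)
    (θ : EuclideanSpace ℝ (Fin d)) (b : Fin d) : ℝ → EuclideanSpace ℝ (Fin d) :=
  T.indicator fun t =>
    fderiv ℝ (fun θ' => score lam θ' t) θ (EuclideanSpace.basisFun (Fin d) ℝ b)

namespace RegularModel

variable (h : RegularModel T Θ lam C c) {θ θ₀ : EuclideanSpace ℝ (Fin d)}
include h

lemma isFiniteMeasure_intensityMeasure (hθ : θ ∈ Θ) :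
    IsFiniteMeasure (intensityMeasure T (lam θ)) :=
  isFiniteMeasure_withDensity_ofReal (h.family.integrableOn θ hθ).2

lemma integral_intensityMeasure {V : Type*} [NormedAddCommGroup V] [NormedSpace ℝ V] (hθ : θ ∈ Θ)
    (g : ℝ → V) : ∫ t, g t ∂intensityMeasure T (lam θ) = ∫ t in T, lam θ t • g t := by
  rw [intensityMeasure, integral_withDensity_eq_integral_toReal_smul₀
    (h.family.integrableOn θ hθ).aestronglyMeasurable.aemeasurable.ennreal_ofReal
    (ae_of_all _ fun _ => ENNReal.ofReal_lt_top)]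
  refine setIntegral_congr_fun h.measurableSet fun t ht => ?_
  simp only [ENNReal.toReal_ofReal (h.family.pos θ hθ t ht).le]

lemma integral_indicator_intensityMeasure {V : Type*} [NormedAddCommGroup V] [NormedSpace ℝ V]
    (hθ : θ ∈ Θ) (g : ℝ → V) :
    ∫ t, T.indicator g t ∂intensityMeasure T (lam θ) = ∫ t in T, lam θ t • g t := by
  rw [h.integral_intensityMeasure hθ]
  refine setIntegral_congr_fun h.measurableSet fun t ht => ?_
  simp only [Set.indicator_of_mem ht]

lemma measureReal_univ_intensityMeasure (hθ : θ ∈ Θ) :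
    (intensityMeasure T (lam θ)).real Set.univ = totalIntensity T lam θ := by
  have h1 := h.integral_intensityMeasure hθ fun _ => (1 : ℝ)
  simpa [totalIntensity] using h1

lemma intensityMeasure_Ioc (hθ : θ ∈ Θ) (a b : ℝ) :
    intensityMeasure T (lam θ) (Set.Ioc a b) =
      ENNReal.ofReal (∫ t in Set.Ioc a b ∩ T, lam θ t) := by
  have hi : IntegrableOn (lam θ) (Set.Ioc a b ∩ T) :=
    (h.family.integrableOn θ hθ).mono_set Set.inter_subset_right
  rw [intensityMeasure, withDensity_apply _ measurableSet_Ioc,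
    Measure.restrict_restrict measurableSet_Ioc, ofReal_integral_eq_lintegral_ofReal hi]
  filter_upwards [ae_restrict_mem (measurableSet_Ioc.inter h.measurableSet)] with t ht
  exact (h.family.pos θ hθ t ht.2).le

lemma isPoissonMeasureSample {Ω : Type*} [MeasurableSpace Ω] {P : Measure Ω}
    {X : ℕ → Ω → StieltjesFunction ℝ} (hθ : θ ∈ Θ) (hX : IsPoissonSample P T (lam θ) X) :
    IsPoissonMeasureSample P (intensityMeasure T (lam θ)) X where
  measurable j := (hX.poisson j).measurable
  law j a b hab := by
    rw [h.intensityMeasure_Ioc hθ]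
    exact (hX.poisson j).increment_law a b hab
  indep_increments j := (hX.poisson j).indep_increments
  indep := hX.indep

lemma measurable_scoreDeriv (hθ : θ ∈ Θ) (b : Fin d) : Measurable (scoreDeriv T lam θ b) :=
  measurable_indicator_fderiv_apply h.isOpen h.measurable_score hθ
    (h.differentiableAt_score θ hθ) _

lemma norm_scoreDeriv_le (hθ : θ ∈ Θ) (b : Fin d) (t : ℝ) : ‖scoreDeriv T lam θ b t‖ ≤ C := by
  by_cases ht : t ∈ T
  · rw [scoreDeriv, Set.indicator_of_mem ht]
    refine (ContinuousLinearMap.le_opNorm _ _).trans ?_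
    rw [OrthonormalBasis.norm_eq_one, mul_one]
    exact h.norm_fderiv_score θ hθ t ht
  · rw [scoreDeriv, Set.indicator_of_notMem ht, norm_zero]
    exact h.const_pos.le

lemma norm_indicator_score_le (hθ : θ ∈ Θ) (t : ℝ) : ‖T.indicator (score lam θ) t‖ ≤ C := by
  by_cases ht : t ∈ T
  · rw [Set.indicator_of_mem ht]
    exact h.norm_score θ hθ t ht
  · rw [Set.indicator_of_notMem ht, norm_zero]
    exact h.const_pos.le

lemma norm_indicator_score_taylor_le (hθ : θ ∈ Θ) (hθ₀ : θ₀ ∈ Θ) (t : ℝ) :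
    ‖T.indicator (score lam θ) t - T.indicator (score lam θ₀) t
      - ∑ b, (θ - θ₀) b • scoreDeriv T lam θ₀ b t‖ ≤ C * ‖θ - θ₀‖ ^ 2 := by
  have hC := h.const_pos
  by_cases ht : t ∈ T
  · simp only [scoreDeriv, Set.indicator_of_mem ht, ← map_smul, ← map_sum]
    have h1 : ∑ b, (θ - θ₀) b • EuclideanSpace.basisFun (Fin d) ℝ b = θ - θ₀ :=
      (EuclideanSpace.basisFun (Fin d) ℝ).sum_repr (θ - θ₀)
    rw [h1]
    exact h.score_taylor θ hθ θ₀ hθ₀ t ht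
  · simp only [scoreDeriv, Set.indicator_of_notMem ht]
    simp only [smul_zero, Finset.sum_const_zero, sub_zero, norm_zero]
    positivity

/-- Expansion of the centered integrated score around `θ₀`. -/
lemma norm_integral_score_sub_le (hθ : θ ∈ Θ) (hθ₀ : θ₀ ∈ Θ) (μ : Measure ℝ) [IsFiniteMeasure μ] :
    ‖((∫ t in T, score lam θ t ∂μ) - scoreDrift T lam θ)
      - ((∫ t, T.indicator (score lam θ₀) t ∂μ
          - ∫ t, T.indicator (score lam θ₀) t ∂intensityMeasure T (lam θ₀))
        + ∑ b, (θ - θ₀) b • (∫ t, scoreDeriv T lam θ₀ b t ∂μ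
          - ∫ t, scoreDeriv T lam θ₀ b t ∂intensityMeasure T (lam θ₀))
        - infoOp T lam θ (θ - θ₀))‖ ≤
      C * ‖θ - θ₀‖ ^ 2 * μ.real Set.univ +
        (C + C ^ 3) * ‖θ - θ₀‖ ^ 2 * totalIntensity T lam θ₀ := by
  have hC := h.const_pos
  set Λ := intensityMeasure T (lam θ₀) with hΛ
  have : IsFiniteMeasure Λ := h.isFiniteMeasure_intensityMeasure hθ₀
  set R : ℝ → EuclideanSpace ℝ (Fin d) := fun t => T.indicator (score lam θ) t
    - T.indicator (score lam θ₀) t - ∑ b, (θ - θ₀) b • scoreDeriv T lam θ₀ b t with hR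
  have hRint : ∀ (ν : Measure ℝ) [IsFiniteMeasure ν], ∫ t, R t ∂ν =
      ∫ t, T.indicator (score lam θ) t ∂ν - ∫ t, T.indicator (score lam θ₀) t ∂ν
        - ∑ b, (θ - θ₀) b • ∫ t, scoreDeriv T lam θ₀ b t ∂ν := fun ν _ => by
    have h1 : ∀ θ' ∈ Θ, Integrable (T.indicator (score lam θ')) ν := fun θ' hθ' =>
      Integrable.of_bound (h.measurable_score θ' hθ').aestronglyMeasurable C
        (ae_of_all _ (h.norm_indicator_score_le hθ'))
    have h2 : ∀ b, Integrable (fun t => (θ - θ₀) b • scoreDeriv T lam θ₀ b t) ν := fun b =>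
      (Integrable.of_bound (h.measurable_scoreDeriv hθ₀ b).aestronglyMeasurable C
        (ae_of_all _ (h.norm_scoreDeriv_le hθ₀ b))).fun_smul ((θ - θ₀) b)
    have h3 : Integrable (fun t => T.indicator (score lam θ) t - T.indicator (score lam θ₀) t) ν :=
      (h1 θ hθ).sub (h1 θ₀ hθ₀)
    rw [hR, integral_sub h3 (integrable_finsetSum _ fun b _ => h2 b),
      integral_sub (h1 θ hθ) (h1 θ₀ hθ₀), integral_finsetSum _ fun b _ => h2 b]
    simp only [integral_smul]
  have hRle : ∀ (ν : Measure ℝ) [IsFiniteMeasure ν],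
      ‖∫ t, R t ∂ν‖ ≤ C * ‖θ - θ₀‖ ^ 2 * ν.real Set.univ := fun ν _ =>
    norm_integral_le_of_norm_le_const
      (ae_of_all _ fun t => h.norm_indicator_score_taylor_le hθ hθ₀ t)
  have hdrift := h.norm_scoreDrift_sub_integral_le hθ hθ₀
  rw [← h.integral_indicator_intensityMeasure hθ₀] at hdrift
  rw [← integral_indicator h.measurableSet]
  -- The score at θ is compensated with λ(θ), the expansion with λ(θ₀). The mismatch is the bias,
  -- linear to first order; R is the Taylor remainder of the score, integrated against both μ and Λ.
  have hkey : (∫ t, T.indicator (score lam θ) t ∂μ - scoreDrift T lam θ)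
      - ((∫ t, T.indicator (score lam θ₀) t ∂μ - ∫ t, T.indicator (score lam θ₀) t ∂Λ)
        + ∑ b, (θ - θ₀) b • (∫ t, scoreDeriv T lam θ₀ b t ∂μ - ∫ t, scoreDeriv T lam θ₀ b t ∂Λ)
        - infoOp T lam θ (θ - θ₀)) =
      ∫ t, R t ∂μ - ∫ t, R t ∂Λ - (scoreDrift T lam θ - ∫ t, T.indicator (score lam θ) t ∂Λ
        - infoOp T lam θ (θ - θ₀)) := by
    rw [hRint μ, hRint Λ]
    simp only [smul_sub, Finset.sum_sub_distrib]
    abel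
  rw [hkey]
  -- Moving the total mass from θ to θ₀ costs one more factor C, whence C³ in the bound.
  have h5 := h.totalIntensity_le hθ hθ₀
  have h6 := hRle Λ
  rw [hΛ, h.measureReal_univ_intensityMeasure hθ₀] at h6
  calc _ ≤ ‖∫ t, R t ∂μ‖ + ‖∫ t, R t ∂Λ‖ + ‖scoreDrift T lam θ
        - ∫ t, T.indicator (score lam θ) t ∂Λ - infoOp T lam θ (θ - θ₀)‖ :=
        (norm_sub_le _ _).trans (add_le_add (norm_sub_le _ _) le_rfl)
    _ ≤ C * ‖θ - θ₀‖ ^ 2 * μ.real Set.univ + C * ‖θ - θ₀‖ ^ 2 * totalIntensity T lam θ₀ +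
        C ^ 2 * ‖θ - θ₀‖ ^ 2 * (C * totalIntensity T lam θ₀) := by
        refine add_le_add (add_le_add (hRle μ) h6) (hdrift.trans ?_)
        gcongr
    _ = _ := by ring

end RegularModel

end IntensityMeasure

/-! ### Expansion and measurability of the one-step estimator -/

section OneStep

variable {d : ℕ} {Ω : Type*} {T : Set ℝ} {Θ : Set (EuclideanSpace ℝ (Fin d))}
  {lam : EuclideanSpace ℝ (Fin d) → ℝ → ℝ} {C c : ℝ} {X : ℕ → Ω → StieltjesFunction ℝ}
  {θbar : ℕ → Ω → EuclideanSpace ℝ (Fin d)} {θ₀ : EuclideanSpace ℝ (Fin d)}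

/-- Deterministic expansion of the one-step estimator. -/
lemma RegularModel.exists_norm_oneStepMLE_sub_le (h : RegularModel T Θ lam C c) (hθ₀ : θ₀ ∈ Θ) :
    ∃ L : ℝ, 0 < L ∧ ∀ (ω : Ω), (∀ j, IsFiniteMeasure (X j ω).measure) → ∀ N k : ℕ, N ≤ k → 0 < k →
      θbar N ω ∈ Θ →
      ‖oneStepMLE T Θ lam X θbar N k ω - θ₀ - infoInv T lam θ₀ ((k : ℝ)⁻¹ •
          centeredSum (intensityMeasure T (lam θ₀)) X (T.indicator (score lam θ₀)) N k ω)‖ ≤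
        (N : ℝ) / k * ‖θbar N ω - θ₀‖ + L * (
          ‖θbar N ω - θ₀‖ ^ 2 *
            (1 + (k : ℝ)⁻¹ * ∑ j ∈ Finset.Ico N k, (X j ω).measure.real Set.univ)
          + ‖θbar N ω - θ₀‖ * ∑ b, ‖(k : ℝ)⁻¹ •
            centeredSum (intensityMeasure T (lam θ₀)) X (scoreDeriv T lam θ₀ b) N k ω‖
          + ‖θbar N ω - θ₀‖ * ‖(k : ℝ)⁻¹ • centeredSum (intensityMeasure T (lam θ₀)) X
            (T.indicator (score lam θ₀)) N k ω‖) := by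
  have hC := h.const_pos
  have hc := h.info_pos
  set m := totalIntensity T lam θ₀ with hm
  have hm0 : 0 ≤ m := h.totalIntensity_nonneg hθ₀
  -- L₁ pays for the summed expansion error, c⁻¹ for the derivative sums, and L₂ for replacing
  -- I(θ)⁻¹ by I(θ₀)⁻¹ in the leading term.
  set L₁ := c⁻¹ * (C + (C + C ^ 3) * m) with hL₁
  set L₂ := c⁻¹ * ((C ^ 3 + 2 * C ^ 2) * c⁻¹ * m) with hL₂
  have hL₁0 : 0 ≤ L₁ := by positivity
  have hL₂0 : 0 ≤ L₂ := by positivity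
  have hc1 : 0 < c⁻¹ := inv_pos.2 hc
  refine ⟨L₁ + c⁻¹ + L₂, by positivity, fun ω hfin N k hNk hk hmem => ?_⟩
  set θ := θbar N ω with hθ_def
  set ρ := ‖θ - θ₀‖ with hρ
  have hρ0 : 0 ≤ ρ := norm_nonneg _
  set Λ := intensityMeasure T (lam θ₀) with hΛ
  set S := centeredSum Λ X (T.indicator (score lam θ₀)) N k ω with hS
  set H : Fin d → EuclideanSpace ℝ (Fin d) := fun b =>
    centeredSum Λ X (scoreDeriv T lam θ₀ b) N k ω with hH
  set A := ∑ j ∈ Finset.Ico N k, (X j ω).measure.real Set.univ with hA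
  have hk0 : (0 : ℝ) < k := by exact_mod_cast hk
  have hki : (0 : ℝ) < (k : ℝ)⁻¹ := inv_pos.2 hk0
  have hA0 : 0 ≤ A := Finset.sum_nonneg fun _ _ => measureReal_nonneg
  have hNk' : (N : ℝ) ≤ k := by exact_mod_cast hNk
  set U := ∑ j ∈ Finset.Ico N k, ((∫ t in T, score lam θ t ∂(X j ω).measure)
      - scoreDrift T lam θ) with hU
  have hcard : (((Finset.Ico N k).card : ℕ) : ℝ) = (k : ℝ) - N := by
    rw [Nat.card_Ico, Nat.cast_sub hNk]
  set err := U - (S + ∑ b, (θ - θ₀) b • H b - ((k : ℝ) - N) • infoOp T lam θ (θ - θ₀)) with herr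
  have herr_le : ‖err‖ ≤ C * ρ ^ 2 * A + (k : ℝ) * ((C + C ^ 3) * ρ ^ 2 * m) := by
    have h1 : err = ∑ j ∈ Finset.Ico N k,
        (((∫ t in T, score lam θ t ∂(X j ω).measure) - scoreDrift T lam θ)
        - ((∫ t, T.indicator (score lam θ₀) t ∂(X j ω).measure
            - ∫ t, T.indicator (score lam θ₀) t ∂Λ)
          + ∑ b, (θ - θ₀) b • (∫ t, scoreDeriv T lam θ₀ b t ∂(X j ω).measure
            - ∫ t, scoreDeriv T lam θ₀ b t ∂Λ)
          - infoOp T lam θ (θ - θ₀))) := by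
      have h2 : ∑ b, (θ - θ₀) b • H b = ∑ j ∈ Finset.Ico N k, ∑ b, (θ - θ₀) b •
          (∫ t, scoreDeriv T lam θ₀ b t ∂(X j ω).measure - ∫ t, scoreDeriv T lam θ₀ b t ∂Λ) := by
        rw [Finset.sum_comm]
        exact Finset.sum_congr rfl fun b _ => Finset.smul_sum
      rw [herr, h2, hU, hS, centeredSum, ← hcard, Nat.cast_smul_eq_nsmul ℝ, ← Finset.sum_const,
        ← Finset.sum_add_distrib, ← Finset.sum_sub_distrib, ← Finset.sum_sub_distrib]
    rw [h1]
    refine (norm_sum_le_of_le (n := fun j => C * ρ ^ 2 * (X j ω).measure.real Set.univ +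
      (C + C ^ 3) * ρ ^ 2 * m) _ fun j _ => ?_).trans ?_
    · have := hfin j
      exact h.norm_integral_score_sub_le hmem hθ₀ (X j ω).measure
    · rw [Finset.sum_add_distrib, ← Finset.mul_sum, Finset.sum_const, nsmul_eq_mul, hcard]
      gcongr
      linarith [Nat.cast_nonneg (α := ℝ) N]
  have hstep : oneStepMLE T Θ lam X θbar N k ω = θ + infoInv T lam θ ((k : ℝ)⁻¹ • U) := by
    rw [oneStepMLE, if_pos hmem]
    rfl
  have hUeq : U = S + ∑ b, (θ - θ₀) b • H b - ((k : ℝ) - N) • infoOp T lam θ (θ - θ₀) + err := by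
    rw [herr]; abel
  -- The Newton cancellation: I(θ)⁻¹ applied to -(1 - N/k) I(θ)(θ - θ₀) removes all of θ - θ₀ except
  -- its multiple N/k.
  have hdecomp : oneStepMLE T Θ lam X θbar N k ω - θ₀ - infoInv T lam θ₀ ((k : ℝ)⁻¹ • S) =
      ((N : ℝ) / k) • (θ - θ₀)
      + infoInv T lam θ ((k : ℝ)⁻¹ • err)
      + infoInv T lam θ (∑ b, (θ - θ₀) b • (k : ℝ)⁻¹ • H b)
      + (infoInv T lam θ ((k : ℝ)⁻¹ • S) - infoInv T lam θ₀ ((k : ℝ)⁻¹ • S)) := by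
    have h2 : (k : ℝ)⁻¹ • U = (k : ℝ)⁻¹ • S + ∑ b, (θ - θ₀) b • (k : ℝ)⁻¹ • H b
        - (1 - (N : ℝ) / k) • infoOp T lam θ (θ - θ₀) + (k : ℝ)⁻¹ • err := by
      have h3 : (1 - (N : ℝ) / k) = (k : ℝ)⁻¹ * ((k : ℝ) - N) := by field_simp
      rw [hUeq, h3, mul_smul, smul_add, smul_sub, smul_add, Finset.smul_sum]
      congr 3
      exact Finset.sum_congr rfl fun b _ => smul_comm _ _ _
    rw [hstep, h2, map_add, map_sub, map_add, map_smul (infoInv T lam θ) (1 - (N : ℝ) / k),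
      h.infoInv_infoOp hmem, sub_smul, one_smul]
    abel
  rw [hdecomp]
  have hb1 : ‖infoInv T lam θ ((k : ℝ)⁻¹ • err)‖ ≤ L₁ * (ρ ^ 2 * (1 + (k : ℝ)⁻¹ * A)) := by
    refine (h.norm_infoInv_le hmem _).trans ?_
    rw [norm_smul, Real.norm_of_nonneg hki.le, hL₁, mul_assoc c⁻¹]
    refine mul_le_mul_of_nonneg_left ?_ hc1.le
    have e1 : (k : ℝ)⁻¹ * ‖err‖ ≤
        (k : ℝ)⁻¹ * (C * ρ ^ 2 * A + (k : ℝ) * ((C + C ^ 3) * ρ ^ 2 * m)) :=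
      mul_le_mul_of_nonneg_left herr_le hki.le
    have e2 : (k : ℝ)⁻¹ * (C * ρ ^ 2 * A + (k : ℝ) * ((C + C ^ 3) * ρ ^ 2 * m)) =
        C * ρ ^ 2 * ((k : ℝ)⁻¹ * A) + (C + C ^ 3) * ρ ^ 2 * m := by
      field_simp
    have e3 : 0 ≤ C * ρ ^ 2 + (C + C ^ 3) * m * (ρ ^ 2 * ((k : ℝ)⁻¹ * A)) := by positivity
    linarith
  have hb2 : ‖infoInv T lam θ (∑ b, (θ - θ₀) b • (k : ℝ)⁻¹ • H b)‖ ≤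
      c⁻¹ * (ρ * ∑ b, ‖(k : ℝ)⁻¹ • H b‖) := by
    refine (h.norm_infoInv_le hmem _).trans ?_
    gcongr
    rw [Finset.mul_sum]
    refine norm_sum_le_of_le _ fun b _ => ?_
    rw [norm_smul]
    gcongr
    exact PiLp.norm_apply_le (θ - θ₀) b
  have hb3 : ‖infoInv T lam θ ((k : ℝ)⁻¹ • S) - infoInv T lam θ₀ ((k : ℝ)⁻¹ • S)‖ ≤
      L₂ * (ρ * ‖(k : ℝ)⁻¹ • S‖) := by
    refine (h.norm_infoInv_sub_le hmem hθ₀ _).trans (le_of_eq ?_)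
    rw [hL₂]; ring
  have hb0 : ‖((N : ℝ) / k) • (θ - θ₀)‖ = (N : ℝ) / k * ρ := by
    rw [norm_smul, Real.norm_of_nonneg (by positivity)]
  have ha₁0 : 0 ≤ ρ ^ 2 * (1 + (k : ℝ)⁻¹ * A) := by positivity
  have ha₂0 : 0 ≤ ρ * ∑ b, ‖(k : ℝ)⁻¹ • H b‖ :=
    mul_nonneg hρ0 (Finset.sum_nonneg fun _ _ => norm_nonneg _)
  have ha₃0 : 0 ≤ ρ * ‖(k : ℝ)⁻¹ • S‖ := by positivity
  clear_value L₁ L₂ err S A ρ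
  generalize ρ ^ 2 * (1 + (k : ℝ)⁻¹ * A) = a₁ at hb1 ha₁0 ⊢
  generalize ρ * ‖(k : ℝ)⁻¹ • S‖ = a₃ at hb3 ha₃0 ⊢
  change _ ≤ (N : ℝ) / k * ρ + (L₁ + c⁻¹ + L₂) * (a₁ + ρ * ∑ b, ‖(k : ℝ)⁻¹ • H b‖ + a₃)
  generalize ρ * ∑ b, ‖(k : ℝ)⁻¹ • H b‖ = a₂ at hb2 ha₂0 ⊢
  have e1 : 0 ≤ L₁ * (a₂ + a₃) := by positivity
  have e2 : 0 ≤ c⁻¹ * (a₁ + a₃) := by positivity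
  have e3 : 0 ≤ L₂ * (a₁ + a₂) := by positivity
  refine norm_add₄_le.trans ?_
  rw [hb0]
  linarith

/-- The one-step estimator is a measurable function of the observations it uses. -/
lemma RegularModel.measurable_oneStepMLE [MeasurableSpace Ω] (h : RegularModel T Θ lam C c)
    (hθ₀ : θ₀ ∈ Θ) {N k : ℕ} (hX : ∀ j < k, ∀ t : ℝ, Measurable fun ω => X j ω t)
    (hθbar : Measurable (θbar N)) : Measurable (oneStepMLE T Θ lam X θbar N k) := by
  have hΘm : MeasurableSet Θ := h.isOpen.measurableSet
  have hC := h.const_pos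
  -- Nothing is known outside Θ, so θ̄ is first sent into Θ by a measurable map fixing Θ.
  obtain ⟨r, hrm, hr⟩ : ∃ r : EuclideanSpace ℝ (Fin d) → Θ, Measurable r ∧
      ∀ θ ∈ Θ, (r θ : EuclideanSpace ℝ (Fin d)) = θ := by
    classical
    have hmem : ∀ θ, (if θ ∈ Θ then θ else θ₀) ∈ Θ := fun θ => by split_ifs <;> assumption
    exact ⟨fun θ => ⟨if θ ∈ Θ then θ else θ₀, hmem θ⟩,
      (Measurable.ite hΘm measurable_id measurable_const).subtype_mk (h := hmem),
      fun θ hθ => if_pos hθ⟩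
  -- Lipschitz in θ and measurable in t, the score is jointly measurable, which allows inserting the
  -- random θ̄ under the path integral.
  have hscore : Measurable (Function.uncurry fun (θ : Θ) t => T.indicator (score lam θ) t) := by
    refine measurable_uncurry_of_continuous_of_measurable (u := fun (θ : Θ) t =>
      T.indicator (score lam θ) t) (fun t => ?_) fun θ => h.measurable_score θ θ.2
    by_cases ht : t ∈ T
    · simp only [Set.indicator_of_mem ht]
      refine LipschitzWith.continuous (K := ⟨C, hC.le⟩)
        (LipschitzWith.of_dist_le_mul fun θ θ' => ?_)
      rw [dist_eq_norm, Subtype.dist_eq, dist_eq_norm]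
      exact h.score_sub θ θ.2 θ' θ'.2 t ht
    · simp only [Set.indicator_of_notMem ht]
      exact continuous_const
  have hdrift : Continuous fun θ : Θ => scoreDrift T lam θ := by
    refine continuous_iff_continuousAt.2 fun θ' => tendsto_iff_norm_sub_tendsto_zero.2 ?_
    refine squeeze_zero (fun _ => norm_nonneg _)
      (fun θ => h.norm_scoreDrift_sub_le θ.2 θ'.2) ?_
    have : Continuous fun θ : Θ => (C ^ 2 + C) * ‖(θ : EuclideanSpace ℝ (Fin d)) - θ'‖ *
        totalIntensity T lam θ' := by fun_prop
    exact (this.tendsto θ').trans (by simp)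
  have hinv : ∀ v, Continuous fun θ : Θ => infoInv T lam θ v := fun v => by
    refine continuous_iff_continuousAt.2 fun θ' => tendsto_iff_norm_sub_tendsto_zero.2 ?_
    refine squeeze_zero (fun _ => norm_nonneg _)
      (fun θ => h.norm_infoInv_sub_le θ.2 θ'.2 v) ?_
    have : Continuous fun θ : Θ => c⁻¹ * ((C ^ 3 + 2 * C ^ 2) *
        ‖(θ : EuclideanSpace ℝ (Fin d)) - θ'‖ * (c⁻¹ * ‖v‖) * totalIntensity T lam θ') := by
      fun_prop
    exact (this.tendsto θ').trans (by simp)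
  have hinv' : Measurable (Function.uncurry fun (v : EuclideanSpace ℝ (Fin d)) (θ : Θ) =>
      infoInv T lam θ v) :=
    measurable_uncurry_of_continuous_of_measurable (u := fun v (θ : Θ) => infoInv T lam θ v)
      (fun θ => (infoInv T lam θ).continuous_of_finiteDimensional) fun v => (hinv v).measurable
  set q : Ω → Θ := fun ω => r (θbar N ω) with hq
  have hqm : Measurable q := hrm.comp hθbar
  have hsum : Measurable fun ω => (k : ℝ)⁻¹ • ∑ j ∈ Finset.Ico N k,
      ((∫ t, T.indicator (score lam (q ω)) t ∂(X j ω).measure) - scoreDrift T lam (q ω)) := by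
    refine Measurable.const_smul (M := ℝ) (X := EuclideanSpace ℝ (Fin d)) ?_ _
    refine Finset.measurable_fun_sum _ fun j hj => ?_
    have hd : Measurable fun ω => scoreDrift T lam (q ω) := hdrift.measurable.comp hqm
    refine Measurable.sub ?_ hd
    exact measurable_integral_stieltjes (X j) (hX j (Finset.mem_Ico.1 hj).2)
      (g := fun ω t => T.indicator (score lam (q ω)) t)
      (hscore.comp ((hqm.comp measurable_fst).prodMk measurable_snd))
  have heq : oneStepMLE T Θ lam X θbar N k = fun ω => (θbar N ⁻¹' Θ).indicator (fun ω =>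
      infoInv T lam (q ω) ((k : ℝ)⁻¹ • ∑ j ∈ Finset.Ico N k,
        ((∫ t, T.indicator (score lam (q ω)) t ∂(X j ω).measure) - scoreDrift T lam (q ω)))) ω
      + θbar N ω := by
    ext1 ω
    by_cases hω : θbar N ω ∈ Θ
    · rw [oneStepMLE, if_pos hω, Set.indicator_of_mem (by exact hω), hq]
      simp only [hr _ hω, integral_indicator h.measurableSet]
      exact add_comm _ _
    · rw [oneStepMLE, if_neg hω, Set.indicator_of_notMem (by exact hω), zero_add]
  rw [heq]
  refine Measurable.add (M := EuclideanSpace ℝ (Fin d)) ?_ hθbar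
  exact (hinv'.comp (hsum.prodMk hqm)).indicator (hθbar hΘm)

end OneStep

/-! ### Calculus of smallness and boundedness in probability -/

section StochasticOrder

variable {Ω : Type*} [MeasurableSpace Ω] {P : Measure Ω} {Z W : ℕ → Ω → ℝ}

/-- `Z n` is bounded above in probability as `n → ∞`. -/
def BoundedInProb (P : Measure Ω) (Z : ℕ → Ω → ℝ) : Prop :=
  ∀ ε : ENNReal, 0 < ε → ∃ M : ℝ, ∀ᶠ n in atTop, P {ω | M < Z n ω} ≤ ε

/-- The positive part of `Z n` tends to zero in probability. -/
def SmallInProb (P : Measure Ω) (Z : ℕ → Ω → ℝ) : Prop :=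
  ∀ ε : ℝ, 0 < ε → Tendsto (fun n => P {ω | ε ≤ Z n ω}) atTop (𝓝 0)

lemma BoundedInProb.const (P : Measure Ω) (a : ℝ) : BoundedInProb P fun _ _ => a :=
  fun ε _ => ⟨a, Eventually.of_forall fun _ => by simp⟩

lemma BoundedInProb.exists_nonneg (hZ : BoundedInProb P Z) {ε : ENNReal} (hε : 0 < ε) :
    ∃ M : ℝ, 0 < M ∧ ∀ᶠ n in atTop, P {ω | M < Z n ω} ≤ ε := by
  obtain ⟨M, hM⟩ := hZ ε hε
  refine ⟨max M 1, lt_max_of_lt_right one_pos, hM.mono fun n hn => (measure_mono ?_).trans hn⟩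
  exact fun ω hω => (le_max_left M 1).trans_lt hω

lemma BoundedInProb.add (hZ : BoundedInProb P Z) (hW : BoundedInProb P W) :
    BoundedInProb P fun n ω => Z n ω + W n ω := fun ε hε => by
  have hε2 : 0 < ε / 2 := ENNReal.half_pos hε.ne'
  obtain ⟨M₁, h₁⟩ := hZ _ hε2
  obtain ⟨M₂, h₂⟩ := hW _ hε2
  refine ⟨M₁ + M₂, ?_⟩
  filter_upwards [h₁, h₂] with n hn₁ hn₂
  rw [← ENNReal.add_halves ε]
  refine (measure_mono ?_).trans ((measure_union_le _ _).trans (add_le_add hn₁ hn₂))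
  intro ω (hω : M₁ + M₂ < _)
  by_contra! h
  simp only [Set.mem_union, Set.mem_ofPred_eq, not_or, not_lt] at h
  linarith

lemma BoundedInProb.sum {ι : Type*} (s : Finset ι) {Z : ι → ℕ → Ω → ℝ}
    (hZ : ∀ i, BoundedInProb P (Z i)) : BoundedInProb P fun n ω => ∑ i ∈ s, Z i n ω := by
  classical
  induction s using Finset.induction_on with
  | empty => simpa using BoundedInProb.const P 0
  | insert i s hi ih => simpa only [Finset.sum_insert hi] using (hZ i).add ih

lemma BoundedInProb.mul (hZ : BoundedInProb P Z) (hW : BoundedInProb P W)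
    (hW0 : ∀ n ω, 0 ≤ W n ω) : BoundedInProb P fun n ω => Z n ω * W n ω := fun ε hε => by
  have hε2 : 0 < ε / 2 := ENNReal.half_pos hε.ne'
  obtain ⟨M₁, h₁0, h₁⟩ := hZ.exists_nonneg hε2
  obtain ⟨M₂, h₂0, h₂⟩ := hW.exists_nonneg hε2
  refine ⟨M₁ * M₂, ?_⟩
  filter_upwards [h₁, h₂] with n hn₁ hn₂
  rw [← ENNReal.add_halves ε]
  refine (measure_mono ?_).trans ((measure_union_le _ _).trans (add_le_add hn₁ hn₂))
  intro ω (hω : M₁ * M₂ < _)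
  by_contra! h
  simp only [Set.mem_union, Set.mem_ofPred_eq, not_or, not_lt] at h
  exact absurd (mul_le_mul h.1 h.2 (hW0 n ω) h₁0.le) (not_le.2 hω)

lemma SmallInProb.of_tendsto {a : ℕ → ℝ} (ha : Tendsto a atTop (𝓝 0)) :
    SmallInProb P fun n _ => a n := fun ε hε => by
  refine tendsto_const_nhds.congr' ?_
  filter_upwards [ha.eventually_lt_const hε] with n hn
  rw [show {ω : Ω | ε ≤ a n} = ∅ from Set.eq_empty_of_forall_notMem fun ω hω => hn.not_ge hω,
    measure_empty]

/-- Domination is needed only off events of vanishing probability; this discards the event that θ̄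
is far from θ₀ and possibly outside Θ. -/
lemma SmallInProb.mono (hZ : SmallInProb P Z) {B : ℕ → Set Ω}
    (hB : Tendsto (fun n => P (B n)) atTop (𝓝 0))
    (hle : ∀ᶠ n in atTop, ∀ᵐ ω ∂P, ω ∉ B n → W n ω ≤ Z n ω) : SmallInProb P W := fun ε hε => by
  have hsum := (hZ ε hε).add hB
  rw [add_zero] at hsum
  refine tendsto_of_tendsto_of_tendsto_of_le_of_le' tendsto_const_nhds hsum
    (Eventually.of_forall fun _ => zero_le) ?_
  filter_upwards [hle] with n hn
  refine le_trans ?_ (measure_union_le _ _)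
  refine measure_mono_ae ?_
  filter_upwards [hn] with ω hω h
  by_cases hωB : ω ∈ B n
  · exact Or.inr hωB
  · exact Or.inl (le_trans h (hω hωB))

lemma SmallInProb.add (hZ : SmallInProb P Z) (hW : SmallInProb P W) :
    SmallInProb P fun n ω => Z n ω + W n ω := fun ε hε => by
  have hsum := (hZ (ε / 2) (by positivity)).add (hW (ε / 2) (by positivity))
  rw [add_zero] at hsum
  refine tendsto_of_tendsto_of_tendsto_of_le_of_le tendsto_const_nhds hsum
    (fun _ => zero_le) fun n => (measure_mono ?_).trans (measure_union_le _ _)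
  intro ω (hω : ε ≤ _)
  by_contra! h
  simp only [Set.mem_union, Set.mem_ofPred_eq, not_or, not_le] at h
  linarith

lemma SmallInProb.mul_boundedInProb (hZ : SmallInProb P Z) (hW : BoundedInProb P W)
    (hW0 : ∀ n ω, 0 ≤ W n ω) : SmallInProb P fun n ω => Z n ω * W n ω := fun ε hε => by
  rw [ENNReal.tendsto_atTop_zero]
  intro η hη
  have hη2 : 0 < η / 2 := ENNReal.half_pos hη.ne'
  obtain ⟨M, hM0, hM⟩ := hW.exists_nonneg hη2
  have hZM := (ENNReal.tendsto_nhds_zero.1 (hZ (ε / M) (by positivity))) _ hη2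
  refine eventually_atTop.1 ?_
  filter_upwards [hM, hZM] with n hn₁ hn₂
  rw [← ENNReal.add_halves η]
  refine (measure_mono ?_).trans ((measure_union_le _ _).trans (add_le_add hn₂ hn₁))
  intro ω (hω : ε ≤ _)
  by_contra! h
  simp only [Set.mem_union, Set.mem_ofPred_eq, not_or, not_le, not_lt] at h
  rcases (hW0 n ω).eq_or_lt with h0 | h0
  · rw [← h0, mul_zero] at hω
    linarith
  · have h1 : Z n ω * W n ω < ε / M * W n ω := mul_lt_mul_of_pos_right h.1 h0
    have h2 : ε / M * W n ω ≤ ε / M * M := mul_le_mul_of_nonneg_left h.2 (by positivity)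
    rw [div_mul_cancel₀ _ hM0.ne'] at h2
    linarith

lemma SmallInProb.comp (hZ : SmallInProb P Z) {N : ℕ → ℕ} (hN : Tendsto N atTop atTop) :
    SmallInProb P fun n => Z (N n) := fun ε hε => (hZ ε hε).comp hN

lemma BoundedInProb.comp (hZ : BoundedInProb P Z) {N : ℕ → ℕ} (hN : Tendsto N atTop atTop) :
    BoundedInProb P fun n => Z (N n) := fun ε hε =>
  (hZ ε hε).imp fun _ hM => hN.eventually hM

/-- Almost sure convergence to zero gives smallness in probability, uniformly over the tail. -/
lemma tendsto_measure_exists_norm_ge {E : Type*} [NormedAddCommGroup E] [IsFiniteMeasure P]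
    [MeasurableSpace E] [OpensMeasurableSpace E] {g : ℕ → Ω → E} (hg : ∀ k, Measurable (g k))
    (h : ∀ᵐ ω ∂P, Tendsto (fun k => g k ω) atTop (𝓝 0)) {ε : ℝ} (hε : 0 < ε) :
    Tendsto (fun N => P {ω | ∃ k, N ≤ k ∧ ε ≤ ‖g k ω‖}) atTop (𝓝 0) := by
  have hm : ∀ N, MeasurableSet {ω | ∃ k, N ≤ k ∧ ε ≤ ‖g k ω‖} := fun N => by
    have : {ω | ∃ k, N ≤ k ∧ ε ≤ ‖g k ω‖} = ⋃ k, ⋃ (_ : N ≤ k), {ω | ε ≤ ‖g k ω‖} := by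
      ext ω
      simp
    rw [this]
    exact MeasurableSet.iUnion fun k => MeasurableSet.iUnion fun _ =>
      measurableSet_le measurable_const (hg k).norm
  -- The tail events decrease to a subset of the null set where convergence fails; continuity from
  -- above concludes.
  have h1 := tendsto_measure_iInter_atTop (μ := P) (fun N => (hm N).nullMeasurableSet)
    (fun N N' hNN' ω ⟨k, hk, hk'⟩ => ⟨k, hNN'.trans hk, hk'⟩) ⟨0, measure_ne_top P _⟩
  have h2 : P (⋂ N, {ω | ∃ k, N ≤ k ∧ ε ≤ ‖g k ω‖}) = 0 := by
    refine measure_mono_null ?_ (ae_iff.1 h)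
    intro ω hω hlim
    obtain ⟨N, hN⟩ := eventually_atTop.1 (hlim.norm.eventually_lt_const (by simpa using hε))
    obtain ⟨k, hk, hk'⟩ := Set.mem_iInter.1 hω N
    exact absurd (hN k hk) (not_lt.2 hk')
  rw [h2] at h1
  exact h1

end StochasticOrder

/-! ### Growth of the learning sample -/

section LearnSize

variable {δ s : ℝ}

lemma tendsto_learnSize (hδ : 0 < δ) : Tendsto (learnSize δ) atTop atTop :=
  tendsto_nat_floor_atTop.comp ((tendsto_rpow_atTop hδ).comp tendsto_natCast_atTop_atTop)

lemma tendsto_natFloor_mul (hs : 0 < s) : Tendsto (fun n : ℕ => ⌊s * n⌋₊) atTop atTop :=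
  tendsto_nat_floor_atTop.comp (tendsto_natCast_atTop_atTop.const_mul_atTop hs)

lemma eventually_half_mul_le_natFloor (hs : 0 < s) :
    ∀ᶠ n : ℕ in atTop, s / 2 * n ≤ (⌊s * n⌋₊ : ℝ) := by
  have h1 : Tendsto (fun n : ℕ => s * (n : ℝ)) atTop atTop :=
    tendsto_natCast_atTop_atTop.const_mul_atTop hs
  filter_upwards [h1.eventually_ge_atTop 2] with n hn
  have := Nat.lt_floor_add_one (s * (n : ℝ))
  linarith

lemma eventually_half_rpow_le_learnSize (hδ : 0 < δ) :
    ∀ᶠ n : ℕ in atTop, (n : ℝ) ^ δ / 2 ≤ learnSize δ n := by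
  have h1 := (tendsto_rpow_atTop hδ).comp (tendsto_natCast_atTop_atTop (R := ℝ))
  filter_upwards [h1.eventually_ge_atTop 2] with n hn
  have := Nat.lt_floor_add_one ((n : ℝ) ^ δ)
  simp only [Function.comp_apply] at hn
  rw [learnSize]
  linarith

/-- The ratio is at most (2/s) n^(δ - 1): δ < 1 makes the learning sample negligible. -/
lemma tendsto_learnSize_div (hδ : δ < 1) (hs : 0 < s) :
    Tendsto (fun n : ℕ => (learnSize δ n : ℝ) / (⌊s * n⌋₊ : ℝ)) atTop (𝓝 0) := by
  have h1 := ((tendsto_rpow_neg_atTop (sub_pos.2 hδ)).comp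
    (tendsto_natCast_atTop_atTop (R := ℝ))).const_mul (2 / s)
  rw [mul_zero] at h1
  refine squeeze_zero' (Eventually.of_forall fun _ => by positivity) ?_ h1
  filter_upwards [eventually_half_mul_le_natFloor hs, eventually_gt_atTop 0] with n hn hn0
  have hn0' : (0 : ℝ) < n := by exact_mod_cast hn0
  have h2 : (learnSize δ n : ℝ) ≤ (n : ℝ) ^ δ := Nat.floor_le (by positivity)
  calc (learnSize δ n : ℝ) / (⌊s * n⌋₊ : ℝ) ≤ (n : ℝ) ^ δ / (s / 2 * n) := by gcongr
    _ = _ := by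
      rw [Function.comp_apply, neg_sub, Real.rpow_sub_one hn0'.ne']
      field_simp

/-- The ratio is at most 2 n^(1/2 - δ): δ > 1/2 makes a squared preliminary error of order 1/N
negligible against k^(-1/2). -/
lemma tendsto_sqrt_div_learnSize (hδ : 1 / 2 < δ) (hs : s ≤ 1) :
    Tendsto (fun n : ℕ => √(⌊s * n⌋₊ : ℝ) / (learnSize δ n : ℝ)) atTop (𝓝 0) := by
  have h1 := ((tendsto_rpow_neg_atTop (sub_pos.2 hδ)).comp
    (tendsto_natCast_atTop_atTop (R := ℝ))).const_mul 2
  rw [mul_zero] at h1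
  refine squeeze_zero' (Eventually.of_forall fun _ => by positivity) ?_ h1
  have hδ0 : 0 < δ := by linarith
  filter_upwards [eventually_half_rpow_le_learnSize hδ0, eventually_gt_atTop 0]
    with n hn hn0
  have hn0' : (0 : ℝ) < n := by exact_mod_cast hn0
  have h2 : (⌊s * n⌋₊ : ℝ) ≤ n := by
    exact_mod_cast Nat.floor_le_of_le (by nlinarith : s * (n : ℝ) ≤ (n : ℕ))
  have h3 : (0 : ℝ) < (n : ℝ) ^ δ := Real.rpow_pos_of_pos hn0' _
  calc √(⌊s * n⌋₊ : ℝ) / (learnSize δ n : ℝ) ≤ √(n : ℝ) / ((n : ℝ) ^ δ / 2) := by gcongr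
    _ = _ := by
      rw [Function.comp_apply, neg_sub, Real.rpow_sub hn0', Real.sqrt_eq_rpow]
      field_simp

end LearnSize

/-! ### Uniform law of large numbers and tightness -/

section CenteredSum

lemma centeredSum_eq_sub {Ω E : Type*} [NormedAddCommGroup E] [NormedSpace ℝ E] {Λ : Measure ℝ}
    {X : ℕ → Ω → StieltjesFunction ℝ} {f : ℝ → E} {N k : ℕ} (hNk : N ≤ k) (ω : Ω) :
    centeredSum Λ X f N k ω = centeredSum Λ X f 0 k ω - centeredSum Λ X f 0 N ω := by
  rw [eq_sub_iff_add_eq, add_comm]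
  exact Finset.sum_Ico_consecutive _ (Nat.zero_le N) hNk

/-- The number of events is the integral of 1, so the limit theorems for centered sums also control
it. -/
lemma sum_measureReal_univ_eq {Ω : Type*} {Λ : Measure ℝ} {X : ℕ → Ω → StieltjesFunction ℝ}
    {N k : ℕ} (hNk : N ≤ k) (ω : Ω) :
    ∑ j ∈ Finset.Ico N k, (X j ω).measure.real Set.univ =
      centeredSum Λ X (fun _ => (1 : ℝ)) N k ω + ((k : ℝ) - N) * Λ.real Set.univ := by
  simp only [centeredSum, integral_const, smul_eq_mul, mul_one, Finset.sum_sub_distrib,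
    Finset.sum_const, Nat.card_Ico, nsmul_eq_mul, Nat.cast_sub hNk]
  ring

variable {Ω : Type*} [MeasurableSpace Ω] {P : Measure Ω} {Λ : Measure ℝ}
  {X : ℕ → Ω → StieltjesFunction ℝ}
  {E : Type*} [NormedAddCommGroup E] [InnerProductSpace ℝ E] [FiniteDimensional ℝ E]
  [MeasurableSpace E] [BorelSpace E] {f : ℝ → E}

namespace IsPoissonMeasureSample

lemma ae_isFiniteMeasure [IsFiniteMeasure Λ] (h : IsPoissonMeasureSample P Λ X) :
    ∀ᵐ ω ∂P, ∀ j, IsFiniteMeasure (X j ω).measure := by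
  refine ae_all_iff.2 fun j => ?_
  filter_upwards [ae_integrable_stieltjes (h.measurable j) (h.mean j)
    (integrable_const (1 : ℝ))] with ω hω
  exact (integrable_const_iff_isFiniteMeasure one_ne_zero).1 hω

/-- The weak law of large numbers for centered integrals, uniformly over the tail. -/
lemma tendsto_measure_exists_centeredSum_ge [IsProbabilityMeasure P] [IsFiniteMeasure Λ]
    (h : IsPoissonMeasureSample P Λ X) (hf : Measurable f) (hfi : Integrable f Λ)
    {N : ℕ → ℕ} (hN : Tendsto N atTop atTop) {ε : ℝ} (hε : 0 < ε) :
    Tendsto (fun n => P {ω | ∃ k, N n ≤ k ∧ ε ≤ ‖(k : ℝ)⁻¹ • centeredSum Λ X f (N n) k ω‖})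
      atTop (𝓝 0) := by
  have h1 := (tendsto_measure_exists_norm_ge
    (fun k => (h.measurable_centeredSum hf 0 k).const_smul ((k : ℝ)⁻¹))
    (h.ae_tendsto_centeredSum hf hfi) (half_pos hε)).comp hN
  refine tendsto_of_tendsto_of_tendsto_of_le_of_le tendsto_const_nhds h1
    (fun _ => zero_le) fun n => measure_mono ?_
  rintro ω ⟨k, hk, hkε⟩
  by_contra hcon
  simp only [Set.mem_ofPred_eq, not_exists, not_and, not_le, Pi.smul_apply] at hcon
  have hk1 := hcon k hk
  have hN1 := hcon (N n) le_rfl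
  rcases Nat.eq_zero_or_pos k with rfl | hk0
  · rw [Nat.cast_zero, inv_zero, zero_smul, norm_zero] at hkε
    linarith
  have hk0' : (0 : ℝ) < k := by exact_mod_cast hk0
  -- The block from N to k is a difference of two sums started at 0, and the second average carries
  -- the weight N/k ≤ 1; smallness of both by ε/2 suffices.
  have h2 : (k : ℝ)⁻¹ • centeredSum Λ X f (N n) k ω = (k : ℝ)⁻¹ • centeredSum Λ X f 0 k ω
      - ((N n : ℝ) / k) • ((N n : ℝ)⁻¹ • centeredSum Λ X f 0 (N n) ω) := by
    rw [centeredSum_eq_sub hk, smul_sub, smul_smul]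
    rcases Nat.eq_zero_or_pos (N n) with h0 | h0
    · simp [h0, centeredSum]
    · have h0' : (0 : ℝ) < N n := by exact_mod_cast h0
      rw [show (N n : ℝ) / k * (N n : ℝ)⁻¹ = (k : ℝ)⁻¹ by field_simp]
  have h3 : (N n : ℝ) / k ≤ 1 := (div_le_one hk0').2 (by exact_mod_cast hk)
  have h4 : ‖((N n : ℝ) / k) • ((N n : ℝ)⁻¹ • centeredSum Λ X f 0 (N n) ω)‖ ≤
      ‖(N n : ℝ)⁻¹ • centeredSum Λ X f 0 (N n) ω‖ := by
    rw [norm_smul, Real.norm_of_nonneg (by positivity)]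
    exact mul_le_of_le_one_left (norm_nonneg _) h3
  rw [h2] at hkε
  have h5 := hkε.trans (norm_sub_le _ _)
  linarith

lemma boundedInProb_centeredSum [IsProbabilityMeasure P] [IsFiniteMeasure Λ]
    (h : IsPoissonMeasureSample P Λ X) (hf : Measurable f) {B : ℝ} (hB : ∀ t, ‖f t‖ ≤ B)
    {N k : ℕ → ℕ} (hk : Tendsto k atTop atTop)
    (hN : Tendsto (fun n => (N n : ℝ) / k n) atTop (𝓝 0)) :
    BoundedInProb P fun n ω => ‖(√(k n : ℝ))⁻¹ • centeredSum Λ X f (N n) (k n) ω‖ := fun _ hε => by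
  obtain ⟨M, -, hM⟩ := h.exists_measure_centeredSum_le hf hB hk hN hε
  exact ⟨M, Eventually.of_forall hM⟩

end IsPoissonMeasureSample

end CenteredSum

/-! ### Adaptedness and uniform consistency -/

section OneStep

variable {d : ℕ} {Ω : Type*} {T : Set ℝ} {Θ : Set (EuclideanSpace ℝ (Fin d))}
  {lam : EuclideanSpace ℝ (Fin d) → ℝ → ℝ} {C c : ℝ} {X : ℕ → Ω → StieltjesFunction ℝ}
  {θbar : ℕ → Ω → EuclideanSpace ℝ (Fin d)} {θ₀ : EuclideanSpace ℝ (Fin d)}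

namespace RegularModel

/-- Measurability of the estimator involves no probability, so it can be applied on Ω with the
σ-algebra of the first k observations. -/
lemma measurable_obsSigma_oneStepMLE (h : RegularModel T Θ lam C c) (hθ₀ : θ₀ ∈ Θ)
    {N k : ℕ} (hNk : N ≤ k) (hθbar : Measurable[obsSigma X N] (θbar N)) :
    Measurable[obsSigma X k] (oneStepMLE T Θ lam X θbar N k) := by
  refine @measurable_oneStepMLE d Ω T Θ lam C c X θbar θ₀ (obsSigma X k) h hθ₀ N k
    (fun j hj t => (measurable_pathSigma (X j) t).mono ?_ le_rfl) (hθbar.mono ?_ le_rfl)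
  · exact le_iSup₂_of_le j (Finset.mem_range.2 hj) le_rfl
  · exact biSup_mono fun j hj => Finset.mem_range.2 ((Finset.mem_range.1 hj).trans_le hNk)

variable [MeasurableSpace Ω] {P : Measure Ω}

/-- Uniform consistency of the one-step estimator. -/
lemma tendsto_measure_exists_oneStepMLE_ge [IsProbabilityMeasure P]
    (h : RegularModel T Θ lam C c) (hθ₀ : θ₀ ∈ Θ) (hX : IsPoissonSample P T (lam θ₀) X)
    (hθbar : SmallInProb P fun n ω => ‖θbar n ω - θ₀‖) {N : ℕ → ℕ} (hN : Tendsto N atTop atTop)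
    {ε : ℝ} (hε : 0 < ε) :
    Tendsto (fun n => P {ω | ∃ k, N n < k ∧ ε ≤ ‖oneStepMLE T Θ lam X θbar (N n) k ω - θ₀‖})
      atTop (𝓝 0) := by
  obtain ⟨L, hL, hbound⟩ := h.exists_norm_oneStepMLE_sub_le (X := X) (θbar := θbar) hθ₀
  set Λ := intensityMeasure T (lam θ₀) with hΛ
  have : IsFiniteMeasure Λ := h.isFiniteMeasure_intensityMeasure hθ₀
  have hS := h.isPoissonMeasureSample hθ₀ hX
  have hc := h.info_pos
  obtain ⟨r, hr, hball⟩ := Metric.isOpen_iff.1 h.isOpen θ₀ hθ₀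
  set m := Λ.real Set.univ with hm
  have hm0 : 0 ≤ m := measureReal_nonneg
  -- On the good event each term is at most a multiple of η: c⁻¹ from the leading term, 1 from
  -- (N/k)ρ and, inside L, 2 + m from the event counts, d from the derivative sums and 1 from S/k.
  set K := c⁻¹ + 1 + L * ((2 + m) + d + 1) with hK
  have hK0 : 0 < K := by positivity
  -- One threshold serves all good events: η ≤ r puts θ̄ in Θ, and η ≤ 1 lets squares be bounded by
  -- η.
  obtain ⟨η, hη0, hη1, hηr, hηK⟩ : ∃ η : ℝ, 0 < η ∧ η ≤ 1 ∧ η ≤ r ∧ K * η < ε := by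
    refine ⟨min (min 1 r) (ε / (2 * K)), by positivity, ?_, ?_, ?_⟩
    · exact (min_le_left _ _).trans (min_le_left _ _)
    · exact (min_le_left _ _).trans (min_le_right _ _)
    · calc K * min (min 1 r) (ε / (2 * K)) ≤ K * (ε / (2 * K)) := by
            gcongr
            exact min_le_right _ _
        _ = ε / 2 := by field_simp
        _ < ε := by linarith
  have hsI : Integrable (T.indicator (score lam θ₀)) Λ :=
    Integrable.of_bound (h.measurable_score θ₀ hθ₀).aestronglyMeasurable C
      (ae_of_all _ (h.norm_indicator_score_le hθ₀))
  have hdI : ∀ b, Integrable (scoreDeriv T lam θ₀ b) Λ := fun b =>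
    Integrable.of_bound (h.measurable_scoreDeriv hθ₀ b).aestronglyMeasurable C
      (ae_of_all _ (h.norm_scoreDeriv_le hθ₀ b))
  have t0 := (hθbar.comp hN) η hη0
  have t1 := hS.tendsto_measure_exists_centeredSum_ge (h.measurable_score θ₀ hθ₀) hsI hN hη0
  have t2 := hS.tendsto_measure_exists_centeredSum_ge (f := fun _ => (1 : ℝ)) measurable_const
    (integrable_const _) hN hη0
  have t3 := tendsto_finsetSum (Finset.univ : Finset (Fin d)) fun b _ =>
    hS.tendsto_measure_exists_centeredSum_ge (h.measurable_scoreDeriv hθ₀ b) (hdI b) hN hη0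
  have t := ((t0.add t1).add t2).add t3
  simp only [Finset.sum_const_zero, add_zero] at t
  refine tendsto_of_tendsto_of_tendsto_of_le_of_le tendsto_const_nhds t (fun _ => zero_le)
    fun n => ?_
  refine le_trans ?_ (add_le_add_right (measure_iUnion_fintype_le P _) _)
  refine le_trans ?_ (add_le_add_left (add_le_add_left (measure_union_le _ _) _) _)
  refine le_trans ?_ (add_le_add_left (measure_union_le _ _) _)
  refine le_trans ?_ (measure_union_le _ _)
  refine measure_mono_ae ?_
  filter_upwards [hS.ae_isFiniteMeasure] with ω hfin
  rintro ⟨k, hNk, hkε⟩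
  by_contra hcon
  have hcon' : ω ∉ (_ : Set Ω) := hcon
  simp only [Set.mem_union, Set.mem_iUnion, Set.mem_ofPred_eq, not_or, not_exists, not_and,
    not_le] at hcon'
  obtain ⟨⟨⟨hρ, h1⟩, h2⟩, h3⟩ := hcon'
  have h1' := (h1 k hNk.le).le
  have h2' := (le_abs_self _).trans ((Real.norm_eq_abs _).symm.le.trans (h2 k hNk.le).le)
  have h3' := fun b => (h3 b k hNk.le).le
  have hk : 0 < k := (Nat.zero_le _).trans_lt hNk
  have hk0 : (0 : ℝ) < k := by exact_mod_cast hk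
  have hmem : θbar (N n) ω ∈ Θ := hball (by
    rw [Metric.mem_ball, dist_eq_norm]
    exact hρ.trans_le hηr)
  have hb := hbound ω hfin (N n) k hNk.le hk hmem
  set ρ := ‖θbar (N n) ω - θ₀‖ with hρd
  have hρ0 : 0 ≤ ρ := norm_nonneg _
  have hA : (k : ℝ)⁻¹ * ∑ j ∈ Finset.Ico (N n) k, (X j ω).measure.real Set.univ ≤ 1 + m := by
    rw [sum_measureReal_univ_eq (Λ := Λ) hNk.le, mul_add]
    refine add_le_add (h2'.trans hη1) ?_
    rw [inv_mul_le_iff₀ hk0]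
    have : (0 : ℝ) ≤ N n := Nat.cast_nonneg _
    nlinarith
  have hH : ∑ b, ‖(k : ℝ)⁻¹ • centeredSum Λ X (scoreDeriv T lam θ₀ b) (N n) k ω‖ ≤ d := by
    refine (Finset.sum_le_card_nsmul _ _ 1 fun b _ => (h3' b).trans hη1).trans ?_
    simp
  have hfrac : (N n : ℝ) / k ≤ 1 := (div_le_one hk0).2 (by exact_mod_cast hNk.le)
  have hmain : ‖oneStepMLE T Θ lam X θbar (N n) k ω - θ₀‖ ≤ K * η := by
    set v := (k : ℝ)⁻¹ • centeredSum Λ X (T.indicator (score lam θ₀)) (N n) k ω with hv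
    have e1 : ‖oneStepMLE T Θ lam X θbar (N n) k ω - θ₀‖ ≤
        ‖oneStepMLE T Θ lam X θbar (N n) k ω - θ₀ - infoInv T lam θ₀ v‖ + ‖infoInv T lam θ₀ v‖ := by
      simpa using norm_add_le (oneStepMLE T Θ lam X θbar (N n) k ω - θ₀ - infoInv T lam θ₀ v)
        (infoInv T lam θ₀ v)
    have e2 : ‖infoInv T lam θ₀ v‖ ≤ c⁻¹ * η := (h.norm_infoInv_le hθ₀ v).trans (by gcongr)
    have e3 : ρ ^ 2 ≤ η * 1 := by
      rw [sq]
      exact mul_le_mul hρ.le (hρ.le.trans hη1) hρ0 hη0.le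
    refine (e1.trans (add_le_add hb e2)).trans ?_
    have e4 : ‖v‖ ≤ 1 := h1'.trans hη1
    clear_value ρ
    generalize ‖v‖ = q at e4 ⊢
    generalize (k : ℝ)⁻¹ * ∑ j ∈ Finset.Ico (N n) k, (X j ω).measure.real Set.univ = A at hA ⊢
    generalize ∑ b, ‖(k : ℝ)⁻¹ • centeredSum Λ X (scoreDeriv T lam θ₀ b) (N n) k ω‖ = B at hH ⊢
    generalize (N n : ℝ) / k = z at hfrac ⊢
    have f1 : z * ρ ≤ η := (mul_le_of_le_one_left hρ0 hfrac).trans hρ.le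
    have f2 : ρ ^ 2 * (1 + A) ≤ η * (2 + m) := by
      calc ρ ^ 2 * (1 + A) ≤ ρ ^ 2 * (2 + m) :=
            mul_le_mul_of_nonneg_left (by linarith) (sq_nonneg ρ)
        _ ≤ η * (2 + m) := mul_le_mul_of_nonneg_right (by linarith) (by positivity)
    have f3 : ρ * B ≤ η * d :=
      (mul_le_mul_of_nonneg_left hH hρ0).trans
        (mul_le_mul_of_nonneg_right hρ.le (Nat.cast_nonneg d))
    have f4 : ρ * q ≤ η := (mul_le_of_le_one_right hρ0 e4).trans hρ.le
    have f5 : L * (ρ ^ 2 * (1 + A) + ρ * B + ρ * q) ≤ L * (η * (2 + m) + η * d + η) := by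
      gcongr
    rw [hK]
    linarith
  linarith

end RegularModel

end OneStep

/-! ### Asymptotic normality -/

section AsymptoticNormality

variable {d : ℕ} {Ω : Type*} {T : Set ℝ} {Θ : Set (EuclideanSpace ℝ (Fin d))}
  {lam : EuclideanSpace ℝ (Fin d) → ℝ → ℝ} {C c : ℝ} {X : ℕ → Ω → StieltjesFunction ℝ}
  {θbar : ℕ → Ω → EuclideanSpace ℝ (Fin d)} {θ₀ : EuclideanSpace ℝ (Fin d)}

/-- The efficient influence function. -/
noncomputable def influence (T : Set ℝ) (lam : EuclideanSpace ℝ (Fin d) → ℝ → ℝ)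
    (θ : EuclideanSpace ℝ (Fin d)) (t : ℝ) : EuclideanSpace ℝ (Fin d) :=
  infoInv T lam θ (T.indicator (score lam θ) t)

namespace RegularModel

lemma measurable_influence (h : RegularModel T Θ lam C c) (hθ₀ : θ₀ ∈ Θ) :
    Measurable (influence T lam θ₀) :=
  (infoInv T lam θ₀).continuous_of_finiteDimensional.measurable.comp (h.measurable_score θ₀ hθ₀)

lemma norm_influence_le (h : RegularModel T Θ lam C c) (hθ₀ : θ₀ ∈ Θ) (t : ℝ) :
    ‖influence T lam θ₀ t‖ ≤ c⁻¹ * C :=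
  (h.norm_infoInv_le hθ₀ _).trans (mul_le_mul_of_nonneg_left (h.norm_indicator_score_le hθ₀ t)
    (inv_pos.2 h.info_pos).le)

lemma centeredSum_influence (h : RegularModel T Θ lam C c) (hθ₀ : θ₀ ∈ Θ) {ω : Ω}
    (hfin : ∀ j, IsFiniteMeasure (X j ω).measure) (N k : ℕ) :
    centeredSum (intensityMeasure T (lam θ₀)) X (influence T lam θ₀) N k ω =
      infoInv T lam θ₀ (centeredSum (intensityMeasure T (lam θ₀)) X
        (T.indicator (score lam θ₀)) N k ω) := by
  have hint : ∀ (ν : Measure ℝ) [IsFiniteMeasure ν], ∫ t, influence T lam θ₀ t ∂ν =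
      infoInv T lam θ₀ (∫ t, T.indicator (score lam θ₀) t ∂ν) := fun ν _ =>
    (infoInv T lam θ₀).toContinuousLinearMap.integral_comp_comm
      (Integrable.of_bound (h.measurable_score θ₀ hθ₀).aestronglyMeasurable C
        (ae_of_all _ (h.norm_indicator_score_le hθ₀)))
  have := h.isFiniteMeasure_intensityMeasure hθ₀
  rw [centeredSum, centeredSum, map_sum]
  refine Finset.sum_congr rfl fun j _ => ?_
  have := hfin j
  rw [hint, hint, map_sub]

variable [MeasurableSpace Ω] {P : Measure Ω} [IsProbabilityMeasure P]

/-- The central limit theorem for the efficient influence function. -/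
lemma tendstoInDistribution_centeredSum_influence (h : RegularModel T Θ lam C c) (hθ₀ : θ₀ ∈ Θ)
    (hX : IsPoissonSample P T (lam θ₀) X) {N k : ℕ → ℕ} (hk : Tendsto k atTop atTop)
    (hNk : Tendsto (fun n => (N n : ℝ) / k n) atTop (𝓝 0)) :
    TendstoInDistribution (fun n ω => (√(k n : ℝ))⁻¹ •
        centeredSum (intensityMeasure T (lam θ₀)) X (influence T lam θ₀) (N n) (k n) ω)
      atTop id (fun _ => P) (multivariateGaussian 0 (fisherInfo T lam θ₀)⁻¹) := by
  have hS := h.isPoissonMeasureSample hθ₀ hX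
  have := h.isFiniteMeasure_intensityMeasure hθ₀
  refine ⟨fun n => Measurable.aemeasurable <| Measurable.const_smul (M := ℝ)
    (hS.measurable_centeredSum (h.measurable_influence hθ₀) _ _) _, aemeasurable_id, ?_⟩
  refine ProbabilityMeasure.tendsto_of_tendsto_charFun fun u => ?_
  have h1 := hS.tendsto_charFun_centeredSum (h.measurable_influence hθ₀)
    (h.norm_influence_le hθ₀) hk hNk u
  have h2 : ∫ t, (inner ℝ (influence T lam θ₀ t) u) ^ 2 ∂intensityMeasure T (lam θ₀) =
      u.ofLp ⬝ᵥ (fisherInfo T lam θ₀)⁻¹.mulVec u.ofLp := by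
    rw [h.integral_intensityMeasure hθ₀, ← h.integral_inner_infoInv_score_sq hθ₀]
    refine setIntegral_congr_fun h.measurableSet fun t ht => ?_
    simp only [influence, Set.indicator_of_mem ht, smul_eq_mul]
  rw [h2] at h1
  have h3 : charFun ((multivariateGaussian 0 (fisherInfo T lam θ₀)⁻¹).map id) u =
      Complex.exp (-(u.ofLp ⬝ᵥ (fisherInfo T lam θ₀)⁻¹.mulVec u.ofLp : ℝ) / 2) := by
    rw [Measure.map_id, charFun_multivariateGaussian (h.posSemidef_fisherInfo_inv hθ₀)]
    simp [neg_div]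
  simp only [ProbabilityMeasure.coe_mk]
  rw [h3]
  exact h1

/-- The remainder in the expansion of the one-step estimator is negligible. -/
lemma smallInProb_oneStepMLE_sub (h : RegularModel T Θ lam C c) (hθ₀ : θ₀ ∈ Θ)
    (hX : IsPoissonSample P T (lam θ₀) X) (hsmall : SmallInProb P fun n ω => ‖θbar n ω - θ₀‖)
    (hbdd : BoundedInProb P fun n ω => ‖√(n : ℝ) • (θbar n ω - θ₀)‖)
    {N k : ℕ → ℕ} (hN : Tendsto N atTop atTop) (hk : Tendsto k atTop atTop)
    (hNk : Tendsto (fun n => (N n : ℝ) / k n) atTop (𝓝 0))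
    (hkN : Tendsto (fun n => √(k n : ℝ) / N n) atTop (𝓝 0)) :
    SmallInProb P fun n ω => ‖√(k n : ℝ) • (oneStepMLE T Θ lam X θbar (N n) (k n) ω - θ₀) -
      (√(k n : ℝ))⁻¹ • centeredSum (intensityMeasure T (lam θ₀)) X (influence T lam θ₀)
        (N n) (k n) ω‖ := by
  obtain ⟨L, hL, hbound⟩ := h.exists_norm_oneStepMLE_sub_le (X := X) (θbar := θbar) hθ₀
  set Λ := intensityMeasure T (lam θ₀) with hΛ
  have : IsFiniteMeasure Λ := h.isFiniteMeasure_intensityMeasure hθ₀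
  have hS := h.isPoissonMeasureSample hθ₀ hX
  obtain ⟨r, hr, hball⟩ := Metric.isOpen_iff.1 h.isOpen θ₀ hθ₀
  set m := Λ.real Set.univ with hm
  have hm0 : 0 ≤ m := measureReal_nonneg
  have b0 := hbdd.comp hN
  have b1 := hS.boundedInProb_centeredSum (h.measurable_score θ₀ hθ₀)
    (h.norm_indicator_score_le hθ₀) hk hNk
  have b2 := hS.boundedInProb_centeredSum (f := fun _ => (1 : ℝ)) measurable_const
    (B := 1) (by simp) hk hNk
  have b3 := BoundedInProb.sum Finset.univ fun b : Fin d =>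
    hS.boundedInProb_centeredSum (h.measurable_scoreDeriv hθ₀ b) (h.norm_scoreDeriv_le hθ₀ b) hk hNk
  have s0 := hsmall.comp hN
  have hNk' : Tendsto (fun n => √((N n : ℝ) / k n)) atTop (𝓝 0) := by
    simpa using hNk.sqrt
  -- This is √k (N/k) ρ = √(N/k) · √N ρ.
  have z1 := (SmallInProb.of_tendsto (P := P) hNk').mul_boundedInProb b0 fun _ _ => norm_nonneg _
  -- This is √k ρ² = (√k/N)(√N ρ)², times a tight factor bounding the average number of events.
  have z2 := (SmallInProb.of_tendsto (P := P) hkN).mul_boundedInProb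
    ((b0.mul b0 fun _ _ => norm_nonneg _).mul ((BoundedInProb.const P (1 + m)).add b2)
      fun _ _ => by positivity) fun _ _ => by positivity
  -- In the mixed terms the factor √k turns the averages H/k and S/k into tight normalized sums,
  -- leaving ρ → 0 in front.
  have z3 := s0.mul_boundedInProb b3 fun _ _ => Finset.sum_nonneg fun _ _ => norm_nonneg _
  have z4 := s0.mul_boundedInProb b1 fun _ _ => norm_nonneg _
  have z5 := ((z2.add z3).add z4).mul_boundedInProb (BoundedInProb.const P L) fun _ _ => hL.le
  refine (z1.add z5).mono (hsmall.comp hN r hr) ?_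
  filter_upwards [hN.eventually_gt_atTop 0, hk.eventually_gt_atTop 0,
    hNk.eventually_lt_const one_pos] with n hN0 hk0 hlt
  have hN0' : (0 : ℝ) < N n := by exact_mod_cast hN0
  have hk0' : (0 : ℝ) < k n := by exact_mod_cast hk0
  have hk1 : (1 : ℝ) ≤ k n := by exact_mod_cast hk0
  have hle : N n ≤ k n := by
    rw [div_lt_one hk0'] at hlt
    exact_mod_cast hlt.le
  filter_upwards [hS.ae_isFiniteMeasure] with ω hfin hω
  have hmem : θbar (N n) ω ∈ Θ := hball (by
    rw [Metric.mem_ball, dist_eq_norm]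
    exact not_le.1 hω)
  have hb := hbound ω hfin (N n) (k n) hle hk0 hmem
  set q := √(k n : ℝ) with hq
  have hq0 : 0 < q := Real.sqrt_pos.2 hk0'
  have hqq : q * q = k n := Real.mul_self_sqrt hk0'.le
  have hqk : q * (k n : ℝ)⁻¹ = q⁻¹ := by
    rw [← hqq]
    field_simp
  have hscale : ∀ v : EuclideanSpace ℝ (Fin d), q * ‖(k n : ℝ)⁻¹ • v‖ = ‖q⁻¹ • v‖ := fun v => by
    rw [← hqk, mul_smul, norm_smul q, Real.norm_of_nonneg hq0.le]
  have hA : (k n : ℝ)⁻¹ * ∑ j ∈ Finset.Ico (N n) (k n), (X j ω).measure.real Set.univ ≤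
      m + ‖q⁻¹ • centeredSum Λ X (fun _ => (1 : ℝ)) (N n) (k n) ω‖ := by
    rw [sum_measureReal_univ_eq (Λ := Λ) hle, mul_add, add_comm]
    refine add_le_add ?_ ?_
    · rw [inv_mul_le_iff₀ hk0']
      nlinarith
    · have hq1 : 1 ≤ q := Real.one_le_sqrt.2 hk1
      -- Only boundedness of the average count is needed, so its fluctuation may be normalized by √k
      -- instead of k.
      have hqk' : (k n : ℝ)⁻¹ ≤ q⁻¹ := inv_anti₀ hq0 (by nlinarith)
      rw [norm_smul, Real.norm_of_nonneg (inv_pos.2 hq0).le]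
      exact (mul_le_mul_of_nonneg_left (Real.le_norm_self _) (inv_pos.2 hk0').le).trans
        (mul_le_mul_of_nonneg_right hqk' (norm_nonneg _))
  rw [h.centeredSum_influence hθ₀ hfin]
  have hlhs : q • (oneStepMLE T Θ lam X θbar (N n) (k n) ω - θ₀) - q⁻¹ • infoInv T lam θ₀
      (centeredSum Λ X (T.indicator (score lam θ₀)) (N n) (k n) ω) =
      q • (oneStepMLE T Θ lam X θbar (N n) (k n) ω - θ₀ - infoInv T lam θ₀ ((k n : ℝ)⁻¹ •
        centeredSum Λ X (T.indicator (score lam θ₀)) (N n) (k n) ω)) := by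
    rw [smul_sub q (oneStepMLE T Θ lam X θbar (N n) (k n) ω - θ₀), map_smul, smul_smul, hqk]
  rw [hlhs, norm_smul, Real.norm_of_nonneg hq0.le]
  refine (mul_le_mul_of_nonneg_left hb hq0.le).trans ?_
  rw [norm_smul √(N n : ℝ), Real.norm_of_nonneg (Real.sqrt_nonneg _), Real.sqrt_div hN0'.le, ← hq]
  simp only [← hscale, ← Finset.mul_sum]
  set ρ := ‖θbar (N n) ω - θ₀‖ with hρ
  have hρ0 : 0 ≤ ρ := norm_nonneg _
  have hNN : √(N n : ℝ) * √(N n : ℝ) = N n := Real.mul_self_sqrt hN0'.le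
  generalize √(N n : ℝ) = p at hNN ⊢
  generalize (k n : ℝ)⁻¹ * ∑ j ∈ Finset.Ico (N n) (k n), (X j ω).measure.real Set.univ = A at hA ⊢
  generalize ∑ b, ‖(k n : ℝ)⁻¹ • centeredSum Λ X (scoreDeriv T lam θ₀ b) (N n) (k n) ω‖ = B
  generalize ‖(k n : ℝ)⁻¹ • centeredSum Λ X (T.indicator (score lam θ₀)) (N n) (k n) ω‖ = v
  generalize ‖q⁻¹ • centeredSum Λ X (fun _ => (1 : ℝ)) (N n) (k n) ω‖ = w at hA ⊢
  have e1 : p / q * (p * ρ) = q * ((N n : ℝ) / k n * ρ) := by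
    rw [← hNN, ← hqq]
    field_simp
  have e2 : q / N n * (p * ρ * (p * ρ) * (1 + m + w)) =
      q * (ρ ^ 2 * (1 + (m + w))) := by
    have : p * ρ * (p * ρ) = N n * ρ ^ 2 := by rw [← hNN]; ring
    rw [this]
    field_simp
    ring
  have e3 : q * (ρ ^ 2 * (1 + A)) ≤ q * (ρ ^ 2 * (1 + (m + w))) := by gcongr
  rw [e1, e2, mul_add]
  refine add_le_add le_rfl ?_
  calc q * (L * (ρ ^ 2 * (1 + A) + ρ * B + ρ * v))
      = (q * (ρ ^ 2 * (1 + A)) + ρ * (q * B) + ρ * (q * v)) * L := by ring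
    _ ≤ _ := mul_le_mul_of_nonneg_right (by linarith) hL.le

end RegularModel

end AsymptoticNormality

/-! ### The three claims -/

theorem theorem3 {d : ℕ} {Ω : Type*} [MeasurableSpace Ω] (P : Measure Ω) [IsProbabilityMeasure P]
    (T : Set ℝ) (hT : T.OrdConnected)
    (Θ : Set (EuclideanSpace ℝ (Fin d))) (hΘ_open : IsOpen Θ) (hΘ_convex : Convex ℝ Θ)
    (hΘ_bounded : Bornology.IsBounded Θ)
    (lam : EuclideanSpace ℝ (Fin d) → ℝ → ℝ) (hlam : IsIntensityFamily T Θ lam)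
    (hL0 : RegularityL0 T Θ lam)
    (θ₀ : EuclideanSpace ℝ (Fin d)) (hθ₀ : θ₀ ∈ Θ)
    (X : ℕ → Ω → StieltjesFunction ℝ) (hX : IsPoissonSample P T (lam θ₀) X)
    (θbar : ℕ → Ω → EuclideanSpace ℝ (Fin d)) (hP0 : PreliminaryP0 P X θ₀ θbar)
    (δ : ℝ) (hδ : δ ∈ Set.Ioo (1 / 2 : ℝ) 1) :
    (∀ n k : ℕ, learnSize δ n < k → k ≤ n →
      Measurable[obsSigma X k] (oneStepMLE T Θ lam X θbar (learnSize δ n) k)) ∧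
    (∀ ε : ℝ, 0 < ε → Tendsto (fun n : ℕ => P {ω | ∃ k : ℕ, learnSize δ n < k ∧ k ≤ n ∧
      ε ≤ ‖oneStepMLE T Θ lam X θbar (learnSize δ n) k ω - θ₀‖}) atTop (𝓝 0)) ∧
    (∀ s ∈ Set.Ioc (0 : ℝ) 1, TendstoInDistribution
      (fun (n : ℕ) ω => √(⌊s * n⌋₊ : ℝ) •
        (oneStepMLE T Θ lam X θbar (learnSize δ n) ⌊s * n⌋₊ ω - θ₀))
      atTop id (fun _ => P) (multivariateGaussian 0 (fisherInfo T lam θ₀)⁻¹)) := by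
  obtain ⟨C, c, h⟩ := exists_regularModel hT hΘ_open hΘ_convex hΘ_bounded hlam hL0
  have hδ0 : 0 < δ := one_half_pos.trans hδ.1
  have hN := tendsto_learnSize hδ0
  have hsmall : SmallInProb P fun n ω => ‖θbar n ω - θ₀‖ :=
    tendstoInMeasure_iff_norm.1 hP0.consistent
  have hbdd : BoundedInProb P fun n ω => ‖√(n : ℝ) • (θbar n ω - θ₀)‖ := fun ε hε =>
    (hP0.bounded_in_prob ε hε).imp fun _ hM => Eventually.of_forall hM
  refine ⟨fun n k hk _ => h.measurable_obsSigma_oneStepMLE hθ₀ hk.le (hP0.estimator _),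
    fun ε hε => ?_, fun s hs => ?_⟩
  -- The event is enlarged by dropping k ≤ n: consistency holds uniformly over all k > N.
  · refine tendsto_of_tendsto_of_tendsto_of_le_of_le tendsto_const_nhds
      (h.tendsto_measure_exists_oneStepMLE_ge hθ₀ hX hsmall hN hε) (fun _ => zero_le)
      fun n => measure_mono ?_
    rintro ω ⟨k, hk, -, hkε⟩
    exact ⟨k, hk, hkε⟩
  · have hk := tendsto_natFloor_mul hs.1
    have hNk := tendsto_learnSize_div hδ.2 hs.1
    have hθbar : ∀ N, Measurable (θbar N) := fun N => (hP0.estimator N).mono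
      (iSup₂_le fun j _ => pathSigma_le (hX.poisson j).measurable) le_rfl
    -- Slutsky's lemma: the central limit theorem for the leading term plus a remainder negligible
    -- in probability.
    refine tendstoInDistribution_of_tendstoInMeasure_sub _ _
      (h.tendstoInDistribution_centeredSum_influence hθ₀ hX hk hNk) ?_ fun n => ?_
    · refine tendstoInMeasure_iff_norm.2 ?_
      simpa [SmallInProb] using h.smallInProb_oneStepMLE_sub hθ₀ hX hsmall hbdd hN hk hNk
        (tendsto_sqrt_div_learnSize hδ.1 hs.2)
    · exact (((h.measurable_oneStepMLE hθ₀ (fun j _ => (hX.poisson j).measurable)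
        (hθbar _)).sub_const θ₀).const_smul (√(⌊s * n⌋₊ : ℝ))).aemeasurable
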